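/- Let $0<\beta<1/2$ and $0\le\theta\le 1$. For $\phi\in L^1(0,1)$ and $x\in[0,1]$ put $${}_0^lI_x^{\beta}\phi=\frac1{\Gamma(\beta)}\int_0^x\frac{\phi(s)}{(x-s)^{1-\beta}}\,ds,\qquad {}_x^rI_1^{\beta}\phi=\frac1{\Gamma(\beta)}\int_x^1\frac{\phi(s)}{(s-x)^{1-\beta}}\,ds,$$ $$I^\beta_\theta\phi(x)=\theta\;{}_0^lI_x^{\beta}\phi+(1-\theta)\;{}_x^rI_1^{\beta}\phi .$$ All functions are real valued. Let $H^1(0,1)$ be the space of functions in $L^2(0,1)$ with weak derivative in $L^2(0,1)$, with norm $\|g\|_{H^1(0,1)}=(\|g\|_{L^2(0,1)}^2+\|g'\|_{L^2(0,1)}^2)^{1/2}$; $g(0)$ and $g(1)$ are the boundary values of the continuous representative of $g$. Let $H^1_0(0,1)$ be the closure of $C_0^\infty(0,1)$ in $H^1(0,1)$. Let $H^{1-\beta}_0(0,1)$ be the completion of $C_0^\infty(0,1)$ (realized as functions on $(0,1)$) in the norm $$\|\phi\|_{H^{1-\beta}(0,1)}=\Big(\|\tilde\phi\|^2_{L^2(\mathbb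 R)}+\big\||\omega|^{1-\beta}\mathcal F\tilde\phi\big\|_{L^2(\mathbb R)}^2\Big)^{1/2},$$ where $\tilde\phi$ is the extension of $\phi$ by zero to $\mathbb R$ and $\mathcal F$ is the Fourier transform (unitary on $L^2(\mathbb R)$, in the angular frequency $\omega$). **Theorem 4.3.** (i) For each $g\in H^1(0,1)$ the integral equation $$I^\beta_\theta\phi(x)+\big(g(0)-(1-\theta)\,{}_0^rI_1^{\beta}\phi\big)(1-x)+\big(g(1)-\theta\,{}_0^lI_1^{\beta}\phi\big)\,x=g(x)\quad\text{for a.e. }x\in(0,1)\qquad(*)$$ has a unique solution $\phi\in H^{1-\beta}_0(0,1)$. (ii) Conversely, for each $\phi\in H_0^{1-\beta}(0,1)$ the function $$I^\beta_\theta\phi(x)-(1-\theta)\big({}_0^rI_1^{\beta}\phi\big)(1-x)-\theta\big({}_0^lI_1^{\beta}\phi\big)\,x$$ belongs to $H^1_0(0,1)$. (iii) There are constants $C_3,C_4>0$, depending only on $\beta$ and $\theta$, such that $$C_3\|\phi\|_{H^{1-\beta}(0,1)}\le\|g\|_{H^1(0,1)}\le C_4\|\phi\|_{H^{1-\beta}(0,1)}$$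 for all $g\in H^1_0(0,1)$, where $\phi\in H^{1-\beta}_0(0,1)$ is the solution of $(*)$. -/

import Mathlib

open MeasureTheory Set

namespace FracInt

noncomputable section

/-! Elements of `L²(0,1)` are given as functions `ℝ → ℝ`, of which only the values on `(0,1)`, up to
null sets, matter. -/

/-- Lebesgue measure on `(0,1)`. -/
abbrev vol01 : Measure ℝ := volume.restrict (Ioo 0 1)

/-- `C₀^∞(0,1)`: smooth functions with compact support contained in `(0,1)`. -/
def IsTest (w : ℝ → ℝ) : Prop :=
  ContDiff ℝ (⊤ : ℕ∞) w ∧ HasCompactSupport w ∧ tsupport w ⊆ Ioo 0 1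

/-- `d ∈ L²(0,1)` is a weak derivative of `g` on `(0,1)`. -/
def HasWeakDeriv (g d : ℝ → ℝ) : Prop :=
  MemLp d 2 vol01 ∧ ∀ η : ℝ → ℝ, IsTest η →
    ∫ x, g x * deriv η x ∂vol01 = -∫ x, d x * η x ∂vol01

/-- `g ∈ H¹(0,1)`: `g` and its weak derivative are in `L²(0,1)`. -/
def MemH1 (g : ℝ → ℝ) : Prop :=
  MemLp g 2 vol01 ∧ ∃ d, HasWeakDeriv g d

open Classical in
/-- The weak derivative `Dg` of `g ∈ H¹(0,1)` (unique up to null sets). -/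
def weakDeriv (g : ℝ → ℝ) : ℝ → ℝ :=
  if h : ∃ d, HasWeakDeriv g d then h.choose else 0

/-- `‖g‖_{H¹(0,1)} = (‖g‖² + ‖Dg‖²)^{1/2}`, for `g ∈ H¹(0,1)`. -/
def h1Norm (g : ℝ → ℝ) : ℝ :=
  Real.sqrt ((∫ x, g x ^ 2 ∂vol01) + ∫ x, weakDeriv g x ^ 2 ∂vol01)

/-- `H¹₀(0,1)`: the closure of `C₀^∞(0,1)` in `H¹(0,1)`. -/
def MemH10 (g : ℝ → ℝ) : Prop :=
  MemH1 g ∧ ∀ ε > 0, ∃ w, IsTest w ∧ h1Norm (fun x ↦ g x - w x) < ε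

open Classical in
/-- The continuous representative on `[0,1]` of `g ∈ H¹(0,1)` (unique on `[0,1]`); the boundary
values `g(0)`, `g(1)` are its values. -/
def contRep (g : ℝ → ℝ) : ℝ → ℝ :=
  if h : ∃ G : ℝ → ℝ, ContinuousOn G (Icc 0 1) ∧ G =ᵐ[vol01] g then h.choose else 0

/-- Extension by zero from `(0,1)` to `ℝ`. -/
def zeroExt (φ : ℝ → ℝ) : ℝ → ℝ := (Ioo (0 : ℝ) 1).indicator φ

open scoped FourierTransform in
/-- `|ω|^μ |ŵ(ω)|`, where `w` is the zero extension of `φ ∈ L²(0,1)` (so `w ∈ L¹(ℝ) ∩ L²(ℝ)`).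
Mathlib's Fourier transform is written in the frequency variable `ξ` with `ω = 2πξ`. -/
def fourierWeight (μ : ℝ) (φ : ℝ → ℝ) (ξ : ℝ) : ℝ :=
  |2 * Real.pi * ξ| ^ μ * ‖𝓕 (fun x ↦ (zeroExt φ x : ℂ)) ξ‖

/-- `‖φ‖_{H^μ} = (‖w‖²_{L²(ℝ)} + ‖|ω|^μ ŵ‖²_{L²(ℝ)})^{1/2}`, where `w` is the zero extension of `φ`. -/
def hNorm (μ : ℝ) (φ : ℝ → ℝ) : ℝ :=
  Real.sqrt ((∫ x, φ x ^ 2 ∂vol01) + ∫ ξ, fourierWeight μ φ ξ ^ 2)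

/-- `H^μ₀(0,1)`, for `μ > 0`: the functions `φ` on `(0,1)` of finite `H^μ(ℝ)` norm (after extension
by zero) which are limits of functions in `C₀^∞(0,1)` in that norm. -/
def MemH0 (μ : ℝ) (φ : ℝ → ℝ) : Prop :=
  MemLp φ 2 vol01 ∧ MemLp (fourierWeight μ φ) 2 volume ∧
    ∀ ε > 0, ∃ w, IsTest w ∧ hNorm μ (fun x ↦ φ x - w x) < ε

/-- The left fractional integral of order `σ` on `(0,1)`, at `x ∈ [0,1]`. -/
def leftInt (σ : ℝ) (w : ℝ → ℝ) (x : ℝ) : ℝ :=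
  1 / Real.Gamma σ * ∫ s in Ioo 0 x, w s / (x - s) ^ (1 - σ)

/-- The right fractional integral of order `σ` on `(0,1)`, at `x ∈ [0,1]`. -/
def rightInt (σ : ℝ) (w : ℝ → ℝ) (x : ℝ) : ℝ :=
  1 / Real.Gamma σ * ∫ s in Ioo x 1, w s / (s - x) ^ (1 - σ)

/-- The two-sided fractional integral operator `I^β_θ`. -/
def twoSidedInt (β θ : ℝ) (w : ℝ → ℝ) (x : ℝ) : ℝ :=
  θ * leftInt β w x + (1 - θ) * rightInt β w x

/-- `φ` solves the integral equation with right-hand side `g ∈ H¹(0,1)`. -/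
def Solves (β θ : ℝ) (g φ : ℝ → ℝ) : Prop :=
  (fun x ↦ twoSidedInt β θ φ x
      + (contRep g 0 - (1 - θ) * rightInt β φ 0) * (1 - x)
      + (contRep g 1 - θ * leftInt β φ 1) * x) =ᵐ[vol01] g

end

end FracInt

open FracInt

/-! For a test function `w` the left and right fractional derivatives `L w = (₀I^β w)'` and `R w =
(I₁^β w)'` have Fourier symbols `iω (iω)^{-β}` and `iω (-iω)^{-β}`. Since `L w` vanishes to the
left of `0` and `R w` to the right of `1`, Plancherel's identity gives `⟪L w, R w⟫ = cos(πβ) ∫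
|ω|^{2(1-β)} |ŵ|²` on `(0,1)`, so that `A = θ L + (1 - θ) R` satisfies `‖A w‖ ≥ c ‖w‖` with the
`H^{1-β}` norm of `w` on the right. For `θ = 1` the range of `A` is orthogonal to `(1 - x)^{-β}`,
and by the method of continuity it is not dense for any `θ`. Conversely, a function orthogonal
both to the range and to the constants vanishes, because `⟪A w, w'⟫` is coercive in `L²(0,1)`.
Hence the closure of the range of `A` is a closed hyperplane which does not contain the constants,
and `A` extends to an isomorphism of `H^{1-β}₀(0,1)` onto `L²(0,1)` modulo constants.

The left side of the integral equation is `A φ` integrated, plus the affine function which makes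
the boundary values right, so the equation says precisely that `g'` equals `A φ` modulo constants.
-/

open Filter
open scoped ComplexConjugate ContDiff Convolution FourierTransform Real
open scoped RealInnerProductSpace Topology

namespace FracInt

section Hilbert

variable {V H : Type*} [AddCommGroup V] [Module ℝ V] [NormedAddCommGroup H]
  [InnerProductSpace ℝ H]

theorem denseRange_of_norm_sub_le [CompleteSpace H] {A B : V →ₗ[ℝ] H} {δ : ℝ} (hδ : δ < 1)
    (hAB : ∀ w, ‖B w - A w‖ ≤ δ * ‖A w‖) (hA : DenseRange A) : DenseRange B := by
  have htop : (LinearMap.range B).topologicalClosure = ⊤ := by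
    rw [Submodule.topologicalClosure_eq_top_iff, Submodule.eq_bot_iff]
    intro f hf
    have hclose : ∀ x : H, ‖f‖ ^ 2 ≤ ‖f‖ * (‖f - x‖ + δ * ‖x‖) := fun x ↦ by
      refine hA.induction_on (p := fun x ↦ ‖f‖ ^ 2 ≤ ‖f‖ * (‖f - x‖ + δ * ‖x‖)) x
        (isClosed_le (by fun_prop) (by fun_prop)) fun w ↦ ?_
      have horth : ⟪f, B w⟫ = 0 := by rw [real_inner_comm]; exact hf _ ⟨w, rfl⟩
      calc ‖f‖ ^ 2 = ⟪f, f - B w⟫ := by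
            rw [inner_sub_right, horth, real_inner_self_eq_norm_sq, sub_zero]
        _ ≤ ‖f‖ * ‖(f - A w) - (B w - A w)‖ := by
            rw [sub_sub_sub_cancel_right]; exact real_inner_le_norm _ _
        _ ≤ ‖f‖ * (‖f - A w‖ + δ * ‖A w‖) := by
            gcongr; exact (norm_sub_le _ _).trans (by gcongr; exact hAB w)
    have hself := hclose f
    rw [sub_self, norm_zero, zero_add] at hself
    have : ‖f‖ ^ 2 ≤ 0 := by nlinarith [sq_nonneg ‖f‖]
    simpa using this
  simpa only [DenseRange, LinearMap.coe_range] using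
    Submodule.dense_iff_topologicalClosure_eq_top.2 htop

theorem not_denseRange_of_orthogonal {A : V →ₗ[ℝ] H} {v : H} (hv : v ≠ 0)
    (hvA : ∀ w, ⟪v, A w⟫ = 0) : ¬ DenseRange A := fun hA ↦
  hv <| inner_self_eq_zero.1 <| hA.induction_on (p := fun x ↦ ⟪v, x⟫ = 0) v
    (isClosed_eq (by fun_prop) continuous_const) hvA

/-- The convex combination `θ L + (1 - θ) R` of two linear maps. -/
noncomputable def mixed (L R : V →ₗ[ℝ] H) (θ : ℝ) : V →ₗ[ℝ] H := θ • L + (1 - θ) • R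

theorem mixed_apply (L R : V →ₗ[ℝ] H) (θ : ℝ) (w : V) :
    mixed L R θ w = θ • L w + (1 - θ) • R w := rfl

theorem inner_mixed_add (L R : V →ₗ[ℝ] H) (θ : ℝ) (w : V) :
    ⟪mixed L R θ w, L w + R w⟫ = θ * ‖L w‖ ^ 2 + (1 - θ) * ‖R w‖ ^ 2 + ⟪L w, R w⟫ := by
  simp only [mixed_apply, inner_add_left, inner_add_right, real_inner_smul_left,
    real_inner_self_eq_norm_sq, real_inner_comm (L w) (R w)]
  ring

theorem norm_mixed_le {L R : V →ₗ[ℝ] H} {w : V} {r θ : ℝ} (hL : ‖L w‖ ≤ r) (hR : ‖R w‖ ≤ r)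
    (hθ : θ ∈ Icc (0 : ℝ) 1) : ‖mixed L R θ w‖ ≤ r := by
  have hθ' : 0 ≤ 1 - θ := sub_nonneg.2 hθ.2
  calc ‖mixed L R θ w‖ ≤ ‖θ • L w‖ + ‖(1 - θ) • R w‖ := norm_add_le _ _
    _ = θ * ‖L w‖ + (1 - θ) * ‖R w‖ := by
        rw [norm_smul, norm_smul, Real.norm_of_nonneg hθ.1, Real.norm_of_nonneg hθ']
    _ ≤ θ * r + (1 - θ) * r := by have := hθ.1; gcongr
    _ = r := by ring

theorem norm_mixed_sub_mixed_le {L R : V →ₗ[ℝ] H} {w : V} {r : ℝ} (hL : ‖L w‖ ≤ r)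
    (hR : ‖R w‖ ≤ r) (θ θ' : ℝ) : ‖mixed L R θ w - mixed L R θ' w‖ ≤ |θ - θ'| * (2 * r) := by
  have hsub : mixed L R θ w - mixed L R θ' w = (θ - θ') • (L w - R w) := by
    simp only [mixed_apply]; module
  rw [hsub, norm_smul, Real.norm_eq_abs]
  gcongr
  linarith [norm_sub_le (L w) (R w)]

/-- `L` and `R` are bounded by the seminorm `p`, and their pairing `⟪L w, R w⟫` controls `p`. -/
structure CoercivePair (L R : V →ₗ[ℝ] H) (p : V → ℝ) (γ : ℝ) : Prop where
  norm_left_le : ∀ w, ‖L w‖ ≤ p w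
  norm_right_le : ∀ w, ‖R w‖ ≤ p w
  le_inner : ∀ w, γ * p w ^ 2 ≤ ⟪L w, R w⟫

namespace CoercivePair

variable {L R : V →ₗ[ℝ] H} {p : V → ℝ} {γ : ℝ}

theorem le_norm_mixed (h : CoercivePair L R p γ) {θ : ℝ} (hθ : θ ∈ Icc (0 : ℝ) 1) (w : V) :
    γ / 2 * p w ≤ ‖mixed L R θ w‖ := by
  have hL := h.norm_left_le w
  have hR := h.norm_right_le w
  have key : γ * p w ^ 2 ≤ ‖mixed L R θ w‖ * (2 * p w) := by
    calc γ * p w ^ 2 ≤ ⟪L w, R w⟫ := h.le_inner w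
      _ ≤ ⟪mixed L R θ w, L w + R w⟫ := by
          rw [inner_mixed_add]
          have := mul_nonneg hθ.1 (sq_nonneg ‖L w‖)
          have := mul_nonneg (sub_nonneg.2 hθ.2) (sq_nonneg ‖R w‖)
          linarith
      _ ≤ ‖mixed L R θ w‖ * ‖L w + R w‖ := real_inner_le_norm _ _
      _ ≤ ‖mixed L R θ w‖ * (2 * p w) := by
          gcongr
          linarith [norm_add_le (L w) (R w)]
  rcases ((norm_nonneg _).trans hL).eq_or_lt with h0 | hpos
  · rw [← h0, mul_zero]; exact norm_nonneg _
  · nlinarith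

theorem denseRange_mixed_of_near [CompleteSpace H] (h : CoercivePair L R p γ) {θ θ' : ℝ}
    (hθ : θ ∈ Icc (0 : ℝ) 1) (hnear : |θ' - θ| ≤ γ / 8) (hd : DenseRange (mixed L R θ)) :
    DenseRange (mixed L R θ') := by
  refine denseRange_of_norm_sub_le one_half_lt_one (fun w ↦ ?_) hd
  have hp : 0 ≤ p w := (norm_nonneg _).trans (h.norm_left_le w)
  calc ‖mixed L R θ' w - mixed L R θ w‖ ≤ |θ' - θ| * (2 * p w) :=
        norm_mixed_sub_mixed_le (h.norm_left_le w) (h.norm_right_le w) θ' θ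
    _ ≤ γ / 8 * (2 * p w) := by gcongr
    _ = 1 / 2 * (γ / 2 * p w) := by ring
    _ ≤ 1 / 2 * ‖mixed L R θ w‖ := by gcongr; exact h.le_norm_mixed hθ w

theorem denseRange_mixed_iff [CompleteSpace H] (h : CoercivePair L R p γ) (hγ : 0 < γ) {θ θ' : ℝ}
    (hθ : θ ∈ Icc (0 : ℝ) 1) (hθ' : θ' ∈ Icc (0 : ℝ) 1) :
    DenseRange (mixed L R θ) ↔ DenseRange (mixed L R θ') := by
  refine isPreconnected_Icc.induction₂
    (fun a b ↦ DenseRange (mixed L R a) ↔ DenseRange (mixed L R b)) (fun a ha ↦ ?_)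
    (fun _ _ _ _ _ _ ↦ Iff.trans) (fun _ _ _ _ ↦ Iff.symm) hθ hθ'
  have hball : ∀ᶠ b in 𝓝[Icc 0 1] a, dist b a ≤ γ / 8 :=
    mem_nhdsWithin_of_mem_nhds (Metric.closedBall_mem_nhds a (by positivity))
  filter_upwards [hball, self_mem_nhdsWithin] with b hb hbI
  refine ⟨h.denseRange_mixed_of_near ha hb, h.denseRange_mixed_of_near hbI ?_⟩
  rwa [abs_sub_comm]

end CoercivePair

/-- Uniqueness for the adjoint problem. If `v ⟂ range A` is the limit of `D wₙ`, then
`⟪A wₙ, D wₙ⟫ = ⟪A wₙ, D wₙ - v⟫ → 0`, so the energy inequality gives `J wₙ → 0`, and integration by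
parts gives `v = 0`. -/
theorem eq_zero_of_orthogonal {A D J : V →ₗ[ℝ] H} {C c : ℝ} (hc : 0 < c)
    (hA : ∀ w, ‖A w‖ ≤ C * ‖D w‖) (henergy : ∀ w, c * ‖J w‖ ^ 2 ≤ ⟪A w, D w⟫)
    (hparts : ∀ w η, ⟪D w, J η⟫ = -⟪J w, D η⟫) (hJ : ∀ v : H, (∀ η, ⟪v, J η⟫ = 0) → v = 0)
    {v : H} (hv : v ∈ closure (range D)) (hvA : ∀ w, ⟪v, A w⟫ = 0) : v = 0 := by
  obtain ⟨x, hx, hlim⟩ := mem_closure_iff_seq_limit.1 hv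
  choose w hw using hx
  have hD : Tendsto (fun n ↦ D (w n)) atTop (𝓝 v) := by simpa only [hw] using hlim
  have hDv : Tendsto (fun n ↦ ‖D (w n) - v‖) atTop (𝓝 0) := by
    simpa using (hD.sub_const v).norm
  have henergy0 : Tendsto (fun n ↦ c * ‖J (w n)‖ ^ 2) atTop (𝓝 0) := by
    have hbound : Tendsto (fun n ↦ C * ‖D (w n)‖ * ‖D (w n) - v‖) atTop (𝓝 0) := by
      simpa using (hD.norm.const_mul C).mul hDv
    refine squeeze_zero (fun n ↦ by positivity) (fun n ↦ ?_) hbound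
    calc c * ‖J (w n)‖ ^ 2 ≤ ⟪A (w n), D (w n)⟫ := henergy _
      _ = ⟪A (w n), D (w n) - v⟫ := by
          rw [inner_sub_right, real_inner_comm v, hvA, sub_zero]
      _ ≤ ‖A (w n)‖ * ‖D (w n) - v‖ := real_inner_le_norm _ _
      _ ≤ C * ‖D (w n)‖ * ‖D (w n) - v‖ := by gcongr; exact hA _
  have hJ0 : Tendsto (fun n ↦ J (w n)) atTop (𝓝 0) := by
    rw [tendsto_zero_iff_norm_tendsto_zero]
    simpa [inv_mul_cancel_left₀ hc.ne'] using (henergy0.const_mul c⁻¹).sqrt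
  refine hJ v fun η ↦ tendsto_nhds_unique (hD.inner tendsto_const_nhds) ?_
  simp_rw [hparts]
  simpa using (hJ0.inner (𝕜 := ℝ) (tendsto_const_nhds (x := D η))).neg

section Line

variable {A : V →ₗ[ℝ] H} {e z : H}

theorem exists_orthogonal_range_ne_zero [CompleteSpace H] (hA : ¬ DenseRange A) :
    ∃ z ≠ 0, ∀ w, ⟪z, A w⟫ = 0 := by
  by_contra! h
  refine hA ?_
  have htop : (LinearMap.range A).topologicalClosure = ⊤ := by
    rw [Submodule.topologicalClosure_eq_top_iff, Submodule.eq_bot_iff]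
    intro f hf
    by_contra hf0
    obtain ⟨w, hw⟩ := h f hf0
    exact hw (by rw [real_inner_comm]; exact hf _ ⟨w, rfl⟩)
  simpa only [DenseRange, LinearMap.coe_range] using
    Submodule.dense_iff_topologicalClosure_eq_top.2 htop

theorem norm_le_mul_norm_sub_smul (hzA : ∀ w, ⟪z, A w⟫ = 0) (hze : ⟪z, e⟫ ≠ 0) (w : V) (c : ℝ) :
    ‖A w‖ ≤ (1 + ‖z‖ * ‖e‖ / |⟪z, e⟫|) * ‖A w - c • e‖ := by
  have hpos : 0 < |⟪z, e⟫| := abs_pos.2 hze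
  have hc : |c| ≤ ‖z‖ * ‖A w - c • e‖ / |⟪z, e⟫| := by
    rw [le_div_iff₀ hpos]
    calc |c| * |⟪z, e⟫| = |⟪z, A w - c • e⟫| := by
          rw [inner_sub_right, hzA, inner_smul_right, zero_sub, abs_neg, abs_mul]
      _ ≤ ‖z‖ * ‖A w - c • e‖ := abs_real_inner_le_norm _ _
  calc ‖A w‖ = ‖(A w - c • e) + c • e‖ := by rw [sub_add_cancel]
    _ ≤ ‖A w - c • e‖ + |c| * ‖e‖ := by
        rw [← Real.norm_eq_abs, ← norm_smul]; exact norm_add_le _ _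
    _ ≤ ‖A w - c • e‖ + ‖z‖ * ‖A w - c • e‖ / |⟪z, e⟫| * ‖e‖ := by gcongr
    _ = (1 + ‖z‖ * ‖e‖ / |⟪z, e⟫|) * ‖A w - c • e‖ := by ring

theorem exists_sub_smul_mem_closure_range [CompleteSpace H] (hzA : ∀ w, ⟪z, A w⟫ = 0)
    (hze : ⟪z, e⟫ ≠ 0) (hdual : ∀ v : H, ⟪v, e⟫ = 0 → (∀ w, ⟪v, A w⟫ = 0) → v = 0) (d : H) :
    ∃ c : ℝ, d - c • e ∈ closure (range A) := by
  refine ⟨⟪z, d⟫ / ⟪z, e⟫, ?_⟩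
  set y := d - (⟪z, d⟫ / ⟪z, e⟫) • e with hy
  have hzy : ⟪z, y⟫ = 0 := by
    rw [hy, inner_sub_right, inner_smul_right, div_mul_cancel₀ _ hze, sub_self]
  rw [← LinearMap.coe_range, ← Submodule.topologicalClosure_coe,
    ← Submodule.orthogonal_orthogonal_eq_closure]
  intro f hf
  have hfA : ∀ w, ⟪f, A w⟫ = 0 := fun w ↦ by
    rw [real_inner_comm]; exact hf _ ⟨w, rfl⟩
  have hfz : f - (⟪f, e⟫ / ⟪z, e⟫) • z = 0 := by
    refine hdual _ ?_ fun w ↦ ?_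
    · rw [inner_sub_left, real_inner_smul_left, div_mul_cancel₀ _ hze, sub_self]
    · rw [inner_sub_left, real_inner_smul_left, hfA, hzA, mul_zero, sub_zero]
  rw [sub_eq_zero.1 hfz, real_inner_smul_left, hzy, mul_zero]

end Line

end Hilbert

/-! ### Test functions -/

theorem IsTest.add {u w : ℝ → ℝ} (hu : IsTest u) (hw : IsTest w) : IsTest (u + w) :=
  ⟨hu.1.add hw.1, hu.2.1.add hw.2.1, (tsupport_add u w).trans (union_subset hu.2.2 hw.2.2)⟩

theorem IsTest.smul (c : ℝ) {w : ℝ → ℝ} (hw : IsTest w) : IsTest (c • w) :=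
  ⟨hw.1.const_smul c, hw.2.1.smul_left (f := fun _ ↦ c),
    (tsupport_smul_subset_right (fun _ ↦ c) w).trans hw.2.2⟩

theorem isTest_zero : IsTest 0 :=
  ⟨contDiff_const, HasCompactSupport.zero, by simp [tsupport]⟩

/-- The vector space `C₀^∞(0,1)`. -/
def testSpace : Submodule ℝ (ℝ → ℝ) where
  carrier := {w | IsTest w}
  add_mem' := IsTest.add
  zero_mem' := isTest_zero
  smul_mem' c _ := IsTest.smul c

namespace IsTest

variable {u w : ℝ → ℝ}

theorem sub (hu : IsTest u) (hw : IsTest w) : IsTest (u - w) :=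
  testSpace.sub_mem hu hw

protected theorem deriv (hw : IsTest w) : IsTest (deriv w) :=
  ⟨(contDiff_infty_iff_deriv.1 hw.1).2, hw.2.1.deriv, tsupport_deriv_subset.trans hw.2.2⟩

theorem continuous (hw : IsTest w) : Continuous w :=
  hw.1.continuous

theorem differentiable (hw : IsTest w) : Differentiable ℝ w :=
  hw.1.differentiable (by simp)

theorem eq_zero (hw : IsTest w) {x : ℝ} (hx : x ∉ Ioo (0 : ℝ) 1) : w x = 0 :=
  image_eq_zero_of_notMem_tsupport fun h ↦ hx (hw.2.2 h)

theorem zeroExt_eq (hw : IsTest w) : zeroExt w = w :=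
  indicator_eq_self.2 ((subset_tsupport w).trans hw.2.2)

theorem integrable (hw : IsTest w) : Integrable w :=
  hw.continuous.integrable_of_hasCompactSupport hw.2.1

theorem memLp (hw : IsTest w) (p : ENNReal) : MemLp w p volume :=
  hw.continuous.memLp_of_hasCompactSupport hw.2.1

theorem memLp_vol01 (hw : IsTest w) (p : ENNReal) : MemLp w p vol01 :=
  (hw.memLp p).restrict _

theorem exists_bound (hw : IsTest w) : ∃ C, ∀ x, |w x| ≤ C :=
  hw.2.1.exists_bound_of_continuous hw.continuous

end IsTest

theorem integral_vol01_eq {f : ℝ → ℝ} (hf : ∀ x ∉ Ioo (0 : ℝ) 1, f x = 0) :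
    ∫ x, f x ∂vol01 = ∫ x, f x :=
  setIntegral_eq_integral_of_forall_compl_eq_zero hf

instance : IsProbabilityMeasure vol01 :=
  ⟨by simp⟩

theorem sq_integral_abs_le {Ω : Type*} [MeasurableSpace Ω] {μ : Measure Ω}
    [IsProbabilityMeasure μ] {f : Ω → ℝ} (hf : MemLp f 2 μ) :
    (∫ x, |f x| ∂μ) ^ 2 ≤ ∫ x, f x ^ 2 ∂μ := by
  have hvar := ProbabilityTheory.variance_nonneg |f| μ
  rw [ProbabilityTheory.variance_eq_sub hf.abs] at hvar
  simpa only [Pi.pow_apply, Pi.abs_apply, sq_abs, sub_nonneg] using hvar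

theorem IsTest.sq_integral_abs_le {w : ℝ → ℝ} (hw : IsTest w) :
    (∫ x, |w x|) ^ 2 ≤ ∫ x, w x ^ 2 := by
  rw [← integral_vol01_eq (f := fun x ↦ |w x|) fun x hx ↦ by simp [hw.eq_zero hx],
    ← integral_vol01_eq (f := fun x ↦ w x ^ 2) fun x hx ↦ by simp [hw.eq_zero hx]]
  exact FracInt.sq_integral_abs_le (hw.memLp_vol01 2)

/-! ### The Fourier transform of a test function -/

/-- The Fourier transform of a real valued function, in Mathlib's frequency variable `ξ`, for which
the angular frequency is `ω = 2πξ`. -/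
noncomputable def realFourier (w : ℝ → ℝ) : ℝ → ℂ :=
  𝓕 (fun x ↦ (w x : ℂ))

theorem continuous_realFourier {w : ℝ → ℝ} (hw : Integrable w) : Continuous (realFourier w) :=
  VectorFourier.fourierIntegral_continuous Real.continuous_fourierChar
    (by exact continuous_inner) hw.ofReal

theorem norm_realFourier_le (w : ℝ → ℝ) (ξ : ℝ) : ‖realFourier w ξ‖ ≤ ∫ x, |w x| := by
  have := VectorFourier.norm_fourierIntegral_le_integral_norm Real.fourierChar volume
    (innerₗ ℝ) (fun x ↦ (w x : ℂ)) ξ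
  simp only [Complex.norm_real, Real.norm_eq_abs] at this
  exact this

/-- Plancherel's identity for integrable functions, one of which satisfies Fourier inversion. -/
theorem integral_conj_realFourier_mul_realFourier {f g : ℝ → ℝ} (hf : Integrable f)
    (hg : Integrable g) (hgc : Continuous g) (hgf : Integrable (realFourier g)) :
    ∫ ξ, conj (realFourier f ξ) * realFourier g ξ = ((∫ x, f x * g x : ℝ) : ℂ) := by
  have hinv : 𝓕⁻ (realFourier g) = fun x ↦ (g x : ℂ) :=
    Continuous.fourierInv_fourier_eq (Complex.continuous_ofReal.comp hgc) hg.ofReal hgf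
  have hflip : (-(innerₗ ℝ).flip : ℝ →ₗ[ℝ] ℝ →ₗ[ℝ] ℝ) = -innerₗ ℝ := by simp
  have hinv' (x : ℝ) : VectorFourier.fourierIntegral Real.fourierChar volume
      (-(innerₗ ℝ).flip) (realFourier g) x = (g x : ℂ) := by
    rw [hflip]
    exact congrFun hinv x
  have hduality := VectorFourier.integral_sesq_fourierIntegral_eq_neg_flip
    (M := innerSL ℂ) (L := innerₗ ℝ) (μ := volume) (ν := volume) (f := fun x ↦ (f x : ℂ))
    Real.continuous_fourierChar continuous_inner hf.ofReal hgf
  simp only [hinv', innerSL_apply_apply, RCLike.inner_apply'] at hduality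
  simp only [← integral_complex_ofReal, Complex.ofReal_mul]
  simp only [Complex.conj_ofReal] at hduality
  exact hduality

namespace IsTest

variable {w : ℝ → ℝ}

/-- A test function as a complex valued Schwartz function. -/
noncomputable def toSchwartz (hw : IsTest w) : SchwartzMap ℝ ℂ :=
  HasCompactSupport.toSchwartzMap (f := fun x ↦ (w x : ℂ))
    (hw.2.1.comp_left (g := ((↑) : ℝ → ℂ)) Complex.ofReal_zero)
    (Complex.ofRealCLM.contDiff.comp hw.1)

theorem realFourier_eq (hw : IsTest w) :
    realFourier w = (𝓕 hw.toSchwartz : SchwartzMap ℝ ℂ) := by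
  rw [SchwartzMap.fourier_coe]
  rfl

theorem integrable_realFourier (hw : IsTest w) : Integrable (realFourier w) := by
  rw [hw.realFourier_eq]
  exact SchwartzMap.integrable _

theorem integrable_norm_realFourier_sq (hw : IsTest w) :
    Integrable (fun ξ ↦ ‖realFourier w ξ‖ ^ 2) := by
  rw [hw.realFourier_eq]
  simpa using (SchwartzMap.memLp (𝓕 hw.toSchwartz) 2 volume).integrable_norm_pow (by simp)

theorem integral_norm_realFourier_sq (hw : IsTest w) :
    ∫ ξ, ‖realFourier w ξ‖ ^ 2 = ∫ x, w x ^ 2 := by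
  rw [hw.realFourier_eq, SchwartzMap.integral_norm_sq_fourier]
  refine integral_congr_ae (.of_forall fun x ↦ ?_)
  change ‖(w x : ℂ)‖ ^ 2 = w x ^ 2
  rw [Complex.norm_real, Real.norm_eq_abs, sq_abs]

theorem realFourier_deriv (hw : IsTest w) (ξ : ℝ) :
    realFourier (deriv w) ξ = (2 * π * Complex.I * ξ) * realFourier w ξ := by
  have hderiv (x : ℝ) : HasDerivAt (fun y ↦ (w y : ℂ)) (deriv w x : ℝ) x :=
    (hw.differentiable x).hasDerivAt.ofReal_comp
  have hcoe : deriv (fun x ↦ (w x : ℂ)) = fun x ↦ ((deriv w x : ℝ) : ℂ) :=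
    funext fun x ↦ (hderiv x).deriv
  have hfourier := Real.fourier_deriv hw.integrable.ofReal
    (fun x ↦ (hderiv x).differentiableAt) (hcoe ▸ hw.deriv.integrable.ofReal)
  rw [hcoe] at hfourier
  simpa [realFourier, smul_eq_mul] using congrFun hfourier ξ

theorem norm_realFourier_deriv_sq (hw : IsTest w) (ξ : ℝ) :
    ‖realFourier (deriv w) ξ‖ ^ 2 = |2 * π * ξ| ^ 2 * ‖realFourier w ξ‖ ^ 2 := by
  rw [hw.realFourier_deriv, norm_mul, mul_pow]
  simp [abs_mul]

theorem norm_realFourier_sq_le (hw : IsTest w) (ξ : ℝ) :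
    ‖realFourier w ξ‖ ^ 2 ≤ ∫ x, w x ^ 2 :=
  (pow_le_pow_left₀ (norm_nonneg _) (norm_realFourier_le w ξ) 2).trans hw.sq_integral_abs_le

/-- Since `|ŵ|² ≤ ‖w‖²` for `w` supported in `(0,1)`, the frequencies `|ξ| ≤ 1/4` carry at most half
of `‖w‖²`. -/
theorem integral_sq_le (hw : IsTest w) {m : ℝ → ℝ} {c : ℝ} (hc : 0 < c)
    (hm0 : ∀ ξ, 0 ≤ m ξ) (hm : ∀ ξ, 1 ≤ |2 * π * ξ| → c ≤ m ξ)
    (hint : Integrable (fun ξ ↦ m ξ * ‖realFourier w ξ‖ ^ 2)) :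
    c * ∫ x, w x ^ 2 ≤ 2 * ∫ ξ, m ξ * ‖realFourier w ξ‖ ^ 2 := by
  set N := ∫ x, w x ^ 2
  set low : ℝ → ℝ := (Icc (-(1 / 4)) (1 / 4)).indicator fun _ ↦ c * N
  have hpt (ξ : ℝ) : c * ‖realFourier w ξ‖ ^ 2 ≤ low ξ + m ξ * ‖realFourier w ξ‖ ^ 2 := by
    by_cases hξ : ξ ∈ Icc (-(1 / 4) : ℝ) (1 / 4)
    · rw [show low ξ = c * N from indicator_of_mem hξ _]
      have := mul_le_mul_of_nonneg_left (hw.norm_realFourier_sq_le ξ) hc.le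
      linarith [mul_nonneg (hm0 ξ) (sq_nonneg ‖realFourier w ξ‖)]
    · rw [show low ξ = 0 from indicator_of_notMem hξ _, zero_add]
      gcongr
      apply hm
      have hξ' : 1 / 4 < |ξ| := not_le.1 fun h ↦ hξ (abs_le.1 h)
      rw [abs_mul, abs_of_pos Real.two_pi_pos]
      nlinarith [Real.pi_gt_three]
  have hlow : Integrable low :=
    (integrable_indicator_iff measurableSet_Icc).2 (integrableOn_const (by simp))
  have hlow_integral : ∫ ξ, low ξ = c * N / 2 := by
    rw [integral_indicator measurableSet_Icc, setIntegral_const, Real.volume_real_Icc]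
    norm_num
    ring
  have := integral_mono (hw.integrable_norm_realFourier_sq.const_mul c) (hlow.add hint) hpt
  simp only [Pi.add_apply] at this
  rw [integral_const_mul, hw.integral_norm_realFourier_sq, integral_add hlow hint,
    hlow_integral] at this
  linarith

end IsTest

/-! ### The damped fractional integration kernels -/

theorem eqOn_re_pos_of_eq_ofReal {f g : ℂ → ℂ} (hf : AnalyticOnNhd ℂ f {z | 0 < z.re})
    (hg : AnalyticOnNhd ℂ g {z | 0 < z.re}) (h : ∀ x : ℝ, 0 < x → f x = g x) :
    EqOn f g {z | 0 < z.re} := by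
  have hcoe : Tendsto (fun x : ℝ ↦ (x : ℂ)) (𝓝[≠] 1) (𝓝[≠] (1 : ℂ)) :=
    tendsto_nhdsWithin_iff.2
      ⟨(Complex.continuous_ofReal.tendsto' 1 1 Complex.ofReal_one).mono_left nhdsWithin_le_nhds,
        eventually_mem_nhdsWithin.mono fun x hx ↦ by simpa using hx⟩
  have hfreq : ∃ᶠ z in 𝓝[≠] (1 : ℂ), f z = g z := by
    refine hcoe.frequently (Eventually.frequently ?_)
    filter_upwards [nhdsWithin_le_nhds (Ioi_mem_nhds one_pos)] with x hx using h x hx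
  exact hf.eqOn_of_preconnected_of_frequently_eq hg (convex_halfSpace_re_gt 0).isPreconnected
    (by simp) hfreq

/-- The integral is the complex moment generating function of `t ↦ -t` under the measure
`t ^ (β - 1) dt`, and these are analytic. -/
theorem analyticOnNhd_integral_rpow_mul_cexp {β : ℝ} (hβ : 0 < β) :
    AnalyticOnNhd ℂ
      (fun z : ℂ ↦ ∫ t in Ioi (0 : ℝ), ((t ^ (β - 1) : ℝ) : ℂ) * Complex.exp (-(z * t)))
      {z | 0 < z.re} := by
  set density : ℝ → ENNReal := fun t ↦ ENNReal.ofReal (t ^ (β - 1))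
  set μ : Measure ℝ := (volume.restrict (Ioi 0)).withDensity density
  have hdensity : Measurable density := by fun_prop
  have hfinite : ∀ᵐ t ∂(volume.restrict (Ioi (0 : ℝ))), density t < ⊤ :=
    .of_forall fun t ↦ ENNReal.ofReal_lt_top
  have hdensity_toReal {t : ℝ} (ht : t ∈ Ioi 0) : (density t).toReal = t ^ (β - 1) :=
    ENNReal.toReal_ofReal (Real.rpow_nonneg (le_of_lt ht) _)
  have hmgf : ProbabilityTheory.complexMGF (fun t ↦ -t) μ = fun z ↦
      ∫ t in Ioi (0 : ℝ), ((t ^ (β - 1) : ℝ) : ℂ) * Complex.exp (-(z * t)) := by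
    ext z
    rw [ProbabilityTheory.complexMGF,
      integral_withDensity_eq_integral_toReal_smul hdensity hfinite]
    refine setIntegral_congr_fun measurableSet_Ioi fun t ht ↦ ?_
    simp only [hdensity_toReal ht, Complex.real_smul, Complex.ofReal_neg, mul_neg]
  have hset : Ioi (0 : ℝ) ⊆ ProbabilityTheory.integrableExpSet (fun t ↦ -t) μ := by
    intro r hr
    refine (integrable_withDensity_iff_integrable_smul' hdensity hfinite).2 ?_
    refine (integrableOn_congr_fun (fun t ht ↦ ?_) measurableSet_Ioi).1
      (integrableOn_rpow_mul_exp_neg_mul_rpow (p := 1) (s := β - 1) (by linarith) one_pos hr)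
    simp only [hdensity_toReal ht, smul_eq_mul, Real.rpow_one, neg_mul, mul_neg]
  rw [← hmgf]
  exact ProbabilityTheory.analyticOnNhd_complexMGF.mono fun z hz ↦
    interior_maximal hset isOpen_Ioi hz

theorem integral_rpow_mul_cexp {β : ℝ} (hβ : 0 < β) {z : ℂ} (hz : 0 < z.re) :
    ∫ t in Ioi (0 : ℝ), ((t ^ (β - 1) : ℝ) : ℂ) * Complex.exp (-(z * t)) =
      Real.Gamma β * z ^ (-β : ℂ) := by
  have hrhs : AnalyticOnNhd ℂ (fun z : ℂ ↦ (Real.Gamma β : ℂ) * z ^ (-β : ℂ)) {z | 0 < z.re} := by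
    refine DifferentiableOn.analyticOnNhd (fun z hz ↦ ?_)
      (isOpen_lt continuous_const Complex.continuous_re)
    exact ((differentiableAt_id.cpow_const (Or.inl hz)).const_mul _).differentiableWithinAt
  refine eqOn_re_pos_of_eq_ofReal (analyticOnNhd_integral_rpow_mul_cexp hβ) hrhs
    (fun x hx ↦ ?_) hz
  have hreal : (x : ℂ) ^ (-β : ℂ) = ((1 / x) ^ β : ℝ) := by
    rw [one_div, Real.inv_rpow hx.le, ← Real.rpow_neg hx.le, Complex.ofReal_cpow hx.le,
      Complex.ofReal_neg]
  rw [hreal, mul_comm, ← Complex.ofReal_mul, ← Real.integral_rpow_mul_exp_neg_mul_Ioi hβ hx,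
    ← integral_complex_ofReal]
  push_cast
  rfl

/-- The damped kernel `t ^ (β - 1) e ^ (-ε t) / Γ(β)` of fractional integration, supported on
`t > 0`; the left fractional integral of order `β` is convolution with `leftKernel β 0`. -/
noncomputable def leftKernel (β ε : ℝ) : ℝ → ℝ :=
  (Ioi (0 : ℝ)).indicator fun t ↦ t ^ (β - 1) * Real.exp (-(ε * t)) / Real.Gamma β

/-- The kernel of the damped right fractional integral. -/
noncomputable def rightKernel (β ε t : ℝ) : ℝ :=
  leftKernel β ε (-t)

section leftKernel

variable {β ε t : ℝ}

theorem leftKernel_of_pos (ht : 0 < t) :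
    leftKernel β ε t = t ^ (β - 1) * Real.exp (-(ε * t)) / Real.Gamma β :=
  indicator_of_mem (s := Ioi (0 : ℝ)) ht _

theorem leftKernel_of_nonpos (ht : t ≤ 0) : leftKernel β ε t = 0 :=
  indicator_of_notMem (s := Ioi (0 : ℝ)) (not_lt.2 ht) _

theorem leftKernel_nonneg (hβ : 0 < β) (ε t : ℝ) : 0 ≤ leftKernel β ε t :=
  indicator_nonneg (fun t (ht : 0 < t) ↦ by
    have := Real.Gamma_pos_of_pos hβ
    positivity) t

theorem leftKernel_eq_exp_mul (β ε t : ℝ) :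
    leftKernel β ε t = Real.exp (-(ε * t)) * leftKernel β 0 t := by
  rcases lt_or_ge 0 t with ht | ht
  · simp only [leftKernel_of_pos ht, zero_mul, neg_zero, Real.exp_zero, mul_one]
    ring
  · simp only [leftKernel_of_nonpos ht, mul_zero]

theorem leftKernel_le (hβ : 0 < β) (hε : 0 ≤ ε) (t : ℝ) :
    leftKernel β ε t ≤ leftKernel β 0 t := by
  rcases lt_or_ge 0 t with ht | ht
  · rw [leftKernel_eq_exp_mul]
    exact mul_le_of_le_one_left (leftKernel_nonneg hβ _ _)
      (Real.exp_le_one_iff.2 (neg_nonpos.2 (by positivity)))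
  · rw [leftKernel_of_nonpos ht, leftKernel_of_nonpos ht]

theorem integrable_leftKernel (hβ : 0 < β) (hε : 0 < ε) : Integrable (leftKernel β ε) := by
  have := integrableOn_rpow_mul_exp_neg_mul_rpow (p := 1) (s := β - 1) (by linarith) one_pos hε
  refine (integrable_indicator_iff measurableSet_Ioi).2 ?_
  simpa [IntegrableOn] using this.div_const (Real.Gamma β)

theorem locallyIntegrable_leftKernel (hβ : 0 < β) : LocallyIntegrable (leftKernel β 0) := by
  have hdamped := locallyIntegrableOn_univ.2 (integrable_leftKernel hβ one_pos).locallyIntegrable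
  have hundamped := hdamped.continuousOn_mul (g := Real.exp) (by fun_prop)
    isOpen_univ.isLocallyClosed
  refine (locallyIntegrableOn_univ.1 hundamped).congr (.of_forall fun t ↦ ?_)
  simp only [leftKernel_eq_exp_mul β 1 t, ← mul_assoc, ← Real.exp_add, one_mul, add_neg_cancel,
    Real.exp_zero]

theorem tendsto_leftKernel (β t : ℝ) :
    Tendsto (fun ε ↦ leftKernel β ε t) (𝓝[>] 0) (𝓝 (leftKernel β 0 t)) := by
  have hcont : Continuous fun ε ↦ leftKernel β ε t := by
    rw [funext fun ε ↦ leftKernel_eq_exp_mul β ε t]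
    fun_prop
  exact (hcont.tendsto 0).mono_left nhdsWithin_le_nhds

end leftKernel

/-- The Laplace variable `ε + iω` with `ω = 2πξ`. -/
noncomputable def laplaceVar (ε ξ : ℝ) : ℂ :=
  ε + (2 * π * ξ : ℝ) * Complex.I

section laplaceVar

variable {β ε : ℝ}

theorem laplaceVar_re (ε ξ : ℝ) : (laplaceVar ε ξ).re = ε := by
  simp [laplaceVar]

theorem laplaceVar_im (ε ξ : ℝ) : (laplaceVar ε ξ).im = 2 * π * ξ := by
  simp [laplaceVar]

theorem abs_le_norm_laplaceVar (ε ξ : ℝ) : |2 * π * ξ| ≤ ‖laplaceVar ε ξ‖ :=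
  laplaceVar_im ε ξ ▸ Complex.abs_im_le_norm _

theorem laplaceVar_ne_zero (hε : 0 < ε) (ξ : ℝ) : laplaceVar ε ξ ≠ 0 :=
  fun h ↦ hε.ne (by rw [← laplaceVar_re ε ξ, h, Complex.zero_re])

theorem continuous_laplaceVar (ε : ℝ) : Continuous (laplaceVar ε) := by
  unfold laplaceVar
  fun_prop

theorem realFourier_leftKernel (hβ : 0 < β) (hε : 0 < ε) (ξ : ℝ) :
    realFourier (leftKernel β ε) ξ = laplaceVar ε ξ ^ (-β : ℂ) := by
  have hΓ : (Real.Gamma β : ℂ) ≠ 0 := by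
    exact_mod_cast (Real.Gamma_pos_of_pos hβ).ne'
  have hintegrand (t : ℝ) :
      Complex.exp ((-2 * π * t * ξ : ℝ) * Complex.I) • (leftKernel β ε t : ℂ) =
        (Ioi (0 : ℝ)).indicator (fun t : ℝ ↦ (((t ^ (β - 1) : ℝ) : ℂ) *
          Complex.exp (-(laplaceVar ε ξ * t))) / Real.Gamma β) t := by
    rcases lt_or_ge 0 t with ht | ht
    · rw [leftKernel_of_pos ht, indicator_of_mem (s := Ioi (0 : ℝ)) ht, smul_eq_mul, laplaceVar,
        add_mul, neg_add, Complex.exp_add]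
      push_cast
      ring_nf
    · rw [leftKernel_of_nonpos ht, indicator_of_notMem (s := Ioi (0 : ℝ)) (not_lt.2 ht),
        Complex.ofReal_zero, smul_zero]
  rw [realFourier, Real.fourier_real_eq_integral_exp_smul]
  simp_rw [hintegrand]
  rw [integral_indicator measurableSet_Ioi, integral_div,
    integral_rpow_mul_cexp hβ (by rwa [laplaceVar_re]), mul_div_cancel_left₀ _ hΓ]

theorem realFourier_comp_neg (f : ℝ → ℝ) (ξ : ℝ) :
    realFourier (fun t ↦ f (-t)) ξ = conj (realFourier f ξ) := by
  rw [realFourier, realFourier, Real.fourier_real_eq_integral_exp_smul,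
    Real.fourier_real_eq_integral_exp_smul, ← integral_conj, ← integral_neg_eq_self]
  refine integral_congr_ae (.of_forall fun t ↦ ?_)
  simp only [smul_eq_mul, map_mul, neg_neg, Complex.conj_ofReal, ← Complex.exp_conj,
    Complex.conj_I]
  congr 2
  push_cast
  ring

theorem realFourier_rightKernel (hβ : 0 < β) (hε : 0 < ε) (ξ : ℝ) :
    realFourier (rightKernel β ε) ξ = conj (laplaceVar ε ξ ^ (-β : ℂ)) := by
  rw [← realFourier_leftKernel hβ hε]
  exact realFourier_comp_neg _ _

theorem norm_cpow_neg_ofReal (z : ℂ) (a : ℝ) : ‖z ^ (-a : ℂ)‖ = ‖z‖ ^ (-a) := by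
  rw [← Complex.ofReal_neg, Complex.norm_cpow_real]

theorem norm_realFourier_leftKernel (hβ : 0 < β) (hε : 0 < ε) (ξ : ℝ) :
    ‖realFourier (leftKernel β ε) ξ‖ = ‖laplaceVar ε ξ‖ ^ (-β) := by
  rw [realFourier_leftKernel hβ hε, norm_cpow_neg_ofReal]

theorem norm_realFourier_rightKernel (hβ : 0 < β) (hε : 0 < ε) (ξ : ℝ) :
    ‖realFourier (rightKernel β ε) ξ‖ = ‖laplaceVar ε ξ‖ ^ (-β) := by
  rw [realFourier_rightKernel hβ hε, RCLike.norm_conj, norm_cpow_neg_ofReal]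

end laplaceVar

/-! ### Convolution with a test function -/

section Convolution

variable {k l u : ℝ → ℝ}

theorem realFourier_convolution (hk : Integrable k) (hu : Integrable u) (ξ : ℝ) :
    realFourier (k ⋆ u) ξ = realFourier k ξ * realFourier u ξ := by
  have hcoe : (fun x ↦ (((k ⋆ u) x : ℝ) : ℂ)) =
      (fun x ↦ (k x : ℂ)) ⋆[ContinuousLinearMap.mul ℂ ℂ] fun x ↦ (u x : ℂ) := by
    ext x
    rw [convolution_def, convolution_def, ← integral_complex_ofReal]
    simp only [ContinuousLinearMap.lsmul_apply, smul_eq_mul, Complex.ofReal_mul,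
      ContinuousLinearMap.mul_apply']
  rw [realFourier, hcoe]
  exact Real.fourier_mul_convolution_eq hk.ofReal hu.ofReal ξ

theorem integrable_convolution (hk : Integrable k) (hu : Integrable u) : Integrable (k ⋆ u) :=
  hk.integrable_convolution _ hu

namespace IsTest

theorem continuous_convolution (hu : IsTest u) (hk : LocallyIntegrable k) :
    Continuous (k ⋆ u) :=
  hu.2.1.continuous_convolution_right _ hk hu.continuous

theorem convolutionExists (hu : IsTest u) (hk : LocallyIntegrable k) :
    ConvolutionExists k u (ContinuousLinearMap.lsmul ℝ ℝ) volume :=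
  hu.2.1.convolutionExists_right _ hk hu.continuous

theorem hasDerivAt_convolution (hu : IsTest u) (hk : LocallyIntegrable k) (x : ℝ) :
    HasDerivAt (k ⋆ u) ((k ⋆ deriv u) x) x :=
  hu.2.1.hasDerivAt_convolution_right _ hk (hu.1.of_le (by simp)) x

theorem integrable_realFourier_convolution (hu : IsTest u) (hk : Integrable k) :
    Integrable (realFourier (k ⋆ u)) := by
  rw [funext (realFourier_convolution hk hu.integrable)]
  exact hu.integrable_realFourier.bdd_mul (continuous_realFourier hk).aestronglyMeasurable
    (.of_forall (norm_realFourier_le k))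

theorem integral_convolution_mul_convolution (hu : IsTest u) (hk : Integrable k)
    (hl : Integrable l) :
    ((∫ x, (k ⋆ u) x * (l ⋆ u) x : ℝ) : ℂ) =
      ∫ ξ, conj (realFourier k ξ) * realFourier l ξ * (‖realFourier u ξ‖ ^ 2 : ℝ) := by
  rw [← integral_conj_realFourier_mul_realFourier (integrable_convolution hk hu.integrable)
    (integrable_convolution hl hu.integrable) (hu.continuous_convolution hl.locallyIntegrable)
    (hu.integrable_realFourier_convolution hl)]
  refine integral_congr_ae (.of_forall fun ξ ↦ ?_)
  simp only [realFourier_convolution hk hu.integrable, realFourier_convolution hl hu.integrable,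
    map_mul, ← Complex.normSq_eq_norm_sq, Complex.normSq_eq_conj_mul_self]
  ring

theorem integral_convolution_mul (hu : IsTest u) (hk : Integrable k) :
    ((∫ x, (k ⋆ u) x * u x : ℝ) : ℂ) =
      ∫ ξ, conj (realFourier k ξ) * (‖realFourier u ξ‖ ^ 2 : ℝ) := by
  rw [← integral_conj_realFourier_mul_realFourier (integrable_convolution hk hu.integrable)
    hu.integrable hu.continuous hu.integrable_realFourier]
  refine integral_congr_ae (.of_forall fun ξ ↦ ?_)
  simp only [realFourier_convolution hk hu.integrable, map_mul, ← Complex.normSq_eq_norm_sq,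
    Complex.normSq_eq_conj_mul_self, mul_assoc]

end IsTest

end Convolution

/-! ### Removing the damping -/

/-- A family of integrable kernels `k ε`, `ε > 0`, converging to the nonnegative, only locally
integrable, kernel `k 0` as `ε → 0⁺` and dominated by it. -/
structure IsDamping (k : ℝ → ℝ → ℝ) : Prop where
  integrable {ε : ℝ} : 0 < ε → Integrable (k ε)
  locallyIntegrable : LocallyIntegrable (k 0)
  abs_le {ε : ℝ} : 0 < ε → ∀ t, |k ε t| ≤ k 0 t
  tendsto (t : ℝ) : Tendsto (k · t) (𝓝[>] 0) (𝓝 (k 0 t))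

theorem isDamping_leftKernel {β : ℝ} (hβ : 0 < β) : IsDamping (leftKernel β) where
  integrable := integrable_leftKernel hβ
  locallyIntegrable := locallyIntegrable_leftKernel hβ
  abs_le hε t := (abs_of_nonneg (leftKernel_nonneg hβ _ t)).trans_le (leftKernel_le hβ hε.le t)
  tendsto := tendsto_leftKernel β

namespace IsDamping

variable {k l : ℝ → ℝ → ℝ} {u : ℝ → ℝ}

theorem comp_neg (h : IsDamping k) : IsDamping fun ε t ↦ k ε (-t) where
  integrable hε := (h.integrable hε).comp_neg
  locallyIntegrable := locallyIntegrable_iff.2 fun K hK ↦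
    (MeasurePreserving.integrableOn_image (Measure.measurePreserving_neg (volume : Measure ℝ))
      (Homeomorph.neg ℝ).measurableEmbedding (f := k 0) (s := K)).1
      (h.locallyIntegrable.integrableOn_isCompact (hK.image (Homeomorph.neg ℝ).continuous))
  abs_le hε t := h.abs_le hε (-t)
  tendsto t := h.tendsto (-t)

theorem continuous_convolution_abs (h : IsDamping k) (hu : IsTest u) : Continuous (k 0 ⋆ |u|) :=
  hu.2.1.abs.continuous_convolution_right _ h.locallyIntegrable hu.continuous.abs

theorem integrable_mul_abs (h : IsDamping k) (hu : IsTest u) (x : ℝ) :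
    Integrable (fun t ↦ k 0 t * |u (x - t)|) :=
  hu.2.1.abs.convolutionExists_right (ContinuousLinearMap.lsmul ℝ ℝ) h.locallyIntegrable
    hu.continuous.abs x

theorem abs_smul_le (h : IsDamping k) {ε : ℝ} (hε : 0 < ε) (t y : ℝ) :
    |k ε t • y| ≤ k 0 t * |y| := by
  rw [smul_eq_mul, abs_mul]
  exact mul_le_mul_of_nonneg_right (h.abs_le hε t) (abs_nonneg y)

theorem abs_convolution_le (h : IsDamping k) (hu : IsTest u) {ε : ℝ} (hε : 0 < ε) (x : ℝ) :
    |(k ε ⋆ u) x| ≤ (k 0 ⋆ |u|) x :=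
  abs_integral_le_integral_abs.trans <|
    integral_mono_of_nonneg (.of_forall fun _ ↦ abs_nonneg _) (h.integrable_mul_abs hu x)
      (.of_forall fun t ↦ h.abs_smul_le hε t _)

theorem tendsto_convolution (h : IsDamping k) (hu : IsTest u) (x : ℝ) :
    Tendsto (fun ε ↦ (k ε ⋆ u) x) (𝓝[>] 0) (𝓝 ((k 0 ⋆ u) x)) := by
  refine tendsto_integral_filter_of_dominated_convergence _ ?_ ?_ (h.integrable_mul_abs hu x)
    (.of_forall fun t ↦ (h.tendsto t).smul_const _)
  · filter_upwards [self_mem_nhdsWithin] with ε hε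
    exact (hu.convolutionExists (h.integrable hε).locallyIntegrable x).aestronglyMeasurable
  · filter_upwards [self_mem_nhdsWithin] with ε hε
    exact .of_forall fun t ↦ h.abs_smul_le hε t _

theorem tendsto_integral_convolution_mul_convolution (hk : IsDamping k) (hl : IsDamping l)
    (hu : IsTest u) :
    Tendsto (fun ε ↦ ∫ x, (k ε ⋆ u) x * (l ε ⋆ u) x ∂vol01) (𝓝[>] 0)
      (𝓝 (∫ x, (k 0 ⋆ u) x * (l 0 ⋆ u) x ∂vol01)) := by
  have hdom : IntegrableOn (fun x ↦ (k 0 ⋆ |u|) x * (l 0 ⋆ |u|) x) (Ioo 0 1) :=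
    (((hk.continuous_convolution_abs hu).mul (hl.continuous_convolution_abs hu)).integrableOn_Icc
      ).mono_set Ioo_subset_Icc_self
  refine tendsto_integral_filter_of_dominated_convergence _ ?_ ?_ hdom
    (.of_forall fun x ↦ (hk.tendsto_convolution hu x).mul (hl.tendsto_convolution hu x))
  · filter_upwards [self_mem_nhdsWithin] with ε hε
    exact ((hu.continuous_convolution (hk.integrable hε).locallyIntegrable).mul
      (hu.continuous_convolution (hl.integrable hε).locallyIntegrable)).aestronglyMeasurable
  · filter_upwards [self_mem_nhdsWithin] with ε hε
    refine .of_forall fun x ↦ (norm_mul _ _).trans_le ?_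
    exact mul_le_mul (hk.abs_convolution_le hu hε x) (hl.abs_convolution_le hu hε x)
      (abs_nonneg _) ((abs_nonneg _).trans (hk.abs_convolution_le hu hε x))

theorem tendsto_integral_convolution_mul (h : IsDamping k) (hu : IsTest u) :
    Tendsto (fun ε ↦ ∫ x, (k ε ⋆ u) x * u x ∂vol01) (𝓝[>] 0)
      (𝓝 (∫ x, (k 0 ⋆ u) x * u x ∂vol01)) := by
  have hdom : IntegrableOn (fun x ↦ (k 0 ⋆ |u|) x * |u x|) (Ioo 0 1) :=
    (((h.continuous_convolution_abs hu).mul hu.continuous.abs).integrableOn_Icc).mono_set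
      Ioo_subset_Icc_self
  refine tendsto_integral_filter_of_dominated_convergence _ ?_ ?_ hdom
    (.of_forall fun x ↦ (h.tendsto_convolution hu x).mul_const _)
  · filter_upwards [self_mem_nhdsWithin] with ε hε
    exact ((hu.continuous_convolution (h.integrable hε).locallyIntegrable).mul
      hu.continuous).aestronglyMeasurable
  · filter_upwards [self_mem_nhdsWithin] with ε hε
    refine .of_forall fun x ↦ (norm_mul _ _).trans_le ?_
    exact mul_le_mul_of_nonneg_right (h.abs_convolution_le hu hε x) (abs_nonneg _)

end IsDamping

theorem isDamping_rightKernel {β : ℝ} (hβ : 0 < β) : IsDamping (rightKernel β) :=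
  (isDamping_leftKernel hβ).comp_neg

/-! ### Energy estimates for test functions -/

/-- The squared Fourier seminorm `∫ |ω|^{2μ} |ŵ|²`, where `ω = 2πξ`. -/
noncomputable def fourierSeminormSq (μ : ℝ) (w : ℝ → ℝ) : ℝ :=
  ∫ ξ, (|2 * π * ξ| ^ μ) ^ 2 * ‖realFourier w ξ‖ ^ 2

theorem sq_rpow_le_one_add_sq {a μ : ℝ} (ha : 0 ≤ a) (h0 : 0 ≤ μ) (h1 : μ ≤ 1) :
    (a ^ μ) ^ 2 ≤ 1 + a ^ 2 := by
  have ha' := Real.rpow_nonneg ha μ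
  rcases le_total a 1 with h | h
  · nlinarith [Real.rpow_le_one ha h h0]
  · nlinarith [Real.rpow_le_self_of_one_le h h1]

namespace IsTest

variable {w : ℝ → ℝ} {μ : ℝ}

theorem integrable_sq_mul_norm_realFourier_sq (hw : IsTest w) :
    Integrable (fun ξ ↦ |2 * π * ξ| ^ 2 * ‖realFourier w ξ‖ ^ 2) := by
  simpa only [hw.norm_realFourier_deriv_sq] using hw.deriv.integrable_norm_realFourier_sq

theorem integral_sq_mul_norm_realFourier_sq (hw : IsTest w) :
    ∫ ξ, |2 * π * ξ| ^ 2 * ‖realFourier w ξ‖ ^ 2 = ∫ x, deriv w x ^ 2 := by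
  simp only [← hw.deriv.integral_norm_realFourier_sq, hw.norm_realFourier_deriv_sq]

theorem integrable_weight_mul_norm_realFourier_sq (hw : IsTest w) {m : ℝ → ℝ}
    (hm : AEStronglyMeasurable m) (hbound : ∀ ξ, |m ξ| ≤ 1 + |2 * π * ξ| ^ 2) :
    Integrable (fun ξ ↦ m ξ * ‖realFourier w ξ‖ ^ 2) := by
  refine (hw.integrable_norm_realFourier_sq.add hw.integrable_sq_mul_norm_realFourier_sq).mono'
    (hm.mul hw.integrable_norm_realFourier_sq.aestronglyMeasurable) (.of_forall fun ξ ↦ ?_)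
  rw [Real.norm_eq_abs, abs_mul, abs_of_nonneg (sq_nonneg ‖realFourier w ξ‖)]
  exact (mul_le_mul_of_nonneg_right (hbound ξ) (sq_nonneg _)).trans_eq (by
    rw [add_mul, one_mul, Pi.add_apply])

theorem integrable_fourierSeminormSq (hw : IsTest w) (h0 : 0 ≤ μ) (h1 : μ ≤ 1) :
    Integrable (fun ξ ↦ (|2 * π * ξ| ^ μ) ^ 2 * ‖realFourier w ξ‖ ^ 2) :=
  hw.integrable_weight_mul_norm_realFourier_sq (by fun_prop) fun ξ ↦ by
    rw [abs_of_nonneg (by positivity)]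
    exact sq_rpow_le_one_add_sq (abs_nonneg _) h0 h1

theorem integral_sq_le_fourierSeminormSq (hw : IsTest w) (h0 : 0 ≤ μ) (h1 : μ ≤ 1) :
    ∫ x, w x ^ 2 ≤ 2 * fourierSeminormSq μ w := by
  simpa only [one_mul, fourierSeminormSq] using
    hw.integral_sq_le one_pos (m := fun ξ ↦ (|2 * π * ξ| ^ μ) ^ 2)
    (fun ξ ↦ by positivity) (fun ξ hξ ↦ one_le_pow₀ (Real.one_le_rpow hξ h0))
    (hw.integrable_fourierSeminormSq h0 h1)

theorem integral_sq_le_integral_deriv_sq (hw : IsTest w) :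
    ∫ x, w x ^ 2 ≤ 2 * ∫ x, deriv w x ^ 2 := by
  simpa only [one_mul, hw.integral_sq_mul_norm_realFourier_sq] using
    hw.integral_sq_le one_pos (m := fun ξ ↦ |2 * π * ξ| ^ 2) (fun ξ ↦ by positivity)
      (fun ξ hξ ↦ one_le_pow₀ hξ) hw.integrable_sq_mul_norm_realFourier_sq

theorem fourierSeminormSq_le (hw : IsTest w) (h0 : 0 ≤ μ) (h1 : μ ≤ 1) :
    fourierSeminormSq μ w ≤ 3 * ∫ x, deriv w x ^ 2 :=
  calc fourierSeminormSq μ w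
    _ ≤ ∫ ξ, (‖realFourier w ξ‖ ^ 2 + |2 * π * ξ| ^ 2 * ‖realFourier w ξ‖ ^ 2) := by
      refine integral_mono (hw.integrable_fourierSeminormSq h0 h1)
        (hw.integrable_norm_realFourier_sq.add hw.integrable_sq_mul_norm_realFourier_sq)
        fun ξ ↦ ?_
      nlinarith [sq_rpow_le_one_add_sq (abs_nonneg (2 * π * ξ)) h0 h1,
        sq_nonneg ‖realFourier w ξ‖]
    _ = (∫ x, w x ^ 2) + ∫ x, deriv w x ^ 2 := by
      rw [integral_add hw.integrable_norm_realFourier_sq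
        hw.integrable_sq_mul_norm_realFourier_sq, hw.integral_sq_mul_norm_realFourier_sq,
        hw.integral_norm_realFourier_sq]
    _ ≤ 3 * ∫ x, deriv w x ^ 2 := by
      linarith [hw.integral_sq_le_integral_deriv_sq]

end IsTest

theorem cos_mul_norm_rpow_neg_le_re_cpow_neg {z : ℂ} (hz : 0 < z.re) {a : ℝ} (h0 : 0 ≤ a)
    (h1 : a ≤ 1) : Real.cos (π * a / 2) * ‖z‖ ^ (-a) ≤ (z ^ (-a : ℂ)).re := by
  have harg := Complex.abs_arg_le_pi_div_two_iff.2 hz.le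
  rw [← Complex.ofReal_neg, Complex.cpow_ofReal_re, mul_comm]
  refine mul_le_mul_of_nonneg_left ?_ (Real.rpow_nonneg (norm_nonneg _) _)
  rw [mul_neg, Real.cos_neg, ← Real.cos_abs (z.arg * a), abs_mul, abs_of_nonneg h0]
  refine Real.cos_le_cos_of_nonneg_of_le_pi (by positivity) ?_ ?_
  · nlinarith [Real.pi_pos]
  · nlinarith

/-- The Fourier multiplier `|ε + iω|^{-2β} ω²`, which increases to `|ω|^{2(1-β)}` as `ε → 0⁺`. -/
noncomputable def dampedWeight (β ε ξ : ℝ) : ℝ :=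
  (‖laplaceVar ε ξ‖ ^ (-β)) ^ 2 * |2 * π * ξ| ^ 2

section dampedWeight

variable {β ε : ℝ} {w : ℝ → ℝ}

theorem dampedWeight_nonneg (β ε ξ : ℝ) : 0 ≤ dampedWeight β ε ξ := by
  unfold dampedWeight
  positivity

theorem rpow_neg_sq_mul_sq {a : ℝ} (ha : 0 < a) (β : ℝ) :
    (a ^ (-β)) ^ 2 * a ^ 2 = (a ^ (1 - β)) ^ 2 := by
  rw [← mul_pow, sub_eq_neg_add, Real.rpow_add ha, Real.rpow_one]

theorem dampedWeight_le (hβ : 0 ≤ β) (ε ξ : ℝ) :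
    dampedWeight β ε ξ ≤ (|2 * π * ξ| ^ (1 - β)) ^ 2 := by
  rw [dampedWeight]
  rcases (abs_nonneg (2 * π * ξ)).eq_or_lt with h | h
  · rw [← h, zero_pow two_ne_zero, mul_zero]
    positivity
  · rw [← rpow_neg_sq_mul_sq h]
    have := Real.rpow_le_rpow_of_nonpos h (abs_le_norm_laplaceVar ε ξ) (neg_nonpos.2 hβ)
    gcongr

theorem continuous_dampedWeight (hε : 0 < ε) : Continuous (dampedWeight β ε) := by
  have hrpow : Continuous fun ξ ↦ ‖laplaceVar ε ξ‖ ^ (-β) :=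
    (continuous_laplaceVar ε).norm.rpow_const fun ξ ↦
      Or.inl (norm_ne_zero_iff.2 (laplaceVar_ne_zero hε ξ))
  exact (hrpow.pow 2).mul (by fun_prop)

theorem tendsto_dampedWeight (β : ℝ) {ξ : ℝ} (hξ : ξ ≠ 0) :
    Tendsto (dampedWeight β · ξ) (𝓝[>] 0) (𝓝 ((|2 * π * ξ| ^ (1 - β)) ^ 2)) := by
  have hω : 0 < |2 * π * ξ| := abs_pos.2 (by positivity)
  have hnorm : Tendsto (fun ε ↦ ‖laplaceVar ε ξ‖) (𝓝 0) (𝓝 |2 * π * ξ|) := by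
    have hcont : Continuous fun ε ↦ ‖laplaceVar ε ξ‖ := by
      unfold laplaceVar
      fun_prop
    exact hcont.tendsto' _ _ (by simp [laplaceVar, abs_mul])
  rw [← rpow_neg_sq_mul_sq hω]
  exact (((hnorm.rpow_const (Or.inl hω.ne')).pow 2).mul_const _).mono_left nhdsWithin_le_nhds

theorem IsTest.integrable_dampedWeight_mul (hw : IsTest w) (hβ : 0 ≤ β) (hβ1 : β ≤ 1)
    (hε : 0 < ε) : Integrable (fun ξ ↦ dampedWeight β ε ξ * ‖realFourier w ξ‖ ^ 2) :=
  hw.integrable_weight_mul_norm_realFourier_sq (continuous_dampedWeight hε).aestronglyMeasurable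
    fun ξ ↦ by
      rw [abs_of_nonneg (dampedWeight_nonneg β ε ξ)]
      exact (dampedWeight_le hβ ε ξ).trans
        (sq_rpow_le_one_add_sq (abs_nonneg _) (by linarith) (by linarith))

theorem IsTest.tendsto_integral_dampedWeight_mul (hw : IsTest w) (hβ : 0 ≤ β) (hβ1 : β ≤ 1) :
    Tendsto (fun ε ↦ ∫ ξ, dampedWeight β ε ξ * ‖realFourier w ξ‖ ^ 2) (𝓝[>] 0)
      (𝓝 (fourierSeminormSq (1 - β) w)) := by
  refine tendsto_integral_filter_of_dominated_convergence _ ?_ (.of_forall fun ε ↦ ?_)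
    (hw.integrable_fourierSeminormSq (μ := 1 - β) (by linarith) (by linarith)) ?_
  · filter_upwards [self_mem_nhdsWithin] with ε hε
    exact (hw.integrable_dampedWeight_mul hβ hβ1 hε).aestronglyMeasurable
  · refine .of_forall fun ξ ↦ ?_
    rw [Real.norm_of_nonneg (mul_nonneg (dampedWeight_nonneg _ _ _) (sq_nonneg _))]
    exact mul_le_mul_of_nonneg_right (dampedWeight_le hβ _ _) (sq_nonneg _)
  · filter_upwards [Measure.ae_ne volume 0] with ξ hξ
    exact (tendsto_dampedWeight β hξ).mul_const _

end dampedWeight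

section Multiplier

variable {k l u : ℝ → ℝ}

theorem IsTest.integrable_mul_norm_realFourier_sq (hu : IsTest u) {M : ℝ → ℂ} {C : ℝ}
    (hM : Continuous M) (hC : ∀ ξ, ‖M ξ‖ ≤ C) :
    Integrable (fun ξ ↦ M ξ * (‖realFourier u ξ‖ ^ 2 : ℝ)) :=
  hu.integrable_norm_realFourier_sq.ofReal.bdd_mul hM.aestronglyMeasurable (.of_forall hC)

theorem eq_integral_re_of_ofReal_eq {f : ℝ → ℂ} (hf : Integrable f) {a : ℝ}
    (h : (a : ℂ) = ∫ ξ, f ξ) : a = ∫ ξ, (f ξ).re := by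
  rw [← Complex.ofReal_re a, h]
  exact (integral_re hf).symm

theorem IsTest.integrable_re_mul_norm_realFourier_sq (hu : IsTest u) (hk : Integrable k) :
    Integrable (fun ξ ↦ (realFourier k ξ).re * ‖realFourier u ξ‖ ^ 2) := by
  simpa only [RCLike.re_eq_complex_re, Complex.re_mul_ofReal] using
    (hu.integrable_mul_norm_realFourier_sq (continuous_realFourier hk)
      (norm_realFourier_le k)).re

theorem IsTest.integral_convolution_mul_eq_integral_re (hu : IsTest u) (hk : Integrable k) :
    ∫ x, (k ⋆ u) x * u x = ∫ ξ, (realFourier k ξ).re * ‖realFourier u ξ‖ ^ 2 := by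
  have hint := hu.integrable_mul_norm_realFourier_sq
    (Complex.continuous_conj.comp (continuous_realFourier hk))
    fun ξ ↦ (RCLike.norm_conj _).trans_le (norm_realFourier_le k ξ)
  simpa only [Function.comp_apply, Complex.re_mul_ofReal, Complex.conj_re] using
    eq_integral_re_of_ofReal_eq hint (hu.integral_convolution_mul hk)

theorem IsTest.integrable_realFourier_mul_realFourier (hu : IsTest u) (hk : Integrable k)
    (hl : Integrable l) :
    Integrable (fun ξ ↦ conj (realFourier k ξ) * realFourier l ξ *
      (‖realFourier u ξ‖ ^ 2 : ℝ)) := by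
  refine hu.integrable_mul_norm_realFourier_sq (C := (∫ t, |k t|) * ∫ t, |l t|)
    ((Complex.continuous_conj.comp (continuous_realFourier hk)).mul (continuous_realFourier hl))
    fun ξ ↦ ?_
  rw [norm_mul, RCLike.norm_conj]
  exact mul_le_mul (norm_realFourier_le k ξ) (norm_realFourier_le l ξ) (norm_nonneg _)
    ((norm_nonneg _).trans (norm_realFourier_le k ξ))

theorem IsTest.integral_convolution_mul_convolution_eq_integral_re (hu : IsTest u)
    (hk : Integrable k) (hl : Integrable l) :
    ∫ x, (k ⋆ u) x * (l ⋆ u) x =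
      ∫ ξ, (conj (realFourier k ξ) * realFourier l ξ).re * ‖realFourier u ξ‖ ^ 2 := by
  simpa only [Complex.re_mul_ofReal] using eq_integral_re_of_ofReal_eq
    (hu.integrable_realFourier_mul_realFourier hk hl)
    (hu.integral_convolution_mul_convolution hk hl)

theorem IsTest.integral_convolution_sq (hu : IsTest u) (hk : Integrable k) :
    ∫ x, (k ⋆ u) x ^ 2 = ∫ ξ, ‖realFourier k ξ‖ ^ 2 * ‖realFourier u ξ‖ ^ 2 := by
  simpa only [← sq, ← Complex.normSq_eq_conj_mul_self, Complex.ofReal_re,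
    Complex.normSq_eq_norm_sq] using hu.integral_convolution_mul_convolution_eq_integral_re hk hk

theorem IsTest.integrable_convolution_sq (hu : IsTest u) (hk : Integrable k) :
    Integrable (fun x ↦ (k ⋆ u) x ^ 2) := by
  obtain ⟨C, hC⟩ := hu.exists_bound
  have hint := integrable_convolution hk hu.integrable
  have hbound (x : ℝ) : ‖(k ⋆ u) x‖ ≤ ∫ t, |k t| * C := by
    refine (norm_integral_le_integral_norm _).trans (integral_mono_of_nonneg
      (.of_forall fun t ↦ norm_nonneg _) (hk.abs.mul_const C) (.of_forall fun t ↦ ?_))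
    simp only [ContinuousLinearMap.lsmul_apply, norm_smul]
    exact mul_le_mul_of_nonneg_left (hC _) (norm_nonneg _)
  simpa only [sq] using hint.bdd_mul hint.aestronglyMeasurable (.of_forall hbound)

end Multiplier

section OneSided

variable {β : ℝ} {w : ℝ → ℝ} {k : ℝ → ℝ → ℝ}

theorem IsTest.integral_convolution_deriv_sq_le (hw : IsTest w) (hβ : 0 ≤ β) (hβ1 : β ≤ 1)
    (hk : IsDamping k)
    (hnorm : ∀ ε > 0, ∀ ξ, ‖realFourier (k ε) ξ‖ = ‖laplaceVar ε ξ‖ ^ (-β)) :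
    ∫ x, (k 0 ⋆ deriv w) x ^ 2 ∂vol01 ≤ fourierSeminormSq (1 - β) w := by
  have hlim := hk.tendsto_integral_convolution_mul_convolution hk hw.deriv
  simp_rw [← sq] at hlim
  refine le_of_tendsto hlim ?_
  filter_upwards [self_mem_nhdsWithin] with ε hε
  calc ∫ x, (k ε ⋆ deriv w) x ^ 2 ∂vol01
    _ ≤ ∫ x, (k ε ⋆ deriv w) x ^ 2 :=
      setIntegral_le_integral (hw.deriv.integrable_convolution_sq (hk.integrable hε))
        (.of_forall fun x ↦ sq_nonneg _)
    _ = ∫ ξ, dampedWeight β ε ξ * ‖realFourier w ξ‖ ^ 2 := by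
      simp only [hw.deriv.integral_convolution_sq (hk.integrable hε), hnorm ε hε,
        hw.norm_realFourier_deriv_sq, dampedWeight, mul_assoc]
    _ ≤ fourierSeminormSq (1 - β) w :=
      integral_mono (hw.integrable_dampedWeight_mul hβ hβ1 hε)
        (hw.integrable_fourierSeminormSq (by linarith) (by linarith))
        fun ξ ↦ mul_le_mul_of_nonneg_right (dampedWeight_le hβ _ _) (sq_nonneg _)

theorem IsTest.integral_leftKernel_convolution_sq_le (hw : IsTest w) (hβ : 0 < β) (hβ1 : β ≤ 1) :
    ∫ x, (leftKernel β 0 ⋆ deriv w) x ^ 2 ∂vol01 ≤ fourierSeminormSq (1 - β) w :=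
  hw.integral_convolution_deriv_sq_le hβ.le hβ1 (isDamping_leftKernel hβ) fun _ hε ↦
    norm_realFourier_leftKernel hβ hε

theorem IsTest.integral_rightKernel_convolution_sq_le (hw : IsTest w) (hβ : 0 < β)
    (hβ1 : β ≤ 1) :
    ∫ x, (rightKernel β 0 ⋆ deriv w) x ^ 2 ∂vol01 ≤ fourierSeminormSq (1 - β) w :=
  hw.integral_convolution_deriv_sq_le hβ.le hβ1 (isDamping_rightKernel hβ) fun _ hε ↦
    norm_realFourier_rightKernel hβ hε

theorem one_div_one_add_sq_le_norm_laplaceVar_rpow_neg (hβ : 0 ≤ β) (hβ1 : β ≤ 1) {ε : ℝ}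
    (hε : ε ∈ Ioc (0 : ℝ) 1) (ξ : ℝ) :
    1 / (1 + |2 * π * ξ| ^ 2) ≤ ‖laplaceVar ε ξ‖ ^ (-β) := by
  have hpos : 0 < ‖laplaceVar ε ξ‖ := norm_pos_iff.2 (laplaceVar_ne_zero hε.1 ξ)
  have hsq : ‖laplaceVar ε ξ‖ ^ 2 ≤ 1 + |2 * π * ξ| ^ 2 := by
    rw [← Complex.normSq_eq_norm_sq, Complex.normSq_apply, laplaceVar_re, laplaceVar_im, sq_abs]
    nlinarith [hε.1, hε.2]
  rw [Real.rpow_neg hpos.le, ← one_div]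
  refine one_div_le_one_div_of_le (by positivity) ?_
  rcases le_total ‖laplaceVar ε ξ‖ 1 with h | h
  · exact (Real.rpow_le_one hpos.le h hβ).trans (le_add_of_nonneg_right (by positivity))
  · nlinarith [Real.rpow_le_self_of_one_le h hβ1]

theorem IsTest.integral_sq_le_div_one_add_sq (hw : IsTest w) :
    Integrable (fun ξ ↦ |2 * π * ξ| ^ 2 / (1 + |2 * π * ξ| ^ 2) * ‖realFourier w ξ‖ ^ 2) ∧
      1 / 4 * ∫ x, w x ^ 2 ≤
        ∫ ξ, |2 * π * ξ| ^ 2 / (1 + |2 * π * ξ| ^ 2) * ‖realFourier w ξ‖ ^ 2 := by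
  have hint : Integrable
      (fun ξ ↦ |2 * π * ξ| ^ 2 / (1 + |2 * π * ξ| ^ 2) * ‖realFourier w ξ‖ ^ 2) := by
    refine hw.integrable_weight_mul_norm_realFourier_sq
      (Continuous.div (by fun_prop) (by fun_prop) fun ξ ↦ by positivity).aestronglyMeasurable
      fun ξ ↦ ?_
    rw [abs_of_nonneg (by positivity)]
    exact (div_le_one_of_le₀ (le_add_of_nonneg_left zero_le_one) (by positivity)).trans
      (le_add_of_nonneg_right (sq_nonneg _))
  have hbound := hw.integral_sq_le (c := 1 / 2) (by norm_num) (fun ξ ↦ by positivity)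
    (fun ξ hξ ↦ by
      rw [div_le_div_iff₀ two_pos (by positivity)]
      linarith [one_le_pow₀ (n := 2) hξ]) hint
  exact ⟨hint, by linarith⟩

theorem IsTest.integral_sq_le_integral_convolution_deriv_mul (hw : IsTest w) (hβ : 0 ≤ β)
    (hβ1 : β ≤ 1) (hk : IsDamping k)
    (hre : ∀ ε > 0, ∀ ξ,
      Real.cos (π * β / 2) * ‖laplaceVar ε ξ‖ ^ (-β) ≤ (realFourier (k ε) ξ).re) :
    Real.cos (π * β / 2) / 4 * ∫ x, w x ^ 2 ≤ ∫ x, (k 0 ⋆ deriv w) x * deriv w x ∂vol01 := by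
  have hcos : 0 ≤ Real.cos (π * β / 2) := Real.cos_nonneg_of_mem_Icc
    ⟨by nlinarith [Real.pi_pos], by nlinarith [Real.pi_pos]⟩
  obtain ⟨hint, hbound⟩ := hw.integral_sq_le_div_one_add_sq
  refine ge_of_tendsto (hk.tendsto_integral_convolution_mul hw.deriv) ?_
  filter_upwards [Ioc_mem_nhdsGT one_pos] with ε hε
  have hkint := hk.integrable hε.1
  rw [integral_vol01_eq fun x hx ↦ by rw [hw.deriv.eq_zero hx, mul_zero],
    hw.deriv.integral_convolution_mul_eq_integral_re hkint]
  calc Real.cos (π * β / 2) / 4 * ∫ x, w x ^ 2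
    _ ≤ ∫ ξ, Real.cos (π * β / 2) *
        (|2 * π * ξ| ^ 2 / (1 + |2 * π * ξ| ^ 2) * ‖realFourier w ξ‖ ^ 2) := by
      rw [integral_const_mul]
      linarith [mul_le_mul_of_nonneg_left hbound hcos]
    _ ≤ ∫ ξ, (realFourier (k ε) ξ).re * ‖realFourier (deriv w) ξ‖ ^ 2 := by
      refine integral_mono (hint.const_mul _)
        (hw.deriv.integrable_re_mul_norm_realFourier_sq hkint) fun ξ ↦ ?_
      have hmul := mul_le_mul_of_nonneg_left
        (one_div_one_add_sq_le_norm_laplaceVar_rpow_neg hβ hβ1 hε ξ) hcos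
      have := mul_le_mul_of_nonneg_right (hmul.trans (hre ε hε.1 ξ))
        (sq_nonneg ‖realFourier (deriv w) ξ‖)
      refine Eq.trans_le ?_ this
      rw [hw.norm_realFourier_deriv_sq]
      ring

theorem cos_mul_le_re_realFourier_leftKernel (hβ : 0 < β) (hβ1 : β ≤ 1) {ε : ℝ} (hε : 0 < ε)
    (ξ : ℝ) :
    Real.cos (π * β / 2) * ‖laplaceVar ε ξ‖ ^ (-β) ≤ (realFourier (leftKernel β ε) ξ).re := by
  rw [realFourier_leftKernel hβ hε]
  exact cos_mul_norm_rpow_neg_le_re_cpow_neg (by rwa [laplaceVar_re]) hβ.le hβ1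

theorem IsTest.integral_sq_le_leftKernel (hw : IsTest w) (hβ : 0 < β) (hβ1 : β ≤ 1) :
    Real.cos (π * β / 2) / 4 * ∫ x, w x ^ 2 ≤
      ∫ x, (leftKernel β 0 ⋆ deriv w) x * deriv w x ∂vol01 :=
  hw.integral_sq_le_integral_convolution_deriv_mul hβ.le hβ1 (isDamping_leftKernel hβ)
    fun _ hε ↦ cos_mul_le_re_realFourier_leftKernel hβ hβ1 hε

theorem IsTest.integral_sq_le_rightKernel (hw : IsTest w) (hβ : 0 < β) (hβ1 : β ≤ 1) :
    Real.cos (π * β / 2) / 4 * ∫ x, w x ^ 2 ≤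
      ∫ x, (rightKernel β 0 ⋆ deriv w) x * deriv w x ∂vol01 :=
  hw.integral_sq_le_integral_convolution_deriv_mul hβ.le hβ1 (isDamping_rightKernel hβ)
    fun ε hε ξ ↦ by
      rw [show realFourier (rightKernel β ε) ξ = _ from realFourier_comp_neg _ ξ,
        Complex.conj_re]
      exact cos_mul_le_re_realFourier_leftKernel hβ hβ1 hε ξ

end OneSided

section TwoSided

variable {β : ℝ} {u w : ℝ → ℝ}

theorem leftKernel_convolution_eq_zero {a x : ℝ} (hu : ∀ y ≤ a, u y = 0) (ε : ℝ) (hx : x ≤ a) :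
    (leftKernel β ε ⋆ u) x = 0 := by
  refine integral_eq_zero_of_ae (.of_forall fun t ↦ ?_)
  rcases le_or_gt t 0 with ht | ht
  · exact mul_eq_zero_of_left (leftKernel_of_nonpos ht) _
  · exact mul_eq_zero_of_right _ (hu _ (by linarith))

theorem rightKernel_convolution_eq_zero {a x : ℝ} (hu : ∀ y ≥ a, u y = 0) (ε : ℝ) (hx : a ≤ x) :
    (rightKernel β ε ⋆ u) x = 0 := by
  refine integral_eq_zero_of_ae (.of_forall fun t ↦ ?_)
  rcases le_or_gt 0 t with ht | ht
  · exact mul_eq_zero_of_left (leftKernel_of_nonpos (neg_nonpos.2 ht)) _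
  · exact mul_eq_zero_of_right _ (hu _ (by linarith))

theorem cos_mul_le_re_realFourier_mul_realFourier (hβ : 0 < β) (hβ' : β ≤ 1 / 2) {ε : ℝ}
    (hε : 0 < ε) (ξ : ℝ) :
    Real.cos (π * β) * (‖laplaceVar ε ξ‖ ^ (-β)) ^ 2 ≤
      (conj (realFourier (leftKernel β ε) ξ) * realFourier (rightKernel β ε) ξ).re := by
  have hsq : laplaceVar ε ξ ^ (-β : ℂ) * laplaceVar ε ξ ^ (-β : ℂ) =
      laplaceVar ε ξ ^ (-(2 * β : ℝ) : ℂ) := by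
    rw [← Complex.cpow_add _ _ (laplaceVar_ne_zero hε ξ)]
    congr 1
    push_cast
    ring
  have hnorm : (‖laplaceVar ε ξ‖ ^ (-β)) ^ 2 = ‖laplaceVar ε ξ‖ ^ (-(2 * β)) := by
    rw [← Real.rpow_mul_natCast (norm_nonneg _)]
    congr 1
    push_cast
    ring
  rw [realFourier_leftKernel hβ hε, realFourier_rightKernel hβ hε, ← map_mul, Complex.conj_re,
    hsq, hnorm, show π * β = π * (2 * β) / 2 by ring]
  exact cos_mul_norm_rpow_neg_le_re_cpow_neg (by rwa [laplaceVar_re]) (by linarith)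
    (by linarith)

/-- The two symbols are conjugate, so their inner product has symbol `(ε + iω)^{-2β}`, whose
argument stays below `πβ < π/2` in absolute value. -/
theorem IsTest.cos_mul_fourierSeminormSq_le (hw : IsTest w) (hβ : 0 < β) (hβ' : β ≤ 1 / 2) :
    Real.cos (π * β) * fourierSeminormSq (1 - β) w ≤
      ∫ x, (leftKernel β 0 ⋆ deriv w) x * (rightKernel β 0 ⋆ deriv w) x ∂vol01 := by
  refine le_of_tendsto_of_tendsto
    ((hw.tendsto_integral_dampedWeight_mul hβ.le (by linarith)).const_mul _)
    ((isDamping_leftKernel hβ).tendsto_integral_convolution_mul_convolution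
      (isDamping_rightKernel hβ) hw.deriv) ?_
  filter_upwards [self_mem_nhdsWithin] with ε hε
  have hleft := (isDamping_leftKernel hβ).integrable hε
  have hright := (isDamping_rightKernel hβ).integrable hε
  have hvanish (x : ℝ) (hx : x ∉ Ioo (0 : ℝ) 1) :
      (leftKernel β ε ⋆ deriv w) x * (rightKernel β ε ⋆ deriv w) x = 0 := by
    rcases not_and_or.1 hx with h | h
    · rw [leftKernel_convolution_eq_zero (fun y hy ↦ hw.deriv.eq_zero fun h ↦ hy.not_gt h.1) ε
        (not_lt.1 h), zero_mul]
    · rw [rightKernel_convolution_eq_zero (fun y hy ↦ hw.deriv.eq_zero fun h ↦ hy.not_gt h.2) ε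
        (not_lt.1 h), mul_zero]
  have hre := (hw.deriv.integrable_realFourier_mul_realFourier hleft hright).re
  simp only [RCLike.re_eq_complex_re, Complex.re_mul_ofReal] at hre
  rw [integral_vol01_eq hvanish,
    hw.deriv.integral_convolution_mul_convolution_eq_integral_re hleft hright,
    ← integral_const_mul]
  refine integral_mono ((hw.integrable_dampedWeight_mul hβ.le (by linarith) hε).const_mul _) hre
    fun ξ ↦ ?_
  have := mul_le_mul_of_nonneg_right
    (cos_mul_le_re_realFourier_mul_realFourier hβ hβ' hε ξ)
    (sq_nonneg ‖realFourier (deriv w) ξ‖)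
  refine Eq.trans_le ?_ this
  rw [hw.norm_realFourier_deriv_sq, dampedWeight]
  ring

end TwoSided

/-! ### The du Bois-Reymond lemma -/

section DuBoisReymond

variable {f χ : ℝ → ℝ}

theorem IsTest.exists_tsupport_subset_Icc (hχ : IsTest χ) :
    ∃ a b : ℝ, 0 < a ∧ b < 1 ∧ tsupport χ ⊆ Icc a b := by
  rcases (tsupport χ).eq_empty_or_nonempty with hempty | hne
  · exact ⟨1, 0, one_pos, one_pos, hempty ▸ empty_subset _⟩
  · obtain ⟨a, ha, hleast⟩ := hχ.2.1.isCompact.exists_isLeast hne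
    obtain ⟨b, hb, hgreatest⟩ := hχ.2.1.isCompact.exists_isGreatest hne
    exact ⟨a, b, (hχ.2.2 ha).1, (hχ.2.2 hb).2, fun x hx ↦ ⟨hleast hx, hgreatest hx⟩⟩

theorem IsTest.exists_deriv_eq (hχ : IsTest χ) (h0 : ∫ x, χ x = 0) :
    ∃ ψ, IsTest ψ ∧ deriv ψ = χ := by
  obtain ⟨a, b, ha, hb, hab⟩ := hχ.exists_tsupport_subset_Icc
  let ψ (x : ℝ) : ℝ := ∫ t in (0 : ℝ)..x, χ t
  have hzero {x : ℝ} (hx : x ∉ Icc a b) : χ x = 0 :=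
    image_eq_zero_of_notMem_tsupport fun h ↦ hx (hab h)
  have hderiv : deriv ψ = χ := funext fun x ↦ hχ.continuous.deriv_integral _ 0 x
  have hdiff : Differentiable ℝ ψ := fun x ↦
    (hχ.continuous.integral_hasStrictDerivAt 0 x).hasDerivAt.differentiableAt
  have hsupp : Function.support ψ ⊆ Icc a b := by
    refine fun x hx ↦ by_contra fun hxab ↦ hx ?_
    rcases not_and_or.1 hxab with hxa | hbx
    · refine intervalIntegral.integral_zero_ae (.of_forall fun t ht ↦ hzero fun h ↦ hxa ?_)
      exact (le_max_iff.1 (h.1.trans ht.2)).resolve_left ha.not_ge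
    · rw [← h0]
      refine intervalIntegral.integral_eq_integral_of_support_subset fun t ht ↦ ?_
      have := hab (subset_tsupport χ ht)
      exact ⟨ha.trans_le this.1, this.2.trans (not_le.1 hbx).le⟩
  exact ⟨ψ, ⟨contDiff_infty_iff_deriv.2 ⟨hdiff, hderiv.symm ▸ hχ.1⟩,
    .of_support_subset_isCompact isCompact_Icc hsupp,
    (closure_minimal hsupp isClosed_Icc).trans (Icc_subset_Ioo ha hb)⟩, hderiv⟩

theorem exists_isTest_integral_eq_one : ∃ η, IsTest η ∧ ∫ x, η x = 1 := by
  let f : ContDiffBump (1 / 2 : ℝ) := ⟨1 / 8, 1 / 4, by norm_num, by norm_num⟩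
  refine ⟨f.normed volume, ⟨f.contDiff_normed, f.hasCompactSupport_normed, ?_⟩, f.integral_normed⟩
  rw [f.tsupport_normed_eq, Real.closedBall_eq_Icc]
  exact Icc_subset_Ioo (by norm_num [f]) (by norm_num [f])

theorem ae_eq_zero_of_integral_mul_eq_zero (hf : Integrable f vol01)
    (h : ∀ η, IsTest η → ∫ x, f x * η x ∂vol01 = 0) : f =ᵐ[vol01] 0 := by
  have hloc : LocallyIntegrableOn f (Ioo 0 1) := IntegrableOn.locallyIntegrableOn hf
  refine (ae_restrict_iff' measurableSet_Ioo).2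
    (isOpen_Ioo.ae_eq_zero_of_integral_contDiff_smul_eq_zero hloc fun η hη hηc hηs ↦ ?_)
  have htest : IsTest η := ⟨hη, hηc, hηs⟩
  rw [← h η htest, integral_vol01_eq fun x hx ↦ by rw [htest.eq_zero hx, mul_zero]]
  simp only [smul_eq_mul, mul_comm]

theorem IsTest.integrable_mul (hχ : IsTest χ) (hf : Integrable f vol01) :
    Integrable (fun x ↦ f x * χ x) vol01 := by
  obtain ⟨C, hC⟩ := hχ.exists_bound
  exact hf.mul_bdd hχ.continuous.aestronglyMeasurable (.of_forall hC)

theorem exists_integral_mul_eq_const_mul_integral (hf : Integrable f vol01)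
    (h : ∀ η, IsTest η → ∫ x, f x * deriv η x ∂vol01 = 0) :
    ∃ c, ∀ η, IsTest η → ∫ x, f x * η x ∂vol01 = c * ∫ x, η x := by
  obtain ⟨η₀, hη₀, hint⟩ := exists_isTest_integral_eq_one
  refine ⟨∫ x, f x * η₀ x ∂vol01, fun η hη ↦ ?_⟩
  let m : ℝ := ∫ x, η x
  have hmean : ∫ x, (η - m • η₀) x = 0 := by
    simp only [Pi.sub_apply, Pi.smul_apply, smul_eq_mul]
    rw [integral_sub hη.integrable (hη₀.integrable.const_mul _), integral_const_mul, hint,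
      mul_one, sub_self]
  obtain ⟨ψ, hψ, hderiv⟩ := (hη.sub (hη₀.smul m)).exists_deriv_eq hmean
  have horth := h ψ hψ
  simp only [hderiv, Pi.sub_apply, Pi.smul_apply, smul_eq_mul, mul_sub,
    mul_left_comm (f _) m] at horth
  rw [integral_sub (hη.integrable_mul hf) ((hη₀.integrable_mul hf).const_mul _),
    integral_const_mul] at horth
  linarith

theorem ae_eq_const_of_integral_mul_deriv_eq_zero (hf : Integrable f vol01)
    (h : ∀ η, IsTest η → ∫ x, f x * deriv η x ∂vol01 = 0) :
    ∃ c : ℝ, f =ᵐ[vol01] fun _ ↦ c := by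
  obtain ⟨c, hc⟩ := exists_integral_mul_eq_const_mul_integral hf h
  refine ⟨c, (ae_eq_zero_of_integral_mul_eq_zero (hf.sub (integrable_const c))
    fun η hη ↦ ?_).mono fun x hx ↦ sub_eq_zero.1 hx⟩
  simp only [Pi.sub_apply, sub_mul]
  rw [integral_sub (hη.integrable_mul hf) (hη.integrable_mul (integrable_const c)), hc η hη,
    integral_const_mul, integral_vol01_eq fun x hx ↦ hη.eq_zero hx, sub_self]

end DuBoisReymond

/-! ### The orthogonal complement of the left fractional derivatives -/

section Semigroup

variable {α β : ℝ} {u w : ℝ → ℝ}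

theorem leftKernel_zero_mul {s : ℝ} (hs : 0 < s) (t : ℝ) :
    leftKernel β 0 (s * t) = s ^ (β - 1) * leftKernel β 0 t := by
  rcases lt_or_ge 0 t with ht | ht
  · rw [leftKernel_of_pos ht, leftKernel_of_pos (mul_pos hs ht), Real.mul_rpow hs.le ht.le]
    simp only [zero_mul]
    ring
  · rw [leftKernel_of_nonpos ht, leftKernel_of_nonpos (mul_nonpos_of_nonneg_of_nonpos hs.le ht),
      mul_zero]

-- The product of the kernels of orders `1 - β` and `β` is homogeneous of degree `-1`.
theorem leftKernel_convolution_leftKernel_of_pos {x : ℝ} (hx : 0 < x) :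
    (leftKernel (1 - β) 0 ⋆ leftKernel β 0) x = (leftKernel (1 - β) 0 ⋆ leftKernel β 0) 1 := by
  have hscale (t : ℝ) : leftKernel (1 - β) 0 (x * t) * leftKernel β 0 (x - x * t) =
      x⁻¹ * (leftKernel (1 - β) 0 t * leftKernel β 0 (1 - t)) := by
    have hpow : x ^ (1 - β - 1) * x ^ (β - 1) = x⁻¹ := by
      rw [← Real.rpow_add hx, ← Real.rpow_neg_one]
      ring_nf
    rw [← mul_one_sub, leftKernel_zero_mul hx, leftKernel_zero_mul hx, ← hpow]
    ring
  have hsubst := Measure.integral_comp_mul_left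
    (fun t ↦ leftKernel (1 - β) 0 t * leftKernel β 0 (x - t)) x
  simp only [hscale] at hsubst
  rw [integral_const_mul, abs_of_pos (inv_pos.2 hx), smul_eq_mul] at hsubst
  exact (mul_left_cancel₀ (inv_pos.2 hx).ne' hsubst).symm

theorem ae_convolutionExistsAt_leftKernel (hα : 0 < α) (hβ : 0 < β) :
    ∀ᵐ x, ConvolutionExistsAt (leftKernel α 0) (leftKernel β 0) x
      (ContinuousLinearMap.lsmul ℝ ℝ) volume := by
  filter_upwards [(integrable_leftKernel hα one_pos).ae_convolution_exists
    (ContinuousLinearMap.lsmul ℝ ℝ) (integrable_leftKernel hβ one_pos)] with x hx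
  refine (hx.const_mul (Real.exp x)).congr (.of_forall fun t ↦ ?_)
  simp only [ContinuousLinearMap.lsmul_apply, smul_eq_mul, leftKernel_eq_exp_mul _ 1]
  have hexp : Real.exp x * (Real.exp (-(1 * t)) * Real.exp (-(1 * (x - t)))) = 1 := by
    rw [← Real.exp_add, ← Real.exp_add, Real.exp_eq_one_iff]
    ring
  linear_combination (leftKernel α 0 t * leftKernel β 0 (x - t)) * hexp

theorem integrable_leftKernel_mul (hα : 0 < α) (hu : Continuous u) (hu0 : ∀ y ≤ 0, u y = 0)
    (x : ℝ) : Integrable fun t ↦ leftKernel α 0 t * u (x - t) := by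
  have hsupp : Function.support (fun t ↦ leftKernel α 0 t * u (x - t)) ⊆ Icc 0 x := by
    refine fun t ht ↦ ⟨?_, ?_⟩ <;> by_contra! h
    · exact ht (mul_eq_zero_of_left (leftKernel_of_nonpos h.le) _)
    · exact ht (mul_eq_zero_of_right _ (hu0 _ (by linarith)))
  exact (integrableOn_iff_integrable_of_support_subset hsupp).1
    (((locallyIntegrable_leftKernel hα).integrableOn_isCompact isCompact_Icc).mul_continuousOn
      (by fun_prop) isCompact_Icc)

theorem IsTest.leftKernel_convolution_assoc (hu : IsTest u) (hα : 0 < α) (hβ : 0 < β) (x : ℝ) :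
    ((leftKernel α 0 ⋆ leftKernel β 0) ⋆ u) x = (leftKernel α 0 ⋆ (leftKernel β 0 ⋆ u)) x := by
  have hnorm {γ : ℝ} (hγ : 0 < γ) : (fun t ↦ ‖leftKernel γ 0 t‖) = leftKernel γ 0 :=
    funext fun t ↦ Real.norm_of_nonneg (leftKernel_nonneg hγ 0 t)
  have hdamping := isDamping_leftKernel hβ
  refine convolution_assoc _ _ _ _ (fun a b c ↦ mul_assoc a b c)
    (locallyIntegrable_leftKernel hα).aestronglyMeasurable
    (locallyIntegrable_leftKernel hβ).aestronglyMeasurable hu.continuous.aestronglyMeasurable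
    (ae_convolutionExistsAt_leftKernel hα hβ) (.of_forall fun y ↦ ?_) ?_
  · rw [hnorm hβ]
    exact hdamping.integrable_mul_abs hu y
  · rw [hnorm hα, hnorm hβ]
    refine integrable_leftKernel_mul hα (hdamping.continuous_convolution_abs hu) (fun y hy ↦ ?_) x
    refine leftKernel_convolution_eq_zero (fun z hz ↦ ?_) 0 hy
    exact abs_eq_zero.2 (hu.eq_zero fun h ↦ hz.not_gt h.1)

theorem IsTest.leftKernel_convolution_convolution_deriv (hw : IsTest w) (hβ : 0 < β)
    (hβ1 : β < 1) (x : ℝ) :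
    (leftKernel (1 - β) 0 ⋆ (leftKernel β 0 ⋆ deriv w)) x =
      (leftKernel (1 - β) 0 ⋆ leftKernel β 0) 1 * w x := by
  rw [← hw.deriv.leftKernel_convolution_assoc (sub_pos.2 hβ1) hβ]
  calc ((leftKernel (1 - β) 0 ⋆ leftKernel β 0) ⋆ deriv w) x
    _ = ∫ s, (leftKernel (1 - β) 0 ⋆ leftKernel β 0) (x - s) * deriv w s := by
      rw [convolution_def, ← integral_sub_left_eq_self _ _ x]
      simp only [sub_sub_cancel, ContinuousLinearMap.lsmul_apply, smul_eq_mul]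
    _ = ∫ s in Iio x, (leftKernel (1 - β) 0 ⋆ leftKernel β 0) (x - s) * deriv w s := by
      refine (setIntegral_eq_integral_of_forall_compl_eq_zero fun s hs ↦ ?_).symm
      exact mul_eq_zero_of_left (leftKernel_convolution_eq_zero
        (fun y hy ↦ leftKernel_of_nonpos hy) 0 (sub_nonpos.2 (not_lt.1 hs))) _
    _ = ∫ s in Iio x, (leftKernel (1 - β) 0 ⋆ leftKernel β 0) 1 * deriv w s :=
      setIntegral_congr_fun measurableSet_Iio fun s hs ↦
        congrArg (· * deriv w s) (leftKernel_convolution_leftKernel_of_pos (sub_pos.2 hs))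
    _ = (leftKernel (1 - β) 0 ⋆ leftKernel β 0) 1 * w x := by
      rw [integral_const_mul, ← integral_Iic_eq_integral_Iio,
        hw.2.1.integral_Iic_deriv_eq (hw.1.of_le (by simp))]

theorem IsTest.integral_leftKernel_mul_convolution_deriv_eq_zero (hw : IsTest w) (hβ : 0 < β)
    (hβ1 : β < 1) :
    ∫ x, leftKernel (1 - β) 0 (1 - x) * (leftKernel β 0 ⋆ deriv w) x ∂vol01 = 0 := by
  have hconv := hw.leftKernel_convolution_convolution_deriv hβ hβ1 1
  rw [hw.eq_zero right_notMem_Ioo, mul_zero, convolution_def, ← integral_sub_left_eq_self _ _ 1]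
    at hconv
  simp only [sub_sub_cancel] at hconv
  refine (integral_vol01_eq fun x hx ↦ ?_).trans hconv
  rcases not_and_or.1 hx with h | h
  · exact mul_eq_zero_of_right _ (leftKernel_convolution_eq_zero
      (fun y hy ↦ hw.deriv.eq_zero fun h ↦ hy.not_gt h.1) 0 (not_lt.1 h))
  · exact mul_eq_zero_of_left (leftKernel_of_nonpos (by linarith)) _

end Semigroup

/-! ### Fractional integrals of test functions -/

section FractionalIntegral

variable {β θ x : ℝ} {f w : ℝ → ℝ}

theorem leftInt_eq_integral_leftKernel (hx : x ≤ 1) :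
    leftInt β f x = ∫ s, leftKernel β 0 (x - s) * f s ∂vol01 := by
  have hzero : ∀ s ∈ Ioo (0 : ℝ) 1 \ Ioo 0 x, leftKernel β 0 (x - s) * f s = 0 := fun s hs ↦
    mul_eq_zero_of_left (leftKernel_of_nonpos (sub_nonpos.2 (not_lt.1 fun h ↦ hs.2 ⟨hs.1.1, h⟩))) _
  rw [leftInt, ← integral_const_mul, setIntegral_eq_of_subset_of_forall_sdiff_eq_zero
    measurableSet_Ioo (Ioo_subset_Ioo_right hx) hzero]
  refine setIntegral_congr_fun measurableSet_Ioo fun s hs ↦ ?_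
  simp only [leftKernel_of_pos (sub_pos.2 hs.2), zero_mul, neg_zero, Real.exp_zero,
    ← neg_sub 1 β, Real.rpow_neg (sub_pos.2 hs.2).le]
  ring

theorem rightInt_eq_integral_rightKernel (hx : 0 ≤ x) :
    rightInt β f x = ∫ s, rightKernel β 0 (x - s) * f s ∂vol01 := by
  have hzero : ∀ s ∈ Ioo (0 : ℝ) 1 \ Ioo x 1, rightKernel β 0 (x - s) * f s = 0 := fun s hs ↦ by
    refine mul_eq_zero_of_left (leftKernel_of_nonpos ?_) _
    have : s ≤ x := not_lt.1 fun h ↦ hs.2 ⟨h, hs.1.2⟩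
    linarith
  rw [rightInt, ← integral_const_mul, setIntegral_eq_of_subset_of_forall_sdiff_eq_zero
    measurableSet_Ioo (Ioo_subset_Ioo_left hx) hzero]
  refine setIntegral_congr_fun measurableSet_Ioo fun s hs ↦ ?_
  simp only [rightKernel, neg_sub x s, leftKernel_of_pos (sub_pos.2 hs.1), zero_mul, neg_zero,
    Real.exp_zero, ← neg_sub 1 β, Real.rpow_neg (sub_pos.2 hs.1).le]
  ring

theorem IsTest.convolution_eq_integral_vol01 (hw : IsTest w) (k : ℝ → ℝ) (x : ℝ) :
    (k ⋆ w) x = ∫ s, k (x - s) * w s ∂vol01 := by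
  rw [integral_vol01_eq fun s hs ↦ mul_eq_zero_of_right _ (hw.eq_zero hs), convolution_def,
    ← integral_sub_left_eq_self _ _ x]
  simp only [sub_sub_cancel, ContinuousLinearMap.lsmul_apply, smul_eq_mul]

/-- The derivative of `I^β_θ w`, for a test function `w`. -/
noncomputable def fracDeriv (β θ : ℝ) (w : ℝ → ℝ) (x : ℝ) : ℝ :=
  θ * (leftKernel β 0 ⋆ deriv w) x + (1 - θ) * (rightKernel β 0 ⋆ deriv w) x

theorem locallyIntegrable_rightKernel (hβ : 0 < β) : LocallyIntegrable (rightKernel β 0) :=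
  (isDamping_rightKernel hβ).locallyIntegrable

theorem IsTest.continuous_fracDeriv (hw : IsTest w) (hβ : 0 < β) (θ : ℝ) :
    Continuous (fracDeriv β θ w) :=
  ((hw.deriv.continuous_convolution (locallyIntegrable_leftKernel hβ)).const_mul θ).add
    ((hw.deriv.continuous_convolution (locallyIntegrable_rightKernel hβ)).const_mul (1 - θ))

theorem IsTest.twoSidedInt_eq_add_integral (hw : IsTest w) (hβ : 0 < β) (θ : ℝ)
    (hx : x ∈ Icc (0 : ℝ) 1) :
    twoSidedInt β θ w x = twoSidedInt β θ w 0 + ∫ t in (0 : ℝ)..x, fracDeriv β θ w t := by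
  have hconv : ∀ y ∈ Icc (0 : ℝ) 1, twoSidedInt β θ w y =
      θ * (leftKernel β 0 ⋆ w) y + (1 - θ) * (rightKernel β 0 ⋆ w) y := fun y hy ↦ by
    rw [twoSidedInt, leftInt_eq_integral_leftKernel hy.2, rightInt_eq_integral_rightKernel hy.1,
      ← hw.convolution_eq_integral_vol01, ← hw.convolution_eq_integral_vol01]
  have hderiv : ∀ y, HasDerivAt
      (fun y ↦ θ * (leftKernel β 0 ⋆ w) y + (1 - θ) * (rightKernel β 0 ⋆ w) y)
      (fracDeriv β θ w y) y := fun y ↦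
    ((hw.hasDerivAt_convolution (locallyIntegrable_leftKernel hβ) y).const_mul θ).add
      ((hw.hasDerivAt_convolution (locallyIntegrable_rightKernel hβ) y).const_mul (1 - θ))
  rw [intervalIntegral.integral_eq_sub_of_hasDerivAt (fun y _ ↦ hderiv y)
    ((hw.continuous_fracDeriv hβ θ).intervalIntegrable _ _), hconv x hx,
    hconv 0 (left_mem_Icc.2 zero_le_one), add_sub_cancel]

theorem memLp_leftKernel {α : ℝ} (hα : 1 / 2 < α) :
    MemLp (fun x ↦ leftKernel α 0 (1 - x)) 2 vol01 := by
  have hsq : (fun t ↦ leftKernel α 0 t ^ 2) = fun t ↦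
      Real.Gamma (2 * α - 1) / Real.Gamma α ^ 2 * leftKernel (2 * α - 1) 0 t := by
    funext t
    rcases le_or_gt t 0 with ht | ht
    · simp [leftKernel_of_nonpos ht]
    · have hΓ := (Real.Gamma_pos_of_pos (show 0 < 2 * α - 1 by linarith)).ne'
      rw [leftKernel_of_pos ht, leftKernel_of_pos ht, show 2 * α - 1 - 1 = (α - 1) * (2 : ℕ) by
        push_cast; ring, Real.rpow_mul_natCast ht.le, zero_mul, neg_zero, Real.exp_zero]
      field_simp
      rw [mul_comm α 2, div_self hΓ]
  have hα0 : 0 < α := by linarith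
  have hmeas : AEStronglyMeasurable fun x ↦ leftKernel α 0 (1 - x) :=
    (locallyIntegrable_leftKernel hα0).aestronglyMeasurable.comp_quasiMeasurePreserving
      (Measure.measurePreserving_sub_left volume 1).quasiMeasurePreserving
  refine (memLp_two_iff_integrable_sq hmeas.restrict).2 ?_
  have hint : IntervalIntegrable (fun t ↦ leftKernel α 0 t ^ 2) volume 0 1 := by
    rw [hsq, intervalIntegrable_iff_integrableOn_Icc_of_le zero_le_one]
    exact ((locallyIntegrable_leftKernel (by linarith)).integrableOn_isCompact
      isCompact_Icc).const_mul _
  refine (intervalIntegrable_iff_integrableOn_Ioo_of_le zero_le_one).1 ?_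
  simpa using (hint.comp_sub_left 1).symm

end FractionalIntegral

/-! ### Operators from test functions to `L²(0,1)` -/

section L2

theorem memLp_vol01_of_continuousOn {f : ℝ → ℝ} (hf : ContinuousOn f (Icc 0 1)) :
    MemLp f 2 vol01 := by
  obtain ⟨C, hC⟩ := isCompact_Icc.exists_bound_of_continuousOn hf
  refine MemLp.of_bound ((hf.mono Ioo_subset_Icc_self).aestronglyMeasurable measurableSet_Ioo) C ?_
  filter_upwards [ae_restrict_mem measurableSet_Ioo] with x hx using hC x (Ioo_subset_Icc_self hx)

theorem inner_toLp {Ω : Type*} [MeasurableSpace Ω] {ν : Measure Ω} {f g : Ω → ℝ}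
    (hf : MemLp f 2 ν) (hg : MemLp g 2 ν) :
    ⟪hf.toLp f, hg.toLp g⟫ = ∫ x, f x * g x ∂ν := by
  rw [L2.inner_def]
  refine integral_congr_ae ?_
  filter_upwards [hf.coeFn_toLp, hg.coeFn_toLp] with x hfx hgx
  rw [hfx, hgx, Real.inner_apply]

theorem norm_toLp_sq {Ω : Type*} [MeasurableSpace Ω] {ν : Measure Ω} {f : Ω → ℝ}
    (hf : MemLp f 2 ν) : ‖hf.toLp f‖ ^ 2 = ∫ x, f x ^ 2 ∂ν := by
  rw [← real_inner_self_eq_norm_sq, inner_toLp]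
  simp only [sq]

/-- The linear map into `L²(0,1)` given by an operator on test functions with square integrable
values. -/
noncomputable def toL2 (T : testSpace →ₗ[ℝ] ℝ → ℝ) (hT : ∀ w, MemLp (T w) 2 vol01) :
    testSpace →ₗ[ℝ] Lp ℝ 2 vol01 where
  toFun w := (hT w).toLp (T w)
  map_add' u w := by simp only [map_add]; exact MemLp.toLp_add _ _
  map_smul' c w := by simp only [map_smul]; exact MemLp.toLp_const_smul _ _

section

variable {S T : testSpace →ₗ[ℝ] ℝ → ℝ} (hS : ∀ w, MemLp (S w) 2 vol01)
  (hT : ∀ w, MemLp (T w) 2 vol01)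

theorem inner_toL2 (v : Lp ℝ 2 vol01) (w : testSpace) :
    ⟪v, toL2 T hT w⟫ = ∫ x, v x * T w x ∂vol01 := by
  conv_lhs => rw [← Lp.toLp_coeFn v (Lp.memLp v)]
  exact inner_toLp (Lp.memLp v) (hT w)

theorem inner_toL2_toL2 (u w : testSpace) :
    ⟪toL2 S hS u, toL2 T hT w⟫ = ∫ x, S u x * T w x ∂vol01 :=
  inner_toLp (hS u) (hT w)

theorem norm_toL2_sq (w : testSpace) : ‖toL2 T hT w‖ ^ 2 = ∫ x, T w x ^ 2 ∂vol01 :=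
  norm_toLp_sq (hT w)

end

/-- Differentiation of test functions. -/
noncomputable def testDeriv : testSpace →ₗ[ℝ] ℝ → ℝ where
  toFun w := deriv w
  map_add' u w := funext fun x ↦ deriv_add (u.2.differentiable x) (w.2.differentiable x)
  map_smul' c w := funext fun x ↦ deriv_const_smul c (w.2.differentiable x)

/-- The operator `w ↦ k ⋆ w'` on test functions. -/
noncomputable def convDeriv (k : ℝ → ℝ) (hk : LocallyIntegrable k) : testSpace →ₗ[ℝ] ℝ → ℝ where
  toFun w := k ⋆ deriv w
  map_add' u w := by
    rw [show deriv ((u + w : testSpace) : ℝ → ℝ) = deriv u + deriv w from testDeriv.map_add u w]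
    exact (u.2.deriv.convolutionExists hk).distrib_add (w.2.deriv.convolutionExists hk)
  map_smul' c w := by
    rw [show deriv ((c • w : testSpace) : ℝ → ℝ) = c • deriv w from testDeriv.map_smul c w]
    exact convolution_smul

/-- Differentiation of test functions, as a map into `L²(0,1)`. -/
noncomputable def derivL2 : testSpace →ₗ[ℝ] Lp ℝ 2 vol01 :=
  toL2 testDeriv fun w ↦ w.2.deriv.memLp_vol01 2

/-- The inclusion of the test functions into `L²(0,1)`. -/
noncomputable def inclL2 : testSpace →ₗ[ℝ] Lp ℝ 2 vol01 :=
  toL2 testSpace.subtype fun w ↦ w.2.memLp_vol01 2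

/-- The operator `w ↦ k ⋆ w'`, as a map into `L²(0,1)`. -/
noncomputable def convDerivL2 (k : ℝ → ℝ) (hk : LocallyIntegrable k) :
    testSpace →ₗ[ℝ] Lp ℝ 2 vol01 :=
  toL2 (convDeriv k hk) fun w ↦
    memLp_vol01_of_continuousOn (w.2.deriv.continuous_convolution hk).continuousOn

/-- The constant function `1` in `L²(0,1)`. -/
noncomputable def oneL2 : Lp ℝ 2 vol01 := (memLp_const (1 : ℝ)).toLp _

theorem integrable_coeFn (v : Lp ℝ 2 vol01) : Integrable v vol01 :=
  (Lp.memLp v).integrable one_le_two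

theorem inner_derivL2_inclL2 (w η : testSpace) :
    ⟪derivL2 w, inclL2 η⟫ = -⟪inclL2 w, derivL2 η⟫ := by
  have hw := w.2
  have hη := η.2
  have hmul {f g : ℝ → ℝ} (hf : IsTest f) (hg : IsTest g) : Integrable (f * g) :=
    (hf.continuous.mul hg.continuous).integrable_of_hasCompactSupport hf.2.1.mul_right
  calc ⟪derivL2 w, inclL2 η⟫ = ∫ x, deriv (w : ℝ → ℝ) x * (η : ℝ → ℝ) x ∂vol01 :=
      inner_toL2_toL2 _ _ w η
    _ = ∫ x, deriv (w : ℝ → ℝ) x * (η : ℝ → ℝ) x :=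
      integral_vol01_eq fun x hx ↦ mul_eq_zero_of_right _ (hη.eq_zero hx)
    _ = -∫ x, (w : ℝ → ℝ) x * deriv (η : ℝ → ℝ) x := by
      rw [integral_mul_deriv_eq_deriv_mul_of_integrable
        (fun x _ ↦ (hw.differentiable x).hasDerivAt) (fun x _ ↦ (hη.differentiable x).hasDerivAt)
        (hmul hw hη.deriv) (hmul hw.deriv hη) (hmul hw hη), neg_neg]
    _ = -∫ x, (w : ℝ → ℝ) x * deriv (η : ℝ → ℝ) x ∂vol01 := by
      rw [integral_vol01_eq fun x hx ↦ mul_eq_zero_of_left (hw.eq_zero hx) _]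
    _ = -⟪inclL2 w, derivL2 η⟫ :=
      congrArg Neg.neg (inner_toL2_toL2 (S := testSpace.subtype) (T := testDeriv) _ _ w η).symm

theorem eq_zero_of_inner_inclL2_eq_zero {v : Lp ℝ 2 vol01} (h : ∀ η, ⟪v, inclL2 η⟫ = 0) :
    v = 0 :=
  (Lp.eq_zero_iff_ae_eq_zero).2 <| ae_eq_zero_of_integral_mul_eq_zero (integrable_coeFn v)
    fun η hη ↦ (inner_toL2 _ v ⟨η, hη⟩).symm.trans (h ⟨η, hη⟩)

theorem mem_closure_range_derivL2 {v : Lp ℝ 2 vol01} (hv : ⟪v, oneL2⟫ = 0) :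
    v ∈ closure (range derivL2) := by
  rw [← LinearMap.coe_range, ← Submodule.topologicalClosure_coe,
    ← Submodule.orthogonal_orthogonal_eq_closure]
  intro z hz
  obtain ⟨c, hc⟩ := ae_eq_const_of_integral_mul_deriv_eq_zero (integrable_coeFn z) fun η hη ↦ by
    have horth : ⟪z, derivL2 ⟨η, hη⟩⟫ = 0 := by rw [real_inner_comm]; exact hz _ ⟨_, rfl⟩
    exact (inner_toL2 _ z ⟨η, hη⟩).symm.trans horth
  have hz_eq : z = c • oneL2 := by
    refine Lp.ext ?_
    filter_upwards [hc, Lp.coeFn_smul c oneL2, (memLp_const (1 : ℝ)).coeFn_toLp]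
      with x hzx hsmul hone
    rw [hzx, hsmul, Pi.smul_apply, oneL2, hone, smul_eq_mul, mul_one]
  rw [hz_eq, inner_smul_left, real_inner_comm, hv, mul_zero]

theorem norm_inclL2_sq (w : testSpace) : ‖inclL2 w‖ ^ 2 = ∫ x, (w : ℝ → ℝ) x ^ 2 :=
  (norm_toL2_sq _ w).trans <| integral_vol01_eq fun x hx ↦ by simp [w.2.eq_zero hx]

theorem norm_derivL2_sq (w : testSpace) : ‖derivL2 w‖ ^ 2 = ∫ x, deriv (w : ℝ → ℝ) x ^ 2 :=
  (norm_toL2_sq _ w).trans <| integral_vol01_eq fun x hx ↦ by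
    simpa [testDeriv] using w.2.deriv.eq_zero hx

theorem exists_test_deriv_near {v : ℝ → ℝ} (hv : MemLp v 2 vol01) (h0 : ∫ x, v x ∂vol01 = 0)
    {ε : ℝ} (hε : 0 < ε) : ∃ w, IsTest w ∧ ∫ x, (v x - deriv w x) ^ 2 ∂vol01 < ε := by
  have hclosure : hv.toLp v ∈ closure (range derivL2) := mem_closure_range_derivL2 <|
    (inner_toLp hv (memLp_const 1)).trans (by simpa only [mul_one] using h0)
  obtain ⟨_, ⟨w, rfl⟩, hw⟩ := Metric.mem_closure_iff.1 hclosure (√ε) (Real.sqrt_pos.2 hε)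
  rw [dist_eq_norm, Real.lt_sqrt (norm_nonneg _)] at hw
  refine ⟨w, w.2, lt_of_eq_of_lt ?_ hw⟩
  exact (norm_toLp_sq (hv.sub (w.2.deriv.memLp_vol01 2))).symm

end L2

/-! ### The range of the fractional derivative -/

section Range

variable {β θ : ℝ} {w : ℝ → ℝ}

/-- The left fractional derivative `w ↦ (₀I^β w)'`, as a map into `L²(0,1)`. -/
noncomputable def leftDerivL2 (hβ : 0 < β) : testSpace →ₗ[ℝ] Lp ℝ 2 vol01 :=
  convDerivL2 (leftKernel β 0) (locallyIntegrable_leftKernel hβ)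

/-- The right fractional derivative `w ↦ (I₁^β w)'`, as a map into `L²(0,1)`. -/
noncomputable def rightDerivL2 (hβ : 0 < β) : testSpace →ₗ[ℝ] Lp ℝ 2 vol01 :=
  convDerivL2 (rightKernel β 0) (locallyIntegrable_rightKernel hβ)

/-- The operator `w ↦ (I^β_θ w)'`, as a map into `L²(0,1)`. -/
noncomputable def fracDerivL2 (hβ : 0 < β) (θ : ℝ) : testSpace →ₗ[ℝ] Lp ℝ 2 vol01 :=
  mixed (leftDerivL2 hβ) (rightDerivL2 hβ) θ

theorem cos_pi_mul_pos (hβ : 0 < β) (hβ' : β < 1 / 2) : 0 < Real.cos (π * β) :=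
  Real.cos_pos_of_mem_Ioo ⟨by nlinarith [Real.pi_pos], by nlinarith [Real.pi_pos]⟩

theorem fourierSeminormSq_nonneg (μ : ℝ) (w : ℝ → ℝ) : 0 ≤ fourierSeminormSq μ w :=
  integral_nonneg fun _ ↦ by positivity

theorem coercivePair_leftDerivL2_rightDerivL2 (hβ : 0 < β) (hβ' : β ≤ 1 / 2) :
    CoercivePair (leftDerivL2 hβ) (rightDerivL2 hβ) (fun w ↦ √(fourierSeminormSq (1 - β) w))
      (Real.cos (π * β)) where
  norm_left_le w := Real.le_sqrt_of_sq_le <| (norm_toL2_sq _ w).trans_le <|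
    w.2.integral_leftKernel_convolution_sq_le hβ (by linarith)
  norm_right_le w := Real.le_sqrt_of_sq_le <| (norm_toL2_sq _ w).trans_le <|
    w.2.integral_rightKernel_convolution_sq_le hβ (by linarith)
  le_inner w := by
    rw [Real.sq_sqrt (fourierSeminormSq_nonneg _ _)]
    exact (w.2.cos_mul_fourierSeminormSq_le hβ hβ').trans_eq
      (inner_toL2_toL2 (S := convDeriv _ (locallyIntegrable_leftKernel hβ))
        (T := convDeriv _ (locallyIntegrable_rightKernel hβ)) _ _ w w).symm

theorem toLp_leftKernel_ne_zero (hβ' : β < 1 / 2) :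
    (memLp_leftKernel (show 1 / 2 < 1 - β by linarith)).toLp _ ≠ 0 := by
  intro h
  have hzero := Lp.eq_zero_iff_ae_eq_zero.1 h
  have hfalse : ∀ᵐ _ ∂vol01, False := by
    filter_upwards [hzero, (memLp_leftKernel (show 1 / 2 < 1 - β by linarith)).coeFn_toLp,
      ae_restrict_mem measurableSet_Ioo] with x hx hcoe hmem
    have hpos := sub_pos.2 hmem.2
    have hΓ := Real.Gamma_pos_of_pos (show 0 < 1 - β by linarith)
    rw [hcoe, leftKernel_of_pos hpos, Pi.zero_apply] at hx
    exact (div_pos (mul_pos (Real.rpow_pos_of_pos hpos _) (Real.exp_pos _)) hΓ).ne' hx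
  exact hfalse.exists.elim fun _ ↦ id

/-- For `θ = 1` the range is orthogonal to `(1 - x)^(-β)`; the continuity method carries this over
to every `θ`. -/
theorem not_denseRange_fracDerivL2 (hβ : 0 < β) (hβ' : β < 1 / 2) (hθ : θ ∈ Icc (0 : ℝ) 1) :
    ¬ DenseRange (fracDerivL2 hβ θ) := by
  rw [fracDerivL2, (coercivePair_leftDerivL2_rightDerivL2 hβ hβ'.le).denseRange_mixed_iff
    (cos_pi_mul_pos hβ hβ') hθ (right_mem_Icc.2 zero_le_one)]
  refine not_denseRange_of_orthogonal (toLp_leftKernel_ne_zero hβ') fun w ↦ ?_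
  have hleft : mixed (leftDerivL2 hβ) (rightDerivL2 hβ) 1 w = leftDerivL2 hβ w := by
    rw [mixed_apply, one_smul, sub_self, zero_smul, add_zero]
  rw [hleft]
  exact (inner_toLp _ (memLp_vol01_of_continuousOn
    (w.2.deriv.continuous_convolution (locallyIntegrable_leftKernel hβ)).continuousOn)).trans
    (w.2.integral_leftKernel_mul_convolution_deriv_eq_zero hβ (by linarith))

theorem norm_fracDerivL2_le (hβ : 0 < β) (hβ' : β ≤ 1 / 2) (hθ : θ ∈ Icc (0 : ℝ) 1)
    (w : testSpace) : ‖fracDerivL2 hβ θ w‖ ≤ √(fourierSeminormSq (1 - β) w) :=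
  norm_mixed_le ((coercivePair_leftDerivL2_rightDerivL2 hβ hβ').norm_left_le w)
    ((coercivePair_leftDerivL2_rightDerivL2 hβ hβ').norm_right_le w) hθ

theorem norm_fracDerivL2_le_norm_derivL2 (hβ : 0 < β) (hβ' : β ≤ 1 / 2) (hθ : θ ∈ Icc (0 : ℝ) 1)
    (w : testSpace) : ‖fracDerivL2 hβ θ w‖ ≤ √3 * ‖derivL2 w‖ := by
  refine (norm_fracDerivL2_le hβ hβ' hθ w).trans ?_
  rw [← Real.sqrt_sq (norm_nonneg (derivL2 w)), ← Real.sqrt_mul (by norm_num), norm_derivL2_sq]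
  exact Real.sqrt_le_sqrt (w.2.fourierSeminormSq_le (by linarith) (by linarith))

theorem norm_inclL2_sq_le_inner_fracDerivL2 (hβ : 0 < β) (hβ1 : β ≤ 1) (hθ : θ ∈ Icc (0 : ℝ) 1)
    (w : testSpace) :
    Real.cos (π * β / 2) / 4 * ‖inclL2 w‖ ^ 2 ≤ ⟪fracDerivL2 hβ θ w, derivL2 w⟫ := by
  have hleft : Real.cos (π * β / 2) / 4 * ‖inclL2 w‖ ^ 2 ≤ ⟪leftDerivL2 hβ w, derivL2 w⟫ := by
    rw [norm_inclL2_sq]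
    exact (w.2.integral_sq_le_leftKernel hβ hβ1).trans_eq
      (inner_toL2_toL2 (S := convDeriv _ (locallyIntegrable_leftKernel hβ)) (T := testDeriv)
        _ _ w w).symm
  have hright : Real.cos (π * β / 2) / 4 * ‖inclL2 w‖ ^ 2 ≤ ⟪rightDerivL2 hβ w, derivL2 w⟫ := by
    rw [norm_inclL2_sq]
    exact (w.2.integral_sq_le_rightKernel hβ hβ1).trans_eq
      (inner_toL2_toL2 (S := convDeriv _ (locallyIntegrable_rightKernel hβ)) (T := testDeriv)
        _ _ w w).symm
  rw [fracDerivL2, mixed_apply, inner_add_left, real_inner_smul_left, real_inner_smul_left]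
  linarith [mul_le_mul_of_nonneg_left hleft hθ.1,
    mul_le_mul_of_nonneg_left hright (sub_nonneg.2 hθ.2)]

theorem eq_zero_of_inner_fracDerivL2_eq_zero (hβ : 0 < β) (hβ' : β ≤ 1 / 2)
    (hθ : θ ∈ Icc (0 : ℝ) 1) {v : Lp ℝ 2 vol01} (hv : ⟪v, oneL2⟫ = 0)
    (hvA : ∀ w, ⟪v, fracDerivL2 hβ θ w⟫ = 0) : v = 0 := by
  have hcos : 0 < Real.cos (π * β / 2) := Real.cos_pos_of_mem_Ioo
    ⟨by nlinarith [Real.pi_pos], by nlinarith [Real.pi_pos]⟩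
  exact eq_zero_of_orthogonal (div_pos hcos four_pos)
    (norm_fracDerivL2_le_norm_derivL2 hβ hβ' hθ)
    (norm_inclL2_sq_le_inner_fracDerivL2 hβ (by linarith) hθ) inner_derivL2_inclL2
    (fun _ ↦ eq_zero_of_inner_inclL2_eq_zero) (mem_closure_range_derivL2 hv) hvA

theorem exists_orthogonal_fracDerivL2 (hβ : 0 < β) (hβ' : β < 1 / 2) (hθ : θ ∈ Icc (0 : ℝ) 1) :
    ∃ z : Lp ℝ 2 vol01, (∀ w, ⟪z, fracDerivL2 hβ θ w⟫ = 0) ∧ ⟪z, oneL2⟫ ≠ 0 := by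
  obtain ⟨z, hz, hzA⟩ := exists_orthogonal_range_ne_zero (not_denseRange_fracDerivL2 hβ hβ' hθ)
  exact ⟨z, hzA, fun h ↦ hz (eq_zero_of_inner_fracDerivL2_eq_zero hβ hβ'.le hθ h hzA)⟩

/-- The squared `H^μ` norm of a test function. -/
noncomputable def testNormSq (μ : ℝ) (w : ℝ → ℝ) : ℝ := (∫ x, w x ^ 2) + fourierSeminormSq μ w

theorem IsTest.testNormSq_le (hw : IsTest w) {μ : ℝ} (h0 : 0 ≤ μ) (h1 : μ ≤ 1) :
    testNormSq μ w ≤ 3 * fourierSeminormSq μ w := by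
  rw [testNormSq]
  linarith [hw.integral_sq_le_fourierSeminormSq h0 h1]

theorem IsTest.memLp_fracDeriv (hw : IsTest w) (hβ : 0 < β) (θ : ℝ) :
    MemLp (fracDeriv β θ w) 2 vol01 :=
  memLp_vol01_of_continuousOn (hw.continuous_fracDeriv hβ θ).continuousOn

theorem fracDerivL2_eq_toLp (hβ : 0 < β) (θ : ℝ) (w : testSpace) :
    fracDerivL2 hβ θ w = (w.2.memLp_fracDeriv hβ θ).toLp _ := by
  have hleft := memLp_vol01_of_continuousOn
    (w.2.deriv.continuous_convolution (locallyIntegrable_leftKernel hβ)).continuousOn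
  have hright := memLp_vol01_of_continuousOn
    (w.2.deriv.continuous_convolution (locallyIntegrable_rightKernel hβ)).continuousOn
  change θ • hleft.toLp _ + (1 - θ) • hright.toLp _ = _
  rw [← MemLp.toLp_const_smul, ← MemLp.toLp_const_smul, ← MemLp.toLp_add]
  rfl

theorem norm_fracDerivL2_sub_smul_oneL2_sq (hβ : 0 < β) (θ c : ℝ) (w : testSpace) :
    ‖fracDerivL2 hβ θ w - c • oneL2‖ ^ 2 = ∫ x, (fracDeriv β θ w x - c) ^ 2 ∂vol01 := by
  rw [fracDerivL2_eq_toLp, oneL2, ← MemLp.toLp_const_smul, ← MemLp.toLp_sub, norm_toLp_sq]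
  simp only [Pi.sub_apply, Pi.smul_apply, smul_eq_mul, mul_one]

theorem IsTest.integral_fracDeriv_sq_le (hw : IsTest w) (hβ : 0 < β) (hβ' : β ≤ 1 / 2)
    (hθ : θ ∈ Icc (0 : ℝ) 1) : ∫ x, fracDeriv β θ w x ^ 2 ∂vol01 ≤ testNormSq (1 - β) w := by
  have hnorm := norm_fracDerivL2_le hβ hβ' hθ ⟨w, hw⟩
  rw [Real.le_sqrt (norm_nonneg _) (fourierSeminormSq_nonneg _ _), fracDerivL2_eq_toLp,
    norm_toLp_sq] at hnorm
  exact hnorm.trans (le_add_of_nonneg_left (integral_nonneg fun x ↦ sq_nonneg _))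

theorem exists_testNormSq_le (hβ : 0 < β) (hβ' : β < 1 / 2) (hθ : θ ∈ Icc (0 : ℝ) 1) :
    ∃ κ : ℝ, 0 < κ ∧ ∀ w, IsTest w → ∀ c : ℝ,
      κ * testNormSq (1 - β) w ≤ ∫ x, (fracDeriv β θ w x - c) ^ 2 ∂vol01 := by
  obtain ⟨z, hzA, hz⟩ := exists_orthogonal_fracDerivL2 hβ hβ' hθ
  have hcos := cos_pi_mul_pos hβ hβ'
  set K := 1 + ‖z‖ * ‖oneL2‖ / |⟪z, oneL2⟫|
  have hKpos : 0 < K := by positivity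
  refine ⟨(Real.cos (π * β) / 2 / K) ^ 2 / 3, by positivity, fun w hw c ↦ ?_⟩
  have hlower : Real.cos (π * β) / 2 * √(fourierSeminormSq (1 - β) w) ≤
      K * ‖fracDerivL2 hβ θ ⟨w, hw⟩ - c • oneL2‖ :=
    ((coercivePair_leftDerivL2_rightDerivL2 hβ hβ'.le).le_norm_mixed hθ ⟨w, hw⟩).trans
      (norm_le_mul_norm_sub_smul hzA hz ⟨w, hw⟩ c)
  calc (Real.cos (π * β) / 2 / K) ^ 2 / 3 * testNormSq (1 - β) w
    _ ≤ (Real.cos (π * β) / 2 / K) ^ 2 / 3 * (3 * fourierSeminormSq (1 - β) w) := by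
      gcongr
      exact hw.testNormSq_le (by linarith) (by linarith)
    _ = (Real.cos (π * β) / 2 * √(fourierSeminormSq (1 - β) w) / K) ^ 2 := by
      rw [mul_div_right_comm, mul_pow, Real.sq_sqrt (fourierSeminormSq_nonneg _ _)]
      ring
    _ ≤ ‖fracDerivL2 hβ θ ⟨w, hw⟩ - c • oneL2‖ ^ 2 := by
      gcongr
      exact (div_le_iff₀' hKpos).2 hlower
    _ = ∫ x, (fracDeriv β θ w x - c) ^ 2 ∂vol01 :=
      norm_fracDerivL2_sub_smul_oneL2_sq hβ θ c ⟨w, hw⟩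

theorem exists_fracDeriv_near (hβ : 0 < β) (hβ' : β < 1 / 2) (hθ : θ ∈ Icc (0 : ℝ) 1)
    {d : ℝ → ℝ} (hd : MemLp d 2 vol01) : ∃ c : ℝ, ∀ ε > 0, ∃ w, IsTest w ∧
      ∫ x, (fracDeriv β θ w x - (d x - c)) ^ 2 ∂vol01 < ε := by
  obtain ⟨z, hzA, hz⟩ := exists_orthogonal_fracDerivL2 hβ hβ' hθ
  obtain ⟨c, hc⟩ := exists_sub_smul_mem_closure_range hzA hz
    (fun v ↦ eq_zero_of_inner_fracDerivL2_eq_zero hβ hβ'.le hθ) (hd.toLp d)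
  refine ⟨c, fun ε hε ↦ ?_⟩
  obtain ⟨_, ⟨w, rfl⟩, hw⟩ := Metric.mem_closure_iff.1 hc (√ε) (Real.sqrt_pos.2 hε)
  refine ⟨w, w.2, ?_⟩
  rw [dist_comm, dist_eq_norm, fracDerivL2_eq_toLp, oneL2, ← MemLp.toLp_const_smul,
    ← MemLp.toLp_sub, ← MemLp.toLp_sub, Real.lt_sqrt (norm_nonneg _), norm_toLp_sq] at hw
  simpa only [Pi.sub_apply, Pi.smul_apply, smul_eq_mul, mul_one] using hw

end Range

/-! ### Convergence in mean square -/

section MeanSquare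

variable {Ω : Type*} [MeasurableSpace Ω] {ν : Measure Ω}

theorem sq_integral_mul_le {f g : Ω → ℝ} (hf : MemLp f 2 ν) (hg : MemLp g 2 ν) :
    (∫ x, f x * g x ∂ν) ^ 2 ≤ (∫ x, f x ^ 2 ∂ν) * ∫ x, g x ^ 2 ∂ν := by
  rw [← inner_toLp hf hg, ← norm_toLp_sq hf, ← norm_toLp_sq hg, ← mul_pow, ← sq_abs]
  exact pow_le_pow_left₀ (abs_nonneg _) (abs_real_inner_le_norm _ _) 2

theorem integral_sub_sq_le {f g : Ω → ℝ} (hf : MemLp f 2 ν) (hg : MemLp g 2 ν) :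
    ∫ x, (f x - g x) ^ 2 ∂ν ≤ 2 * (∫ x, f x ^ 2 ∂ν) + 2 * ∫ x, g x ^ 2 ∂ν := by
  rw [← integral_const_mul, ← integral_const_mul,
    ← integral_add (hf.integrable_sq.const_mul 2) (hg.integrable_sq.const_mul 2)]
  refine integral_mono (hf.sub hg).integrable_sq
    ((hf.integrable_sq.const_mul 2).add (hg.integrable_sq.const_mul 2)) fun x ↦ ?_
  change (f x - g x) ^ 2 ≤ 2 * f x ^ 2 + 2 * g x ^ 2
  linarith [sq_nonneg (f x + g x), add_sq (f x) (g x), sub_sq (f x) (g x)]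

theorem norm_toLp_sub_toLp_sq {f g : Ω → ℝ} (hf : MemLp f 2 ν) (hg : MemLp g 2 ν) :
    ‖hf.toLp f - hg.toLp g‖ ^ 2 = ∫ x, (f x - g x) ^ 2 ∂ν := by
  rw [← MemLp.toLp_sub, norm_toLp_sq]
  rfl

theorem exists_tendsto_of_cauchy {f : ℕ → Ω → ℝ} (hf : ∀ n, MemLp (f n) 2 ν)
    (hc : ∀ ε > 0, ∃ N, ∀ n ≥ N, ∀ m ≥ N, ∫ x, (f n x - f m x) ^ 2 ∂ν ≤ ε) :
    ∃ g, MemLp g 2 ν ∧ Tendsto (fun n ↦ ∫ x, (g x - f n x) ^ 2 ∂ν) atTop (𝓝 0) := by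
  have hcauchy : CauchySeq fun n ↦ (hf n).toLp (f n) := by
    refine Metric.cauchySeq_iff.2 fun ε hε ↦ ?_
    obtain ⟨N, hN⟩ := hc ((ε / 2) ^ 2) (by positivity)
    refine ⟨N, fun n hn m hm ↦ ?_⟩
    rw [dist_eq_norm]
    refine (pow_le_pow_iff_left₀ (norm_nonneg _) (half_pos hε).le two_ne_zero).1 ?_
      |>.trans_lt (half_lt_self hε)
    exact (norm_toLp_sub_toLp_sq (hf n) (hf m)).trans_le (hN n hn m hm)
  obtain ⟨g, hg⟩ := cauchySeq_tendsto_of_complete hcauchy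
  refine ⟨g, Lp.memLp g, ?_⟩
  have hsq := (tendsto_iff_norm_sub_tendsto_zero.1 hg).pow 2
  rw [zero_pow two_ne_zero] at hsq
  refine hsq.congr fun n ↦ ?_
  rw [norm_sub_rev, ← norm_toLp_sub_toLp_sq (Lp.memLp g) (hf n), Lp.toLp_coeFn]

theorem exists_subseq_tendsto_ae {f : ℕ → Ω → ℝ} {g : Ω → ℝ} (hf : ∀ n, MemLp (f n) 2 ν)
    (hg : MemLp g 2 ν) (h : Tendsto (fun n ↦ ∫ x, (g x - f n x) ^ 2 ∂ν) atTop (𝓝 0)) :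
    ∃ ns : ℕ → ℕ, StrictMono ns ∧
      ∀ᵐ x ∂ν, Tendsto (fun i ↦ f (ns i) x) atTop (𝓝 (g x)) := by
  have hlim : Tendsto (fun n ↦ (hf n).toLp (f n)) atTop (𝓝 (hg.toLp g)) := by
    rw [tendsto_iff_norm_sub_tendsto_zero]
    have hsqrt := h.sqrt
    rw [Real.sqrt_zero] at hsqrt
    refine hsqrt.congr fun n ↦ ?_
    rw [← norm_toLp_sub_toLp_sq hg (hf n), Real.sqrt_sq (norm_nonneg _), norm_sub_rev]
  obtain ⟨ns, hns, hae⟩ := (tendstoInMeasure_of_tendsto_Lp hlim).exists_seq_tendsto_ae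
  refine ⟨ns, hns, ?_⟩
  filter_upwards [hae, ae_all_iff.2 fun n ↦ (hf n).coeFn_toLp, hg.coeFn_toLp] with x hx hfx hgx
  simpa only [hfx, hgx] using hx

end MeanSquare

theorem integrable_and_integral_le_of_tendsto {ν : Measure ℝ} {F : ℕ → ℝ → ℝ} {G : ℝ → ℝ} {ε : ℝ}
    (hF : ∀ n, Integrable (F n) ν) (h0 : ∀ n x, 0 ≤ F n x)
    (hlim : ∀ x, Tendsto (F · x) atTop (𝓝 (G x))) (hle : ∀ᶠ n in atTop, ∫ x, F n x ∂ν ≤ ε) :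
    Integrable G ν ∧ ∫ x, G x ∂ν ≤ ε := by
  have hG0 (x : ℝ) : 0 ≤ G x := ge_of_tendsto' (hlim x) (h0 · x)
  have hε : 0 ≤ ε := hle.exists.elim fun n hn ↦ (integral_nonneg (h0 n)).trans hn
  have hliminf : liminf (fun n ↦ ∫⁻ x, ‖F n x‖ₑ ∂ν) atTop ≤ ENNReal.ofReal ε := by
    refine liminf_le_of_frequently_le' (Eventually.frequently (hle.mono fun n hn ↦ ?_))
    rw [← ofReal_integral_norm_eq_lintegral_enorm (hF n)]
    simpa only [Real.norm_of_nonneg (h0 n _)] using ENNReal.ofReal_le_ofReal hn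
  have hG : Integrable G ν := integrable_of_tendsto (.of_forall hlim)
    (fun n ↦ (hF n).aestronglyMeasurable) (hliminf.trans_lt ENNReal.ofReal_lt_top).ne
  refine ⟨hG, (ENNReal.ofReal_le_ofReal_iff hε).1 ?_⟩
  have hfatou := (lintegral_enorm_le_liminf_of_tendsto (.of_forall hlim)
    fun n ↦ (hF n).aestronglyMeasurable.aemeasurable.enorm).trans hliminf
  rw [← ofReal_integral_norm_eq_lintegral_enorm hG] at hfatou
  simpa only [Real.norm_of_nonneg (hG0 _)] using hfatou

/-! ### The Sobolev inequality -/

section Sobolev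

variable {w : ℝ → ℝ} {μ : ℝ}

theorem integrable_sobolev_weight (hμ : 1 / 2 < μ) :
    Integrable (fun ξ : ℝ ↦ (1 + (|2 * π * ξ| ^ μ) ^ 2)⁻¹) := by
  have hdecay := integrable_one_add_norm (E := ℝ) (μ := volume) (r := 2 * μ)
    (by rw [Module.finrank_self, Nat.cast_one]; linarith)
  refine (hdecay.const_mul (2 ^ (2 * μ))).mono (Measurable.aestronglyMeasurable (by fun_prop))
    (.of_forall fun ξ ↦ ?_)
  have hsq : (|2 * π * ξ| ^ μ) ^ 2 = |2 * π * ξ| ^ (2 * μ) := by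
    rw [← Real.rpow_natCast, ← Real.rpow_mul (abs_nonneg _), mul_comm μ, Nat.cast_ofNat]
  have hξ : |ξ| ≤ |2 * π * ξ| := by
    rw [abs_mul, abs_of_pos Real.two_pi_pos]
    exact le_mul_of_one_le_left (abs_nonneg ξ) (by linarith [Real.pi_gt_three])
  have hweight : (1 + |ξ|) ^ (2 * μ) ≤ 2 ^ (2 * μ) * (1 + |2 * π * ξ| ^ (2 * μ)) := by
    rcases le_total |ξ| 1 with h | h
    · calc (1 + |ξ|) ^ (2 * μ) ≤ 2 ^ (2 * μ) :=
          Real.rpow_le_rpow (by positivity) (by linarith) (by linarith)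
        _ ≤ 2 ^ (2 * μ) * (1 + |2 * π * ξ| ^ (2 * μ)) :=
          le_mul_of_one_le_right (by positivity) (le_add_of_nonneg_right (by positivity))
    · calc (1 + |ξ|) ^ (2 * μ) ≤ (2 * |2 * π * ξ|) ^ (2 * μ) :=
          Real.rpow_le_rpow (by positivity) (by linarith) (by linarith)
        _ = 2 ^ (2 * μ) * |2 * π * ξ| ^ (2 * μ) := Real.mul_rpow two_pos.le (abs_nonneg _)
        _ ≤ 2 ^ (2 * μ) * (1 + |2 * π * ξ| ^ (2 * μ)) := by gcongr; linarith
  rw [Real.norm_of_nonneg (by positivity), Real.norm_of_nonneg (by positivity),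
    Real.rpow_neg (by positivity), ← div_eq_mul_inv, inv_eq_one_div, hsq,
    div_le_div_iff₀ (by positivity) (by positivity), one_mul, Real.norm_eq_abs]
  exact hweight

theorem IsTest.abs_le_integral_norm_realFourier (hw : IsTest w) (x : ℝ) :
    |w x| ≤ ∫ ξ, ‖realFourier w ξ‖ := by
  have hinv : 𝓕⁻ (realFourier w) = fun x ↦ (w x : ℂ) :=
    (Complex.continuous_ofReal.comp hw.continuous).fourierInv_fourier_eq hw.integrable.ofReal
      hw.integrable_realFourier
  calc |w x| = ‖𝓕⁻ (realFourier w) x‖ := by rw [hinv, Complex.norm_real, Real.norm_eq_abs]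
    _ ≤ ∫ ξ, ‖Real.fourierChar (inner ℝ ξ x) • realFourier w ξ‖ := by
      rw [Real.fourierInv_eq]
      exact norm_integral_le_integral_norm _
    _ = ∫ ξ, ‖realFourier w ξ‖ := by simp only [Circle.norm_smul]

theorem IsTest.integrable_sobolev_weight_mul (hw : IsTest w) (h0 : 0 ≤ μ) (h1 : μ ≤ 1) :
    Integrable (fun ξ ↦ (1 + (|2 * π * ξ| ^ μ) ^ 2) * ‖realFourier w ξ‖ ^ 2) := by
  simp only [add_mul, one_mul]
  exact hw.integrable_norm_realFourier_sq.add (hw.integrable_fourierSeminormSq h0 h1)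

theorem IsTest.testNormSq_eq_integral (hw : IsTest w) (h0 : 0 ≤ μ) (h1 : μ ≤ 1) :
    testNormSq μ w = ∫ ξ, (1 + (|2 * π * ξ| ^ μ) ^ 2) * ‖realFourier w ξ‖ ^ 2 := by
  simp only [add_mul, one_mul]
  rw [integral_add hw.integrable_norm_realFourier_sq (hw.integrable_fourierSeminormSq h0 h1),
    hw.integral_norm_realFourier_sq]
  rfl

theorem IsTest.sq_integral_norm_realFourier_le (hw : IsTest w) (h0 : 1 / 2 < μ) (h1 : μ ≤ 1) :
    (∫ ξ, ‖realFourier w ξ‖) ^ 2 ≤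
      (∫ ξ : ℝ, (1 + (|2 * π * ξ| ^ μ) ^ 2)⁻¹) * testNormSq μ w := by
  set m : ℝ → ℝ := fun ξ ↦ 1 + (|2 * π * ξ| ^ μ) ^ 2
  have hm (ξ : ℝ) : 0 < m ξ := by positivity
  have hmeas : Measurable m := by fun_prop
  have hfsq (ξ : ℝ) : (√(m ξ))⁻¹ ^ 2 = (m ξ)⁻¹ := by rw [inv_pow, Real.sq_sqrt (hm ξ).le]
  have hgsq (ξ : ℝ) : (√(m ξ) * ‖realFourier w ξ‖) ^ 2 = m ξ * ‖realFourier w ξ‖ ^ 2 := by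
    rw [mul_pow, Real.sq_sqrt (hm ξ).le]
  have hfmeas : Measurable fun ξ ↦ (√(m ξ))⁻¹ := hmeas.sqrt.inv
  have hgmeas : Measurable fun ξ ↦ √(m ξ) * ‖realFourier w ξ‖ :=
    hmeas.sqrt.mul (continuous_realFourier hw.integrable).norm.measurable
  have hf : MemLp (fun ξ ↦ (√(m ξ))⁻¹) 2 := by
    refine (memLp_two_iff_integrable_sq hfmeas.aestronglyMeasurable).2 ?_
    simpa only [hfsq] using integrable_sobolev_weight h0
  have hg : MemLp (fun ξ ↦ √(m ξ) * ‖realFourier w ξ‖) 2 := by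
    refine (memLp_two_iff_integrable_sq hgmeas.aestronglyMeasurable).2 ?_
    simpa only [hgsq] using hw.integrable_sobolev_weight_mul (by linarith) h1
  have hcs := sq_integral_mul_le hf hg
  simp only [hfsq, hgsq, inv_mul_cancel_left₀ (Real.sqrt_ne_zero'.2 (hm _))] at hcs
  rwa [hw.testNormSq_eq_integral (by linarith) h1]

theorem exists_sobolev (h0 : 1 / 2 < μ) (h1 : μ ≤ 1) :
    ∃ C : ℝ, 0 ≤ C ∧ ∀ w, IsTest w → ∀ x, w x ^ 2 ≤ C * testNormSq μ w := by
  refine ⟨∫ ξ : ℝ, (1 + (|2 * π * ξ| ^ μ) ^ 2)⁻¹, integral_nonneg fun ξ ↦ by positivity,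
    fun w hw x ↦ ?_⟩
  refine le_trans ?_ (hw.sq_integral_norm_realFourier_le h0 h1)
  exact sq_le_sq' (by linarith [neg_abs_le (w x), hw.abs_le_integral_norm_realFourier x])
    ((le_abs_self _).trans (hw.abs_le_integral_norm_realFourier x))

end Sobolev

/-! ### The space `H^μ₀(0,1)` -/

section HSpace

/-- The square of the norm of `H^μ₀(0,1)`. -/
noncomputable def hNormSq (μ : ℝ) (φ : ℝ → ℝ) : ℝ :=
  (∫ x, φ x ^ 2 ∂vol01) + ∫ ξ, fourierWeight μ φ ξ ^ 2

/-- The functions on `(0,1)` of finite `H^μ` norm. -/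
def MemH (μ : ℝ) (φ : ℝ → ℝ) : Prop :=
  MemLp φ 2 vol01 ∧ MemLp (fourierWeight μ φ) 2

variable {μ : ℝ} {f g w : ℝ → ℝ}

theorem hNorm_eq (μ : ℝ) (f : ℝ → ℝ) : hNorm μ f = √(hNormSq μ f) := rfl

theorem hNormSq_nonneg (μ : ℝ) (f : ℝ → ℝ) : 0 ≤ hNormSq μ f :=
  add_nonneg (integral_nonneg fun _ ↦ sq_nonneg _) (integral_nonneg fun _ ↦ sq_nonneg _)

theorem fourierWeight_eq (μ : ℝ) (f : ℝ → ℝ) (ξ : ℝ) :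
    fourierWeight μ f ξ = |2 * π * ξ| ^ μ * ‖realFourier (zeroExt f) ξ‖ := rfl

theorem fourierWeight_nonneg (μ : ℝ) (f : ℝ → ℝ) (ξ : ℝ) : 0 ≤ fourierWeight μ f ξ := by
  rw [fourierWeight_eq]
  positivity

theorem IsTest.hNormSq_eq (hw : IsTest w) (μ : ℝ) : hNormSq μ w = testNormSq μ w := by
  rw [hNormSq, testNormSq, integral_vol01_eq (fun x hx ↦ by simp [hw.eq_zero hx]),
    fourierSeminormSq]
  simp only [fourierWeight_eq, hw.zeroExt_eq, mul_pow]

theorem integrable_zeroExt (hf : MemLp f 2 vol01) : Integrable (zeroExt f) :=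
  (integrable_indicator_iff measurableSet_Ioo).2 (hf.integrable one_le_two)

theorem measurable_fourierWeight (μ : ℝ) (hf : MemLp f 2 vol01) :
    Measurable (fourierWeight μ f) := by
  have hpow : Measurable fun ξ : ℝ ↦ |2 * π * ξ| ^ μ := by fun_prop
  exact hpow.mul (continuous_realFourier (integrable_zeroExt hf)).norm.measurable

theorem IsTest.memH (hw : IsTest w) (h0 : 0 ≤ μ) (h1 : μ ≤ 1) : MemH μ w := by
  refine ⟨hw.memLp_vol01 2, (memLp_two_iff_integrable_sq
    (measurable_fourierWeight μ (hw.memLp_vol01 2)).aestronglyMeasurable).2 ?_⟩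
  simpa only [fourierWeight_eq, hw.zeroExt_eq, mul_pow] using hw.integrable_fourierSeminormSq h0 h1

theorem realFourier_sub (hf : Integrable f) (hg : Integrable g) (ξ : ℝ) :
    realFourier (f - g) ξ = realFourier f ξ - realFourier g ξ := by
  simp only [realFourier, Real.fourier_eq]
  rw [← integral_sub ((Real.fourierIntegral_convergent_iff ξ).2 hf.ofReal)
    ((Real.fourierIntegral_convergent_iff ξ).2 hg.ofReal)]
  simp only [Pi.sub_apply, Complex.ofReal_sub, smul_sub]

theorem realFourier_neg (f : ℝ → ℝ) (ξ : ℝ) : realFourier (-f) ξ = -realFourier f ξ := by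
  simp only [realFourier, Real.fourier_eq, Pi.neg_apply, Complex.ofReal_neg, smul_neg,
    integral_neg]

theorem zeroExt_sub (f g : ℝ → ℝ) : zeroExt (f - g) = zeroExt f - zeroExt g :=
  indicator_sub' _ _ _

theorem zeroExt_neg (f : ℝ → ℝ) : zeroExt (-f) = -zeroExt f :=
  indicator_neg' _ _

theorem fourierWeight_neg (μ : ℝ) (f : ℝ → ℝ) : fourierWeight μ (-f) = fourierWeight μ f := by
  ext ξ
  rw [fourierWeight_eq, fourierWeight_eq, zeroExt_neg, realFourier_neg, norm_neg]

theorem fourierWeight_sub_le (μ : ℝ) (hf : MemLp f 2 vol01) (hg : MemLp g 2 vol01) (ξ : ℝ) :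
    fourierWeight μ (f - g) ξ ≤ fourierWeight μ f ξ + fourierWeight μ g ξ := by
  rw [fourierWeight_eq, fourierWeight_eq, fourierWeight_eq, zeroExt_sub,
    realFourier_sub (integrable_zeroExt hf) (integrable_zeroExt hg), ← mul_add]
  gcongr
  exact norm_sub_le _ _

theorem MemH.neg (hf : MemH μ f) : MemH μ (-f) :=
  ⟨hf.1.neg, by rw [fourierWeight_neg]; exact hf.2⟩

theorem hNormSq_neg (μ : ℝ) (f : ℝ → ℝ) : hNormSq μ (-f) = hNormSq μ f := by
  simp only [hNormSq, fourierWeight_neg, Pi.neg_apply, neg_sq]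

theorem MemH.sub (hf : MemH μ f) (hg : MemH μ g) : MemH μ (f - g) := by
  refine ⟨hf.1.sub hg.1, (hf.2.add hg.2).mono
    (measurable_fourierWeight μ (hf.1.sub hg.1)).aestronglyMeasurable
    (Eventually.of_forall fun ξ ↦ ?_)⟩
  rw [Real.norm_of_nonneg (fourierWeight_nonneg _ _ _)]
  exact (fourierWeight_sub_le μ hf.1 hg.1 ξ).trans (le_abs_self _)

theorem hNormSq_sub_le (hf : MemH μ f) (hg : MemH μ g) :
    hNormSq μ (f - g) ≤ 2 * hNormSq μ f + 2 * hNormSq μ g := by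
  have hL2 : ∫ x, (f - g) x ^ 2 ∂vol01 ≤
      2 * (∫ x, f x ^ 2 ∂vol01) + 2 * ∫ x, g x ^ 2 ∂vol01 :=
    integral_sub_sq_le hf.1 hg.1
  have hweight : ∫ ξ, fourierWeight μ (f - g) ξ ^ 2 ≤
      2 * (∫ ξ, fourierWeight μ f ξ ^ 2) + 2 * ∫ ξ, fourierWeight μ g ξ ^ 2 := by
    rw [← integral_const_mul, ← integral_const_mul, ← integral_add
      (hf.2.integrable_sq.const_mul 2) (hg.2.integrable_sq.const_mul 2)]
    refine integral_mono (hf.sub hg).2.integrable_sq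
      ((hf.2.integrable_sq.const_mul 2).add (hg.2.integrable_sq.const_mul 2)) fun ξ ↦ ?_
    calc fourierWeight μ (f - g) ξ ^ 2
        ≤ (fourierWeight μ f ξ + fourierWeight μ g ξ) ^ 2 :=
          pow_le_pow_left₀ (fourierWeight_nonneg _ _ _) (fourierWeight_sub_le μ hf.1 hg.1 ξ) 2
      _ ≤ 2 * (fourierWeight μ f ξ ^ 2 + fourierWeight μ g ξ ^ 2) := add_sq_le
      _ = 2 * fourierWeight μ f ξ ^ 2 + 2 * fourierWeight μ g ξ ^ 2 := mul_add _ _ _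
  rw [hNormSq, hNormSq, hNormSq]
  linarith

end HSpace

/-- `w` is a sequence of test functions converging to `φ` in the `H^μ` norm. -/
structure TestApprox (μ : ℝ) (φ : ℝ → ℝ) (w : ℕ → ℝ → ℝ) : Prop where
  memH : MemH μ φ
  isTest : ∀ n, IsTest (w n)
  tendsto : Tendsto (fun n ↦ hNormSq μ (φ - w n)) atTop (𝓝 0)

theorem MemH0.exists_testApprox {μ : ℝ} {φ : ℝ → ℝ} (h : MemH0 μ φ) : ∃ w, TestApprox μ φ w := by
  choose w hw hlt using fun n : ℕ ↦ h.2.2 (1 / ((n : ℝ) + 1)) Nat.one_div_pos_of_nat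
  have hle (n : ℕ) : hNormSq μ (φ - w n) ≤ (1 / ((n : ℝ) + 1)) ^ 2 :=
    (Real.sqrt_le_left Nat.one_div_pos_of_nat.le).1 (hlt n).le
  refine ⟨w, ⟨h.1, h.2.1⟩, hw, squeeze_zero (fun n ↦ hNormSq_nonneg _ _) hle ?_⟩
  simpa using (tendsto_one_div_add_atTop_nhds_zero_nat (𝕜 := ℝ)).pow 2

namespace TestApprox

variable {μ : ℝ} {φ : ℝ → ℝ} {w : ℕ → ℝ → ℝ}

theorem memH0 (h : TestApprox μ φ w) : MemH0 μ φ := by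
  refine ⟨h.memH.1, h.memH.2, fun ε hε ↦ ?_⟩
  obtain ⟨n, hn⟩ := (h.tendsto.eventually (gt_mem_nhds (sq_pos_of_pos hε))).exists
  exact ⟨w n, h.isTest n, (Real.sqrt_lt' hε).2 hn⟩

theorem memH_sub (h : TestApprox μ φ w) (h0 : 0 ≤ μ) (h1 : μ ≤ 1) (n : ℕ) :
    MemH μ (φ - w n) :=
  h.memH.sub ((h.isTest n).memH h0 h1)

theorem testNormSq_sub_le (h : TestApprox μ φ w) (h0 : 0 ≤ μ) (h1 : μ ≤ 1) (n m : ℕ) :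
    testNormSq μ (w n - w m) ≤ 2 * hNormSq μ (φ - w n) + 2 * hNormSq μ (φ - w m) := by
  have hle := hNormSq_sub_le (h.memH_sub h0 h1 m) (h.memH_sub h0 h1 n)
  rwa [sub_sub_sub_cancel_left, ((h.isTest n).sub (h.isTest m)).hNormSq_eq, add_comm] at hle

theorem testNormSq_le (h : TestApprox μ φ w) (h0 : 0 ≤ μ) (h1 : μ ≤ 1) (n : ℕ) :
    testNormSq μ (w n) ≤ 2 * hNormSq μ φ + 2 * hNormSq μ (φ - w n) := by
  have hle := hNormSq_sub_le h.memH (h.memH_sub h0 h1 n)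
  rwa [sub_sub_cancel, (h.isTest n).hNormSq_eq] at hle

theorem hNormSq_le (h : TestApprox μ φ w) (h0 : 0 ≤ μ) (h1 : μ ≤ 1) (n : ℕ) :
    hNormSq μ φ ≤ 2 * testNormSq μ (w n) + 2 * hNormSq μ (φ - w n) := by
  have hle := hNormSq_sub_le (h.memH_sub h0 h1 n) ((h.isTest n).memH h0 h1).neg
  rwa [sub_neg_eq_add, sub_add_cancel, hNormSq_neg, (h.isTest n).hNormSq_eq, add_comm] at hle

theorem tendsto_integral_sq (h : TestApprox μ φ w) :
    Tendsto (fun n ↦ ∫ x, (φ x - w n x) ^ 2 ∂vol01) atTop (𝓝 0) :=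
  squeeze_zero (fun _ ↦ integral_nonneg fun _ ↦ sq_nonneg _)
    (fun _ ↦ le_add_of_nonneg_right (integral_nonneg fun _ ↦ sq_nonneg _)) h.tendsto

theorem ae_sub_sq_le (h : TestApprox μ φ w) (h0 : 0 ≤ μ) (h1 : μ ≤ 1) {C : ℝ} (hC0 : 0 ≤ C)
    (hC : ∀ w, IsTest w → ∀ x, w x ^ 2 ≤ C * testNormSq μ w) :
    ∀ᵐ x ∂vol01, ∀ n, (φ x - w n x) ^ 2 ≤ C * (2 * hNormSq μ (φ - w n)) := by
  obtain ⟨ns, hns, hae⟩ := exists_subseq_tendsto_ae (fun n ↦ (h.isTest n).memLp_vol01 2)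
    h.memH.1 h.tendsto_integral_sq
  filter_upwards [hae] with x hx n
  have hl : Tendsto (fun i ↦ (w (ns i) x - w n x) ^ 2) atTop (𝓝 ((φ x - w n x) ^ 2)) :=
    (hx.sub_const _).pow 2
  have hr : Tendsto (fun i ↦ C * (2 * hNormSq μ (φ - w (ns i)) + 2 * hNormSq μ (φ - w n))) atTop
      (𝓝 (C * (2 * 0 + 2 * hNormSq μ (φ - w n)))) :=
    (((h.tendsto.comp hns.tendsto_atTop).const_mul 2).add_const _).const_mul C
  rw [mul_zero, zero_add] at hr
  refine le_of_tendsto_of_tendsto' hl hr fun i ↦ ?_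
  exact (hC _ ((h.isTest _).sub (h.isTest n)) x).trans
    (mul_le_mul_of_nonneg_left (h.testNormSq_sub_le h0 h1 _ _) hC0)

theorem ae_tendsto (h : TestApprox μ φ w) (h0 : 1 / 2 < μ) (h1 : μ ≤ 1) :
    ∀ᵐ x ∂vol01, Tendsto (fun n ↦ w n x) atTop (𝓝 (φ x)) := by
  obtain ⟨C, hC0, hC⟩ := exists_sobolev h0 h1
  filter_upwards [h.ae_sub_sq_le (by linarith) h1 hC0 hC] with x hx
  have hbound : Tendsto (fun n ↦ C * (2 * hNormSq μ (φ - w n))) atTop (𝓝 0) := by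
    simpa using (h.tendsto.const_mul 2).const_mul C
  have habs := (squeeze_zero (fun n ↦ sq_nonneg _) hx hbound).sqrt
  simp only [Real.sqrt_sq_eq_abs, Real.sqrt_zero] at habs
  rw [tendsto_iff_norm_sub_tendsto_zero]
  simpa only [Real.norm_eq_abs, abs_sub_comm] using habs

theorem exists_abs_le (h : TestApprox μ φ w) (h0 : 1 / 2 < μ) (h1 : μ ≤ 1) :
    ∃ M, ∀ n x, |w n x| ≤ M := by
  obtain ⟨C, hC0, hC⟩ := exists_sobolev h0 h1
  obtain ⟨B, hB⟩ := h.tendsto.bddAbove_range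
  refine ⟨√(C * (2 * hNormSq μ φ + 2 * B)), fun n x ↦ Real.abs_le_sqrt ?_⟩
  refine (hC _ (h.isTest n) x).trans (mul_le_mul_of_nonneg_left ?_ hC0)
  have hn : hNormSq μ (φ - w n) ≤ B := hB ⟨n, rfl⟩
  linarith [h.testNormSq_le (by linarith) h1 n]

theorem tendsto_integral_mul (h : TestApprox μ φ w) (h0 : 1 / 2 < μ) (h1 : μ ≤ 1) {k : ℝ → ℝ}
    (hk : Integrable k vol01) :
    Tendsto (fun n ↦ ∫ s, k s * w n s ∂vol01) atTop (𝓝 (∫ s, k s * φ s ∂vol01)) := by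
  obtain ⟨M, hM⟩ := h.exists_abs_le h0 h1
  refine tendsto_integral_of_dominated_convergence (fun s ↦ |k s| * M) (fun n ↦ ?_)
    (hk.abs.mul_const M) (fun n ↦ Eventually.of_forall fun s ↦ ?_) ?_
  · exact hk.aestronglyMeasurable.mul (h.isTest n).continuous.aestronglyMeasurable
  · rw [Real.norm_eq_abs, abs_mul]
    exact mul_le_mul_of_nonneg_left (hM n s) (abs_nonneg _)
  · filter_upwards [h.ae_tendsto h0 h1] with s hs using hs.const_mul _

end TestApprox

theorem integrable_comp_sub_vol01 {k : ℝ → ℝ} (hk : LocallyIntegrable k) (x : ℝ) :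
    Integrable (fun s ↦ k (x - s)) vol01 := by
  have hint : IntervalIntegrable k volume (x - 0) (x - 1) :=
    (hk.integrableOn_isCompact isCompact_uIcc).intervalIntegrable
  have hcomp := hint.comp_sub_left x
  simp only [sub_sub_cancel] at hcomp
  exact (intervalIntegrable_iff_integrableOn_Ioo_of_le zero_le_one).1 hcomp

theorem TestApprox.tendsto_twoSidedInt {μ β : ℝ} {φ : ℝ → ℝ} {w : ℕ → ℝ → ℝ}
    (h : TestApprox μ φ w) (h0 : 1 / 2 < μ) (h1 : μ ≤ 1) (hβ : 0 < β) (θ : ℝ) {x : ℝ}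
    (hx : x ∈ Icc (0 : ℝ) 1) :
    Tendsto (fun n ↦ twoSidedInt β θ (w n) x) atTop (𝓝 (twoSidedInt β θ φ x)) := by
  simp only [twoSidedInt, leftInt_eq_integral_leftKernel hx.2,
    rightInt_eq_integral_rightKernel hx.1]
  exact ((h.tendsto_integral_mul h0 h1
    (integrable_comp_sub_vol01 (locallyIntegrable_leftKernel hβ) x)).const_mul θ).add
    ((h.tendsto_integral_mul h0 h1
    (integrable_comp_sub_vol01 (locallyIntegrable_rightKernel hβ) x)).const_mul (1 - θ))

section Completeness

variable {μ : ℝ} {f w : ℝ → ℝ}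

theorem norm_realFourier_zeroExt_sub_le (hf : MemLp f 2 vol01) (hw : IsTest w) (ξ : ℝ) :
    ‖realFourier w ξ - realFourier (zeroExt f) ξ‖ ≤ √(∫ x, (f x - w x) ^ 2 ∂vol01) := by
  have hL1 : ∫ x, |(zeroExt f - w) x| = ∫ x, |f x - w x| ∂vol01 := by
    rw [← integral_vol01_eq (fun x hx ↦ by
      simp [zeroExt, indicator_of_notMem hx, hw.eq_zero hx])]
    refine setIntegral_congr_fun measurableSet_Ioo fun x hx ↦ ?_
    simp [zeroExt, indicator_of_mem hx]
  rw [norm_sub_rev, ← realFourier_sub (integrable_zeroExt hf) hw.integrable]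
  refine (norm_realFourier_le _ ξ).trans ?_
  rw [hL1]
  exact Real.le_sqrt_of_sq_le (sq_integral_abs_le (hf.sub (hw.memLp_vol01 2)))

theorem tendsto_fourierWeight_sub {w : ℕ → ℝ → ℝ} (hw : ∀ n, IsTest (w n))
    (hf : MemLp f 2 vol01) (hL2 : Tendsto (fun n ↦ ∫ x, (f x - w n x) ^ 2 ∂vol01) atTop (𝓝 0))
    (n : ℕ) (ξ : ℝ) :
    Tendsto (fun m ↦ fourierWeight μ (w m - w n) ξ) atTop (𝓝 (fourierWeight μ (f - w n) ξ)) := by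
  have hlim : Tendsto (fun m ↦ realFourier (w m) ξ) atTop (𝓝 (realFourier (zeroExt f) ξ)) := by
    rw [tendsto_iff_norm_sub_tendsto_zero]
    refine squeeze_zero (fun m ↦ norm_nonneg _)
      (fun m ↦ norm_realFourier_zeroExt_sub_le hf (hw m) ξ) ?_
    simpa using hL2.sqrt
  simp only [fourierWeight_eq, zeroExt_sub, (hw _).zeroExt_eq,
    realFourier_sub (hw _).integrable (hw n).integrable,
    realFourier_sub (integrable_zeroExt hf) (hw n).integrable]
  exact ((hlim.sub_const _).norm).const_mul _

theorem memH_and_integral_le_of_testNormSq_sub_le {w : ℕ → ℝ → ℝ} (h0 : 0 ≤ μ) (h1 : μ ≤ 1)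
    (hw : ∀ n, IsTest (w n)) (hf : MemLp f 2 vol01)
    (hL2 : Tendsto (fun n ↦ ∫ x, (f x - w n x) ^ 2 ∂vol01) atTop (𝓝 0)) {n : ℕ} {ε : ℝ}
    (hle : ∀ᶠ m in atTop, testNormSq μ (w m - w n) ≤ ε) :
    MemH μ (f - w n) ∧ ∫ ξ, fourierWeight μ (f - w n) ξ ^ 2 ≤ ε := by
  have hsub : MemLp (f - w n) 2 vol01 := hf.sub ((hw n).memLp_vol01 2)
  have hweight (m : ℕ) : ∫ ξ, fourierWeight μ (w m - w n) ξ ^ 2 ≤ testNormSq μ (w m - w n) := by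
    rw [← ((hw m).sub (hw n)).hNormSq_eq]
    exact le_add_of_nonneg_left (integral_nonneg fun x ↦ sq_nonneg _)
  obtain ⟨hint, hbound⟩ := integrable_and_integral_le_of_tendsto
    (fun m ↦ (((hw m).sub (hw n)).memH h0 h1).2.integrable_sq) (fun _ _ ↦ sq_nonneg _)
    (fun ξ ↦ (tendsto_fourierWeight_sub hw hf hL2 n ξ).pow 2)
    (hle.mono fun m hm ↦ (hweight m).trans hm)
  exact ⟨⟨hsub, (memLp_two_iff_integrable_sq
    (measurable_fourierWeight μ hsub).aestronglyMeasurable).2 hint⟩, hbound⟩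

theorem exists_testApprox_of_cauchy {w : ℕ → ℝ → ℝ} (h0 : 0 ≤ μ) (h1 : μ ≤ 1)
    (hw : ∀ n, IsTest (w n))
    (hc : ∀ ε > 0, ∃ N, ∀ n ≥ N, ∀ m ≥ N, testNormSq μ (w n - w m) ≤ ε) :
    ∃ φ, TestApprox μ φ w := by
  obtain ⟨f, hf, hL2⟩ := exists_tendsto_of_cauchy (fun n ↦ (hw n).memLp_vol01 2) fun ε hε ↦ by
    obtain ⟨N, hN⟩ := hc ε hε
    refine ⟨N, fun n hn m hm ↦ le_trans ?_ (hN n hn m hm)⟩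
    rw [← ((hw n).sub (hw m)).hNormSq_eq]
    exact le_add_of_nonneg_right (integral_nonneg fun x ↦ sq_nonneg _)
  have hbound : ∀ ε > 0, ∃ N, ∀ n ≥ N,
      MemH μ (f - w n) ∧ ∫ ξ, fourierWeight μ (f - w n) ξ ^ 2 ≤ ε := fun ε hε ↦ by
    obtain ⟨N, hN⟩ := hc ε hε
    exact ⟨N, fun n hn ↦ memH_and_integral_le_of_testNormSq_sub_le h0 h1 hw hf hL2
      ((eventually_ge_atTop N).mono fun m hm ↦ hN m hm n hn)⟩
  have hmem : MemH μ f := by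
    obtain ⟨N, hN⟩ := hbound 1 one_pos
    have := (hN N le_rfl).1.sub ((hw N).memH h0 h1).neg
    rwa [sub_neg_eq_add, sub_add_cancel] at this
  have hweight : Tendsto (fun n ↦ ∫ ξ, fourierWeight μ (f - w n) ξ ^ 2) atTop (𝓝 0) := by
    rw [Metric.tendsto_atTop]
    intro ε hε
    obtain ⟨N, hN⟩ := hbound (ε / 2) (half_pos hε)
    refine ⟨N, fun n hn ↦ ?_⟩
    rw [Real.dist_eq, sub_zero, abs_of_nonneg (integral_nonneg fun ξ ↦ sq_nonneg _)]
    exact (hN n hn).2.trans_lt (half_lt_self hε)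
  exact ⟨f, hmem, hw, by simpa only [hNormSq, Pi.sub_apply, add_zero] using hL2.add hweight⟩

end Completeness

/-! ### Primitives and weak derivatives -/

/-- The primitive of `d` vanishing at `0`. -/
noncomputable def primitive (d : ℝ → ℝ) (x : ℝ) : ℝ := ∫ t in 0..x, d t

section Primitive

variable {c x : ℝ} {d e w : ℝ → ℝ}

theorem intervalIntegral_eq_vol01 (f : ℝ → ℝ) : ∫ x in 0..1, f x = ∫ x, f x ∂vol01 := by
  rw [intervalIntegral.integral_of_le zero_le_one, integral_Ioc_eq_integral_Ioo]

theorem intervalIntegrable_of_memLp (hd : MemLp d 2 vol01) (hx : x ∈ Icc (0 : ℝ) 1) :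
    IntervalIntegrable d volume 0 x := by
  have hint : IntegrableOn d (Ioo 0 1) volume := hd.integrable one_le_two
  exact (intervalIntegrable_iff_integrableOn_Ioo_of_le hx.1).2
    (hint.mono_set (Ioo_subset_Ioo_right hx.2))

theorem primitive_zero (d : ℝ → ℝ) : primitive d 0 = 0 := intervalIntegral.integral_same

theorem primitive_one (d : ℝ → ℝ) : primitive d 1 = ∫ x, d x ∂vol01 :=
  intervalIntegral_eq_vol01 d

theorem primitive_sub (hd : MemLp d 2 vol01) (he : MemLp e 2 vol01) (hx : x ∈ Icc (0 : ℝ) 1) :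
    primitive (d - e) x = primitive d x - primitive e x :=
  intervalIntegral.integral_sub (intervalIntegrable_of_memLp hd hx)
    (intervalIntegrable_of_memLp he hx)

theorem primitive_const (c x : ℝ) : primitive (fun _ ↦ c) x = c * x := by
  rw [primitive, intervalIntegral.integral_const, sub_zero, smul_eq_mul, mul_comm]

theorem continuousOn_const_add_primitive (c : ℝ) (hd : MemLp d 2 vol01) :
    ContinuousOn (fun x ↦ c + primitive d x) (Icc 0 1) := by
  have hcont := intervalIntegral.continuousOn_primitive_interval (f := d) (μ := volume)
    (a := 0) (b := 1)
    ((intervalIntegrable_iff' (by simp)).1 (intervalIntegrable_of_memLp hd (x := 1) (by simp)))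
  rw [uIcc_of_le zero_le_one] at hcont
  exact continuousOn_const.add hcont

theorem IsTest.primitive_deriv (hw : IsTest w) (x : ℝ) : primitive (deriv w) x = w x := by
  rw [primitive, intervalIntegral.integral_deriv_eq_sub (fun y _ ↦ hw.differentiable y)
    (hw.deriv.continuous.intervalIntegrable _ _), hw.eq_zero (x := 0) (by simp), sub_zero]

theorem sq_primitive_le (hd : MemLp d 2 vol01) (hx : x ∈ Icc (0 : ℝ) 1) :
    primitive d x ^ 2 ≤ ∫ t, d t ^ 2 ∂vol01 := by
  refine le_trans ?_ (sq_integral_abs_le hd)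
  rw [← sq_abs]
  refine pow_le_pow_left₀ (abs_nonneg _) ?_ 2
  refine (intervalIntegral.norm_integral_le_integral_norm (f := d) hx.1).trans ?_
  rw [intervalIntegral.integral_of_le hx.1, integral_Ioc_eq_integral_Ioo]
  exact setIntegral_mono_set (hd.integrable one_le_two).norm
    (Eventually.of_forall fun t ↦ norm_nonneg _) (Ioo_subset_Ioo_right hx.2).eventuallyLE

theorem memLp_const_add_primitive (c : ℝ) (hd : MemLp d 2 vol01) :
    MemLp (fun x ↦ c + primitive d x) 2 vol01 :=
  memLp_vol01_of_continuousOn (continuousOn_const_add_primitive c hd)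

theorem memLp_primitive (hd : MemLp d 2 vol01) : MemLp (primitive d) 2 vol01 := by
  simpa only [zero_add] using memLp_const_add_primitive 0 hd

theorem integral_primitive_sq_le (hd : MemLp d 2 vol01) :
    ∫ x, primitive d x ^ 2 ∂vol01 ≤ ∫ t, d t ^ 2 ∂vol01 := by
  have hle := setIntegral_mono_on (memLp_primitive hd).integrable_sq (integrable_const _)
    measurableSet_Ioo fun x hx ↦ sq_primitive_le hd (Ioo_subset_Icc_self hx)
  simpa using hle

end Primitive

section WeakDeriv

variable {c : ℝ} {g h d e w η : ℝ → ℝ}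

theorem HasWeakDeriv.congr (hg : HasWeakDeriv g d) (hgh : g =ᵐ[vol01] h) : HasWeakDeriv h d :=
  ⟨hg.1, fun η hη ↦ (integral_congr_ae (hgh.mono fun x hx ↦ by simp only [hx])).symm.trans
    (hg.2 η hη)⟩

theorem IsTest.integral_deriv_eq_zero (hη : IsTest η) : ∫ x, deriv η x ∂vol01 = 0 := by
  rw [← primitive_one, hη.primitive_deriv, hη.eq_zero (by simp)]

theorem hasWeakDeriv_primitive (hd : MemLp d 2 vol01) : HasWeakDeriv (primitive d) d := by
  refine ⟨hd, fun η hη ↦ ?_⟩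
  have hint := intervalIntegrable_of_memLp hd (x := 1) (by simp)
  have hparts := (hint.absolutelyContinuousOnInterval_intervalIntegral
    (c := 0) (by simp)).integral_mul_deriv_eq_deriv_mul
    (g := η) (ContDiffOn.absolutelyContinuousOnInterval (hη.1.of_le (by simp)).contDiffOn)
  rw [hη.eq_zero (x := 0) (by simp), hη.eq_zero (x := 1) (by simp), mul_zero, mul_zero, sub_zero,
    zero_sub, intervalIntegral_eq_vol01, intervalIntegral_eq_vol01] at hparts
  refine hparts.trans (congrArg _ (integral_congr_ae ?_))
  filter_upwards [ae_restrict_of_ae hint.ae_hasDerivAt_integral, ae_restrict_mem measurableSet_Ioo]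
    with x hx hmem
  rw [uIcc_of_le zero_le_one] at hx
  rw [(hx (Ioo_subset_Icc_self hmem) 0 (by simp)).deriv]

theorem HasWeakDeriv.sub (hg : HasWeakDeriv g d) (hh : HasWeakDeriv h e) (hgm : MemLp g 2 vol01)
    (hhm : MemLp h 2 vol01) : HasWeakDeriv (g - h) (d - e) := by
  refine ⟨hg.1.sub hh.1, fun η hη ↦ ?_⟩
  simp only [Pi.sub_apply, sub_mul]
  rw [integral_sub (hη.deriv.integrable_mul (hgm.integrable one_le_two))
    (hη.deriv.integrable_mul (hhm.integrable one_le_two)),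
    integral_sub (hη.integrable_mul (hg.1.integrable one_le_two))
    (hη.integrable_mul (hh.1.integrable one_le_two)), hg.2 η hη, hh.2 η hη]
  ring

theorem IsTest.hasWeakDeriv (hw : IsTest w) : HasWeakDeriv w (deriv w) :=
  (hasWeakDeriv_primitive (hw.deriv.memLp_vol01 2)).congr
    (Eventually.of_forall fun x ↦ hw.primitive_deriv x)

theorem HasWeakDeriv.ae_eq (hd : HasWeakDeriv g d) (he : HasWeakDeriv g e) : d =ᵐ[vol01] e := by
  have hsub := ae_eq_zero_of_integral_mul_eq_zero
    (f := d - e) ((hd.1.sub he.1).integrable one_le_two) fun η hη ↦ by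
      simp only [Pi.sub_apply, sub_mul]
      rw [integral_sub (hη.integrable_mul (hd.1.integrable one_le_two))
        (hη.integrable_mul (he.1.integrable one_le_two)), sub_eq_zero]
      exact neg_injective ((hd.2 η hη).symm.trans (he.2 η hη))
  exact hsub.mono fun x hx ↦ sub_eq_zero.1 hx

theorem HasWeakDeriv.exists_ae_eq (hg : HasWeakDeriv g d) (hgm : MemLp g 2 vol01) :
    ∃ c : ℝ, g =ᵐ[vol01] fun x ↦ c + primitive d x := by
  have hm := memLp_primitive hg.1
  obtain ⟨c, hc⟩ := ae_eq_const_of_integral_mul_deriv_eq_zero (f := g - primitive d)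
    ((hgm.sub hm).integrable one_le_two) fun η hη ↦ by
      rw [(hg.sub (hasWeakDeriv_primitive hg.1) hgm hm).2 η hη]
      simp
  exact ⟨c, hc.mono fun x hx ↦ sub_eq_iff_eq_add.1 hx⟩

theorem hasWeakDeriv_of_ae_eq (hd : MemLp d 2 vol01)
    (hg : g =ᵐ[vol01] fun x ↦ c + primitive d x) : HasWeakDeriv g d := by
  refine HasWeakDeriv.congr ⟨hd, fun η hη ↦ ?_⟩ hg.symm
  simp only [add_mul]
  rw [integral_add (hη.deriv.integrable_mul (integrable_const c))
    (hη.deriv.integrable_mul ((memLp_primitive hd).integrable one_le_two)),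
    integral_const_mul, hη.integral_deriv_eq_zero, mul_zero, zero_add,
    (hasWeakDeriv_primitive hd).2 η hη]

theorem h1Norm_eq (hg : HasWeakDeriv g d) :
    h1Norm g = √((∫ x, g x ^ 2 ∂vol01) + ∫ x, d x ^ 2 ∂vol01) := by
  have hex : ∃ d, HasWeakDeriv g d := ⟨d, hg⟩
  have hweak : HasWeakDeriv g (weakDeriv g) := by
    rw [weakDeriv, dif_pos hex]
    exact hex.choose_spec
  rw [h1Norm, integral_congr_ae (f := fun x ↦ weakDeriv g x ^ 2) (g := fun x ↦ d x ^ 2)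
    ((hweak.ae_eq hg).mono fun x hx ↦ by simp only [hx])]

theorem memH1_of_ae_eq (hd : MemLp d 2 vol01) (hg : g =ᵐ[vol01] fun x ↦ c + primitive d x) :
    MemH1 g :=
  ⟨(memLp_const_add_primitive c hd).ae_eq hg.symm, d, hasWeakDeriv_of_ae_eq hd hg⟩

theorem eqOn_of_ae_eq_vol01 {F G : ℝ → ℝ} (hF : ContinuousOn F (Icc 0 1))
    (hG : ContinuousOn G (Icc 0 1)) (hFG : F =ᵐ[vol01] G) : EqOn F G (Icc 0 1) := by
  refine Measure.eqOn_Icc_of_ae_eq volume zero_ne_one ?_ hF hG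
  rwa [← Measure.restrict_congr_set Ioo_ae_eq_Icc]

theorem eqOn_contRep {G : ℝ → ℝ} (hG : ContinuousOn G (Icc 0 1)) (hGg : G =ᵐ[vol01] g) :
    EqOn (contRep g) G (Icc 0 1) := by
  have hex : ∃ G : ℝ → ℝ, ContinuousOn G (Icc 0 1) ∧ G =ᵐ[vol01] g := ⟨G, hG, hGg⟩
  rw [contRep, dif_pos hex]
  exact eqOn_of_ae_eq_vol01 hex.choose_spec.1 hG (hex.choose_spec.2.trans hGg.symm)

theorem contRep_zero (hd : MemLp d 2 vol01) (hg : g =ᵐ[vol01] fun x ↦ c + primitive d x) :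
    contRep g 0 = c := by
  simp [eqOn_contRep (continuousOn_const_add_primitive c hd) hg.symm (x := 0) (by simp),
    primitive_zero]

theorem contRep_one (hd : MemLp d 2 vol01) (hg : g =ᵐ[vol01] fun x ↦ c + primitive d x) :
    contRep g 1 = c + ∫ x, d x ∂vol01 := by
  rw [eqOn_contRep (continuousOn_const_add_primitive c hd) hg.symm (x := 1) (by simp),
    ← primitive_one]

theorem memH10_of_ae_eq (hd : MemLp d 2 vol01) (h0 : ∫ x, d x ∂vol01 = 0)
    (hg : g =ᵐ[vol01] primitive d) : MemH10 g := by
  have hg' : g =ᵐ[vol01] fun x ↦ 0 + primitive d x := by simpa only [zero_add] using hg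
  have hmem := memH1_of_ae_eq hd hg'
  refine ⟨hmem, fun ε hε ↦ ?_⟩
  obtain ⟨w, hw, hlt⟩ := exists_test_deriv_near hd h0 (ε := ε ^ 2 / 2) (by positivity)
  refine ⟨w, hw, ?_⟩
  have hwd := hw.deriv.memLp_vol01 2
  have hweak : HasWeakDeriv (fun x ↦ g x - w x) (d - deriv w) :=
    (hasWeakDeriv_of_ae_eq hd hg').sub hw.hasWeakDeriv hmem.1 (hw.memLp_vol01 2)
  rw [h1Norm_eq hweak, Real.sqrt_lt' hε]
  have hsub : ∫ x, (g x - w x) ^ 2 ∂vol01 = ∫ x, primitive (d - deriv w) x ^ 2 ∂vol01 := by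
    refine integral_congr_ae ?_
    filter_upwards [hg, ae_restrict_mem measurableSet_Ioo] with x hx hmem
    rw [primitive_sub hd hwd (Ioo_subset_Icc_self hmem), hw.primitive_deriv, hx]
  have hle := integral_primitive_sq_le (hd.sub hwd)
  simp only [Pi.sub_apply] at hle ⊢
  rw [hsub]
  linarith

theorem HasWeakDeriv.sq_const_le (hg : HasWeakDeriv g d) (hgm : MemLp g 2 vol01)
    (hc : g =ᵐ[vol01] fun x ↦ c + primitive d x) (hw : IsTest w) :
    c ^ 2 ≤ 2 * h1Norm (fun x ↦ g x - w x) ^ 2 := by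
  have hwd := hw.deriv.memLp_vol01 2
  have hwm := hw.memLp_vol01 2
  have hweak : HasWeakDeriv (fun x ↦ g x - w x) (d - deriv w) := hg.sub hw.hasWeakDeriv hgm hwm
  have hem := hg.1.sub hwd
  have hconst : ∫ x, ((g - w) x - primitive (d - deriv w) x) ^ 2 ∂vol01 = c ^ 2 := by
    have hae : (fun x ↦ ((g - w) x - primitive (d - deriv w) x) ^ 2) =ᵐ[vol01] fun _ ↦ c ^ 2 := by
      filter_upwards [hc, ae_restrict_mem measurableSet_Ioo] with x hx hmem
      rw [primitive_sub hg.1 hwd (Ioo_subset_Icc_self hmem), hw.primitive_deriv, Pi.sub_apply, hx]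
      ring
    rw [integral_congr_ae hae]
    simp
  have hle := integral_sub_sq_le (hgm.sub hwm) (memLp_primitive hem)
  have hprim := integral_primitive_sq_le hem
  rw [hconst] at hle
  rw [h1Norm_eq hweak, Real.sq_sqrt (add_nonneg (integral_nonneg fun _ ↦ sq_nonneg _)
    (integral_nonneg fun _ ↦ sq_nonneg _))]
  simp only [Pi.sub_apply] at hle hprim ⊢
  linarith

theorem HasWeakDeriv.sq_integral_le (hg : HasWeakDeriv g d) (hgm : MemLp g 2 vol01)
    (hw : IsTest w) : (∫ x, d x ∂vol01) ^ 2 ≤ h1Norm (fun x ↦ g x - w x) ^ 2 := by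
  have hwd := hw.deriv.memLp_vol01 2
  have hweak : HasWeakDeriv (fun x ↦ g x - w x) (d - deriv w) :=
    hg.sub hw.hasWeakDeriv hgm (hw.memLp_vol01 2)
  have hle := sq_primitive_le (hg.1.sub hwd) (x := 1) (by simp)
  rw [primitive_sub hg.1 hwd (by simp), hw.primitive_deriv, hw.eq_zero (by simp), sub_zero,
    primitive_one] at hle
  rw [h1Norm_eq hweak, Real.sq_sqrt (add_nonneg (integral_nonneg fun _ ↦ sq_nonneg _)
    (integral_nonneg fun _ ↦ sq_nonneg _))]
  exact hle.trans (le_add_of_nonneg_left (integral_nonneg fun _ ↦ sq_nonneg _))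

theorem MemH10.exists_ae_eq (hg : MemH10 g) :
    ∃ d, MemLp d 2 vol01 ∧ ∫ x, d x ∂vol01 = 0 ∧ g =ᵐ[vol01] primitive d := by
  obtain ⟨⟨hgm, d, hd⟩, happ⟩ := hg
  obtain ⟨c, hc⟩ := hd.exists_ae_eq hgm
  have hzero {a K : ℝ} (h : ∀ w, IsTest w → a ^ 2 ≤ K * h1Norm (fun x ↦ g x - w x) ^ 2) :
      a = 0 := by
    refine pow_eq_zero_iff two_ne_zero |>.1 (le_antisymm ?_ (sq_nonneg a))
    have hlim : Tendsto (fun ε : ℝ ↦ |K| * ε ^ 2) (𝓝[>] 0) (𝓝 (|K| * 0 ^ 2)) :=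
      ((continuous_const.mul (continuous_pow 2)).tendsto 0).mono_left nhdsWithin_le_nhds
    rw [zero_pow two_ne_zero, mul_zero] at hlim
    refine ge_of_tendsto hlim (eventually_mem_nhdsWithin.mono fun ε hε ↦ ?_)
    obtain ⟨w, hw, hlt⟩ := happ ε hε
    exact (h w hw).trans (mul_le_mul (le_abs_self K)
      (pow_le_pow_left₀ (Real.sqrt_nonneg _) hlt.le 2) (sq_nonneg _) (abs_nonneg K))
  refine ⟨d, hd.1, hzero (K := 1) fun w hw ↦ ?_, ?_⟩
  · simpa only [one_mul] using hd.sq_integral_le hgm hw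
  · simpa only [hzero fun _ hw ↦ hd.sq_const_le hgm hc hw, zero_add] using hc

end WeakDeriv

/-! ### The integral equation -/

variable {β θ : ℝ}

theorem IsTest.fracDeriv_sub {u w : ℝ → ℝ} (hu : IsTest u) (hw : IsTest w) (hβ : 0 < β) (θ : ℝ) :
    fracDeriv β θ (u - w) = fracDeriv β θ u - fracDeriv β θ w := by
  have hsub {k : ℝ → ℝ} (hk : LocallyIntegrable k) :
      k ⋆ deriv (u - w) = (k ⋆ deriv u) - (k ⋆ deriv w) :=
    map_sub (convDeriv k hk) (⟨u, hu⟩ : testSpace) ⟨w, hw⟩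
  ext x
  simp only [fracDeriv, hsub (locallyIntegrable_leftKernel hβ),
    hsub (locallyIntegrable_rightKernel hβ), Pi.sub_apply]
  ring

/-- `w` is a sequence of test functions converging to `φ` in the `H^{1-β}` norm, whose fractional
derivatives converge to `a` in `L²(0,1)`; thus `a` is the fractional derivative of `φ`. -/
structure FracApprox (β θ : ℝ) (φ a : ℝ → ℝ) (w : ℕ → ℝ → ℝ) : Prop where
  approx : TestApprox (1 - β) φ w
  memLp : MemLp a 2 vol01
  tendsto : Tendsto (fun n ↦ ∫ x, (a x - fracDeriv β θ (w n) x) ^ 2 ∂vol01) atTop (𝓝 0)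

theorem TestApprox.exists_fracApprox {φ : ℝ → ℝ} {w : ℕ → ℝ → ℝ} (h : TestApprox (1 - β) φ w)
    (hβ : 0 < β) (hβ' : β ≤ 1 / 2) (hθ : θ ∈ Icc (0 : ℝ) 1) : ∃ a, FracApprox β θ φ a w := by
  obtain ⟨a, ha, hlim⟩ := exists_tendsto_of_cauchy
    (fun n ↦ (h.isTest n).memLp_fracDeriv hβ θ) fun ε hε ↦ by
      obtain ⟨N, hN⟩ := eventually_atTop.1
        (h.tendsto.eventually (gt_mem_nhds (show 0 < ε / 4 by positivity)))
      refine ⟨N, fun n hn m hm ↦ ?_⟩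
      have hle := ((h.isTest n).sub (h.isTest m)).integral_fracDeriv_sq_le hβ hβ' hθ
      have hnorm := h.testNormSq_sub_le (by linarith) (by linarith) n m
      simp only [(h.isTest n).fracDeriv_sub (h.isTest m) hβ, Pi.sub_apply] at hle
      linarith [hN n hn, hN m hm]
  exact ⟨a, h, ha, hlim⟩

theorem MemH0.exists_fracApprox {φ : ℝ → ℝ} (hφ : MemH0 (1 - β) φ) (hβ : 0 < β)
    (hβ' : β ≤ 1 / 2) (hθ : θ ∈ Icc (0 : ℝ) 1) :
    ∃ (a : ℝ → ℝ) (w : ℕ → ℝ → ℝ), FracApprox β θ φ a w := by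
  obtain ⟨w, hw⟩ := hφ.exists_testApprox
  obtain ⟨a, ha⟩ := hw.exists_fracApprox hβ hβ' hθ
  exact ⟨a, w, ha⟩

theorem exists_fracApprox_sub_const (hβ : 0 < β) (hβ' : β < 1 / 2) (hθ : θ ∈ Icc (0 : ℝ) 1)
    {d : ℝ → ℝ} (hd : MemLp d 2 vol01) :
    ∃ (c : ℝ) (φ : ℝ → ℝ) (w : ℕ → ℝ → ℝ), FracApprox β θ φ (fun x ↦ d x - c) w := by
  obtain ⟨c, hc⟩ := exists_fracDeriv_near hβ hβ' hθ hd
  obtain ⟨κ, hκ0, hκ⟩ := exists_testNormSq_le hβ hβ' hθ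
  choose w hw hlt using fun n : ℕ ↦ hc (1 / ((n : ℝ) + 1)) Nat.one_div_pos_of_nat
  have hdc : MemLp (fun x ↦ d x - c) 2 vol01 := hd.sub (memLp_const c)
  have hlim : Tendsto (fun n ↦ ∫ x, (fracDeriv β θ (w n) x - (d x - c)) ^ 2 ∂vol01) atTop (𝓝 0) :=
    squeeze_zero (fun n ↦ integral_nonneg fun _ ↦ sq_nonneg _) (fun n ↦ (hlt n).le)
      tendsto_one_div_add_atTop_nhds_zero_nat
  obtain ⟨φ, hφ⟩ := exists_testApprox_of_cauchy (μ := 1 - β) (by linarith) (by linarith) hw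
    fun ε hε ↦ by
      obtain ⟨N, hN⟩ := eventually_atTop.1
        (hlim.eventually (gt_mem_nhds (show 0 < κ * ε / 4 by positivity)))
      refine ⟨N, fun n hn m hm ↦ ?_⟩
      have hκnm := hκ _ ((hw n).sub (hw m)) 0
      have hsub := integral_sub_sq_le (((hw n).memLp_fracDeriv hβ θ).sub hdc)
        (((hw m).memLp_fracDeriv hβ θ).sub hdc)
      simp only [Pi.sub_apply, sub_sub_sub_cancel_right] at hsub
      simp only [(hw n).fracDeriv_sub (hw m) hβ, sub_zero, Pi.sub_apply] at hκnm
      exact le_of_mul_le_mul_left (by linarith [hN n hn, hN m hm]) hκ0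
  exact ⟨c, φ, w, hφ, hdc, hlim.congr fun n ↦ by simp only [sub_sq_comm]⟩

theorem twoSidedInt_zero (β θ : ℝ) (φ : ℝ → ℝ) :
    twoSidedInt β θ φ 0 = (1 - θ) * rightInt β φ 0 := by
  simp [twoSidedInt, leftInt]

theorem twoSidedInt_one (β θ : ℝ) (φ : ℝ → ℝ) :
    twoSidedInt β θ φ 1 = θ * leftInt β φ 1 := by
  simp [twoSidedInt, rightInt]

namespace FracApprox

variable {φ ψ a b g : ℝ → ℝ} {w u : ℕ → ℝ → ℝ}

theorem memLp_fracDeriv (h : FracApprox β θ φ a w) (hβ : 0 < β) (n : ℕ) :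
    MemLp (fracDeriv β θ (w n)) 2 vol01 :=
  (h.approx.isTest n).memLp_fracDeriv hβ θ

theorem sub (h : FracApprox β θ φ a w) (k : FracApprox β θ ψ b u) (hβ : 0 < β) (hβ1 : β ≤ 1) :
    FracApprox β θ (φ - ψ) (a - b) (fun n ↦ w n - u n) := by
  refine ⟨⟨h.approx.memH.sub k.approx.memH, fun n ↦ (h.approx.isTest n).sub
    (k.approx.isTest n), ?_⟩, h.memLp.sub k.memLp, ?_⟩
  · refine squeeze_zero (fun n ↦ hNormSq_nonneg _ _) (fun n ↦ ?_)
      (by simpa using (h.approx.tendsto.const_mul 2).add (k.approx.tendsto.const_mul 2))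
    rw [sub_sub_sub_comm]
    exact hNormSq_sub_le (h.approx.memH_sub (by linarith) (by linarith) n)
      (k.approx.memH_sub (by linarith) (by linarith) n)
  · refine squeeze_zero (fun n ↦ integral_nonneg fun _ ↦ sq_nonneg _) (fun n ↦ ?_)
      (by simpa using (h.tendsto.const_mul 2).add (k.tendsto.const_mul 2))
    rw [(h.approx.isTest n).fracDeriv_sub (k.approx.isTest n) hβ]
    have hle := integral_sub_sq_le (h.memLp.sub (h.memLp_fracDeriv hβ n))
      (k.memLp.sub (k.memLp_fracDeriv hβ n))
    simpa only [Pi.sub_apply, sub_sub_sub_comm] using hle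

theorem tendsto_primitive (h : FracApprox β θ φ a w) (hβ : 0 < β) {x : ℝ}
    (hx : x ∈ Icc (0 : ℝ) 1) :
    Tendsto (fun n ↦ primitive (fracDeriv β θ (w n)) x) atTop (𝓝 (primitive a x)) := by
  have hlim := (squeeze_zero (fun n ↦ sq_nonneg _)
    (fun n ↦ sq_primitive_le (h.memLp.sub (h.memLp_fracDeriv hβ n)) hx) h.tendsto).sqrt
  simp only [Real.sqrt_sq_eq_abs, Real.sqrt_zero,
    primitive_sub h.memLp (h.memLp_fracDeriv hβ _) hx] at hlim
  rw [tendsto_iff_norm_sub_tendsto_zero]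
  simpa only [Real.norm_eq_abs, abs_sub_comm] using hlim

theorem twoSidedInt_eq (h : FracApprox β θ φ a w) (hβ : 0 < β) (hβ' : β < 1 / 2) {x : ℝ}
    (hx : x ∈ Icc (0 : ℝ) 1) : twoSidedInt β θ φ x = twoSidedInt β θ φ 0 + primitive a x := by
  have hlim (y : ℝ) (hy : y ∈ Icc (0 : ℝ) 1) :
      Tendsto (fun n ↦ twoSidedInt β θ (w n) y) atTop (𝓝 (twoSidedInt β θ φ y)) :=
    h.approx.tendsto_twoSidedInt (by linarith) (by linarith) hβ θ hy
  refine tendsto_nhds_unique (hlim x hx)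
    (((hlim 0 (by simp)).add (h.tendsto_primitive hβ hx)).congr fun n ↦ ?_)
  exact ((h.approx.isTest n).twoSidedInt_eq_add_integral hβ θ hx).symm

theorem integral_sq_le (h : FracApprox β θ φ a w) (hβ : 0 < β) (hβ' : β ≤ 1 / 2)
    (hθ : θ ∈ Icc (0 : ℝ) 1) : ∫ x, a x ^ 2 ∂vol01 ≤ 4 * hNormSq (1 - β) φ := by
  have hlim : Tendsto (fun n ↦ 2 * (∫ x, (a x - fracDeriv β θ (w n) x) ^ 2 ∂vol01) +
      (4 * hNormSq (1 - β) φ + 4 * hNormSq (1 - β) (φ - w n))) atTop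
      (𝓝 (4 * hNormSq (1 - β) φ)) := by
    simpa using (h.tendsto.const_mul 2).add ((h.approx.tendsto.const_mul 4).const_add _)
  refine ge_of_tendsto' hlim fun n ↦ ?_
  have hmem := h.memLp_fracDeriv hβ n
  have hsplit := integral_sub_sq_le (h.memLp.sub hmem) hmem.neg
  have hderiv := (h.approx.isTest n).integral_fracDeriv_sq_le hβ hβ' hθ
  have hnorm := h.approx.testNormSq_le (by linarith) (by linarith) n
  simp only [Pi.sub_apply, Pi.neg_apply, sub_neg_eq_add, sub_add_cancel, neg_sq] at hsplit
  linarith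

theorem hNormSq_le (h : FracApprox β θ φ a w) (hβ : 0 < β) (hβ1 : β ≤ 1) {κ : ℝ} (hκ0 : 0 ≤ κ)
    {c : ℝ} (hκ : ∀ w, IsTest w →
      κ * testNormSq (1 - β) w ≤ ∫ x, (fracDeriv β θ w x - c) ^ 2 ∂vol01) :
    κ * hNormSq (1 - β) φ ≤ 4 * ∫ x, (a x - c) ^ 2 ∂vol01 := by
  have hlim : Tendsto (fun n ↦ 4 * (∫ x, (a x - c) ^ 2 ∂vol01) +
      4 * (∫ x, (a x - fracDeriv β θ (w n) x) ^ 2 ∂vol01) +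
      2 * κ * hNormSq (1 - β) (φ - w n)) atTop (𝓝 (4 * ∫ x, (a x - c) ^ 2 ∂vol01)) := by
    simpa using ((h.tendsto.const_mul 4).const_add _).add (h.approx.tendsto.const_mul (2 * κ))
  refine ge_of_tendsto' hlim fun n ↦ ?_
  have hsplit := integral_sub_sq_le (h.memLp.sub (memLp_const c))
    (h.memLp.sub (h.memLp_fracDeriv hβ n))
  have hderiv := hκ _ (h.approx.isTest n)
  have hnorm := mul_le_mul_of_nonneg_left
    (h.approx.hNormSq_le (by linarith) (by linarith) n) hκ0
  simp only [Pi.sub_apply, sub_sub_sub_cancel_left] at hsplit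
  linarith

theorem add_linear_eq (h : FracApprox β θ φ a w) (hβ : 0 < β) (hβ' : β < 1 / 2) (p q : ℝ) {x : ℝ}
    (hx : x ∈ Icc (0 : ℝ) 1) :
    twoSidedInt β θ φ x + (p - (1 - θ) * rightInt β φ 0) * (1 - x) + (q - θ * leftInt β φ 1) * x =
      p + primitive (fun t ↦ a t - ((∫ t, a t ∂vol01) - (q - p))) x := by
  have hprim := primitive_sub h.memLp (memLp_const ((∫ t, a t ∂vol01) - (q - p))) hx
  rw [primitive_const] at hprim
  rw [← twoSidedInt_zero, ← twoSidedInt_one, h.twoSidedInt_eq hβ hβ' hx,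
    h.twoSidedInt_eq hβ hβ' (x := 1) (by simp), primitive_one]
  refine Eq.trans ?_ (congrArg (p + ·) hprim.symm)
  ring

theorem solves_iff (h : FracApprox β θ φ a w) (hβ : 0 < β) (hβ' : β < 1 / 2) :
    Solves β θ g φ ↔ g =ᵐ[vol01] fun x ↦ contRep g 0 +
      primitive (fun t ↦ a t - ((∫ t, a t ∂vol01) - (contRep g 1 - contRep g 0))) x := by
  have heq := (ae_restrict_mem (μ := volume) (measurableSet_Ioo (a := (0 : ℝ)) (b := 1))).mono
    fun x hx ↦ h.add_linear_eq hβ hβ' (contRep g 0) (contRep g 1) (Ioo_subset_Icc_self hx)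
  rw [Solves, eventuallyEq_comm]
  exact ⟨fun hs ↦ hs.trans heq, fun hs ↦ hs.trans (EventuallyEq.symm heq)⟩

theorem ae_eq_zero (h : FracApprox β θ φ a w) (hβ : 0 < β) (hβ' : β < 1 / 2)
    (hθ : θ ∈ Icc (0 : ℝ) 1) {c : ℝ} (ha : a =ᵐ[vol01] fun _ ↦ c) : φ =ᵐ[vol01] 0 := by
  obtain ⟨κ, hκ0, hκ⟩ := exists_testNormSq_le hβ hβ' hθ
  have hint : ∫ x, (a x - c) ^ 2 ∂vol01 = 0 :=
    integral_eq_zero_of_ae (ha.mono fun x hx ↦ by simp [hx])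
  have hle := h.hNormSq_le hβ (by linarith) hκ0.le fun w hw ↦ hκ w hw c
  rw [hint, mul_zero] at hle
  have hsq : ∫ x, φ x ^ 2 ∂vol01 ≤ 0 :=
    (le_add_of_nonneg_right (integral_nonneg fun _ ↦ sq_nonneg _)).trans
      (nonpos_of_mul_nonpos_right hle hκ0)
  have hzero := (integral_eq_zero_iff_of_nonneg (fun x ↦ sq_nonneg (φ x))
    h.approx.memH.1.integrable_sq).1 (le_antisymm hsq (integral_nonneg fun _ ↦ sq_nonneg _))
  exact hzero.mono fun x hx ↦ sq_eq_zero_iff.1 hx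

theorem ae_eq_of_solves (h : FracApprox β θ φ a w) (k : FracApprox β θ ψ b u) (hβ : 0 < β)
    (hβ' : β < 1 / 2) (hθ : θ ∈ Icc (0 : ℝ) 1) (hφ : Solves β θ g φ) (hψ : Solves β θ g ψ) :
    φ =ᵐ[vol01] ψ := by
  rw [h.solves_iff hβ hβ'] at hφ
  rw [k.solves_iff hβ hβ'] at hψ
  have hweak := (hasWeakDeriv_of_ae_eq (h.memLp.sub (memLp_const _)) hφ).ae_eq
    (hasWeakDeriv_of_ae_eq (k.memLp.sub (memLp_const _)) hψ)
  have hconst : a - b =ᵐ[vol01] fun _ ↦ (∫ t, a t ∂vol01) - ∫ t, b t ∂vol01 :=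
    hweak.mono fun x hx ↦ by
      simp only [Pi.sub_apply] at hx ⊢
      linarith
  exact ((h.sub k hβ (by linarith)).ae_eq_zero hβ hβ' hθ hconst).mono fun x hx ↦ sub_eq_zero.1 hx

theorem memH10 (h : FracApprox β θ φ a w) (hβ : 0 < β) (hβ' : β < 1 / 2) :
    MemH10 (fun x ↦ twoSidedInt β θ φ x
      - (1 - θ) * rightInt β φ 0 * (1 - x) - θ * leftInt β φ 1 * x) := by
  refine memH10_of_ae_eq (h.memLp.sub (memLp_const (∫ t, a t ∂vol01))) ?_ ?_
  · simp only [Pi.sub_apply]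
    rw [integral_sub (h.memLp.integrable one_le_two) (integrable_const _)]
    simp
  · filter_upwards [ae_restrict_mem measurableSet_Ioo] with x hx
    have heq := h.add_linear_eq hβ hβ' 0 0 (Ioo_subset_Icc_self hx)
    rw [sub_zero, sub_zero, zero_add] at heq
    refine Eq.trans ?_ heq
    ring

theorem hasWeakDeriv_of_solves (h : FracApprox β θ φ a w) (hβ : 0 < β) (hβ' : β < 1 / 2)
    (hg : MemH10 g) (hs : Solves β θ g φ) :
    HasWeakDeriv g (fun x ↦ a x - ∫ t, a t ∂vol01) ∧
      g =ᵐ[vol01] primitive (fun x ↦ a x - ∫ t, a t ∂vol01) := by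
  obtain ⟨d, hd, hd0, hgd⟩ := hg.exists_ae_eq
  have hgd' : g =ᵐ[vol01] fun x ↦ 0 + primitive d x := by simpa only [zero_add] using hgd
  rw [h.solves_iff hβ hβ', contRep_one hd hgd', contRep_zero hd hgd', hd0, zero_add, sub_zero,
    sub_zero] at hs
  exact ⟨hasWeakDeriv_of_ae_eq (h.memLp.sub (memLp_const _)) hs, by simpa only [zero_add] using hs⟩

theorem h1Norm_bounds (h : FracApprox β θ φ a w) (hβ : 0 < β) (hβ' : β < 1 / 2)
    (hg : MemH10 g) (hs : Solves β θ g φ) :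
    √(∫ x, (a x - ∫ t, a t ∂vol01) ^ 2 ∂vol01) ≤ h1Norm g ∧
      h1Norm g ≤ √(8 * ∫ x, a x ^ 2 ∂vol01) := by
  obtain ⟨hweak, hprim⟩ := h.hasWeakDeriv_of_solves hβ hβ' hg hs
  set m := ∫ t, a t ∂vol01 with hm
  have hgsq : ∫ x, g x ^ 2 ∂vol01 ≤ ∫ x, (a x - m) ^ 2 ∂vol01 := by
    rw [integral_congr_ae (hprim.mono fun x hx ↦ by simp only [hx] :
      (fun x ↦ g x ^ 2) =ᵐ[vol01] fun x ↦ primitive (fun x ↦ a x - m) x ^ 2)]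
    exact integral_primitive_sq_le hweak.1
  have hgsq0 : 0 ≤ ∫ x, g x ^ 2 ∂vol01 := integral_nonneg fun _ ↦ sq_nonneg _
  have hmsq : m ^ 2 ≤ ∫ x, a x ^ 2 ∂vol01 := by
    rw [hm, ← primitive_one]
    exact sq_primitive_le h.memLp (by simp)
  have hsplit : ∫ x, (a x - m) ^ 2 ∂vol01 ≤ 2 * (∫ x, a x ^ 2 ∂vol01) + 2 * m ^ 2 := by
    simpa using integral_sub_sq_le h.memLp (memLp_const m)
  rw [h1Norm_eq hweak]
  exact ⟨Real.sqrt_le_sqrt (by linarith), Real.sqrt_le_sqrt (by linarith)⟩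

end FracApprox

theorem exists_solves (hβ : 0 < β) (hβ' : β < 1 / 2) (hθ : θ ∈ Icc (0 : ℝ) 1) {g : ℝ → ℝ}
    (hg : MemH1 g) : ∃ (φ a : ℝ → ℝ) (w : ℕ → ℝ → ℝ), FracApprox β θ φ a w ∧ Solves β θ g φ := by
  obtain ⟨hgm, d, hd⟩ := hg
  obtain ⟨p, hp⟩ := hd.exists_ae_eq hgm
  obtain ⟨c, φ, w, h⟩ := exists_fracApprox_sub_const hβ hβ' hθ hd.1
  refine ⟨φ, _, w, h, (h.solves_iff hβ hβ').2 ?_⟩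
  rw [contRep_zero hd.1 hp, contRep_one hd.1 hp,
    integral_sub (hd.1.integrable one_le_two) (integrable_const c)]
  simpa using hp

theorem exists_norm_equiv (hβ : 0 < β) (hβ' : β < 1 / 2) (hθ : θ ∈ Icc (0 : ℝ) 1) :
    ∃ C₃ C₄ : ℝ, 0 < C₃ ∧ 0 < C₄ ∧
      ∀ g φ : ℝ → ℝ, MemH10 g → MemH0 (1 - β) φ → Solves β θ g φ →
        C₃ * hNorm (1 - β) φ ≤ h1Norm g ∧ h1Norm g ≤ C₄ * hNorm (1 - β) φ := by
  obtain ⟨κ, hκ0, hκ⟩ := exists_testNormSq_le hβ hβ' hθ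
  refine ⟨√(κ / 4), √32, by positivity, by positivity, fun g φ hg hφ hs ↦ ?_⟩
  obtain ⟨a, w, h⟩ := hφ.exists_fracApprox hβ hβ'.le hθ
  obtain ⟨hlower, hupper⟩ := h.h1Norm_bounds hβ hβ' hg hs
  have hφ_le := h.hNormSq_le hβ (by linarith) hκ0.le fun w hw ↦ hκ w hw (∫ t, a t ∂vol01)
  have ha_le := h.integral_sq_le hβ hβ'.le hθ
  rw [hNorm_eq, ← Real.sqrt_mul (by positivity), ← Real.sqrt_mul (by positivity)]
  exact ⟨(Real.sqrt_le_sqrt (by linarith)).trans hlower,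
    hupper.trans (Real.sqrt_le_sqrt (by linarith))⟩

end FracInt

theorem theorem4p3 (β θ : ℝ) (hβ : 0 < β) (hβ' : β < 1 / 2) (hθ : 0 ≤ θ) (hθ' : θ ≤ 1) :
    -- unique solvability in `H₀^{1-β}(0,1)`
    (∀ g : ℝ → ℝ, MemH1 g →
      ∃ φ : ℝ → ℝ, MemH0 (1 - β) φ ∧ Solves β θ g φ ∧
        ∀ ψ : ℝ → ℝ, MemH0 (1 - β) ψ → Solves β θ g ψ → ψ =ᵐ[vol01] φ) ∧
    -- converse
    (∀ φ : ℝ → ℝ, MemH0 (1 - β) φ →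
      MemH10 (fun x ↦ twoSidedInt β θ φ x
        - (1 - θ) * rightInt β φ 0 * (1 - x) - θ * leftInt β φ 1 * x)) ∧
    -- norm equivalence
    (∃ C₃ C₄ : ℝ, 0 < C₃ ∧ 0 < C₄ ∧
      ∀ g φ : ℝ → ℝ, MemH10 g → MemH0 (1 - β) φ → Solves β θ g φ →
        C₃ * hNorm (1 - β) φ ≤ h1Norm g ∧ h1Norm g ≤ C₄ * hNorm (1 - β) φ) := by
  have hmem : θ ∈ Icc (0 : ℝ) 1 := ⟨hθ, hθ'⟩
  refine ⟨fun g hg ↦ ?_, fun φ hφ ↦ ?_, exists_norm_equiv hβ hβ' hmem⟩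
  · obtain ⟨φ, a, w, h, hs⟩ := exists_solves hβ hβ' hmem hg
    refine ⟨φ, h.approx.memH0, hs, fun ψ hψ hψs ↦ ?_⟩
    obtain ⟨b, u, k⟩ := hψ.exists_fracApprox hβ hβ'.le hmem
    exact k.ae_eq_of_solves h hβ hβ' hmem hψs hs
  · obtain ⟨a, w, h⟩ := hφ.exists_fracApprox hβ hβ'.le hmem
    exact h.memH10 hβ hβ'
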